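/- Let $m\ge 0$, $d\ge 1$, and let $(X,\mathcal X,\mu,(T_g)_{g\in\mathbb R^m})$ be a measure preserving $\mathbb R^m$-system: $(X,\mathcal X)$ is a standard Borel space, $\mu$ is a probability measure on it, and $(T_g)_{g\in\mathbb R^m}$ is an action of the group $\mathbb R^m$ on $X$ ($T_{g+h}=T_gT_h$, $T_0=\mathrm{id}$) by $\mu$-preserving maps such that $(g,x)\mapsto T_gx$ is measurable. For a subgroup $H$ of $\mathbb R^m$ acting (diagonally) on $X^{2^k}$, let $I(H)$ be the $\sigma$-algebra of measurable $H$-invariant sets. For subgroups $H_1,H_2,\dots$ define measures on $X^{2^k}$ inductively by $\mu_\emptyset=\mu$ and $\mu_{H_1,\dots,H_{k+1}}=\mu_{H_1,\dots,H_k}\times_{I(H_{k+1})}\mu_{H_1,\dots,H_k}$, the relatively independent product, characterized by $\int F\otimes G\,d\mu_{H_1,\dots,H_{k+1}}=\int \mathbb E(F\mid I(H_{k+1}))\,\mathbb E(G\mid I(H_{k+1}))\,d\mu_{H_1,\dots,H_k}$ for bounded measurable $F,G$ on $X^{2^k}$. For real $f\in L^\infty(\mu)$ put $\|f\|_{H_1,\dots,H_k}=\bigl(\int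 f^{\otimes 2^k}\,d\mu_{H_1,\dots,H_k}\bigr)^{1/2^k}$. Let $Z_{H_1,\dots,H_k}$ denote a sub-$\sigma$-algebra of $\mathcal X$ such that, for every real $f\in L^\infty(\mu)$, $\mathbb E(f\mid Z_{H_1,\dots,H_k})=0$ if and only if $\|f\|_{H_1,\dots,H_k}=0$. When $H_i=\{t\beta_i:t\in\mathbb R\}$ with $\beta_i\in\mathbb R^m$, write $Z_{\beta_1,\dots,\beta_k}$. Let $\alpha_1,\dots,\alpha_d\in\mathbb R^m$, and for $1\le i\le d$ let $Z_i=Z_{\alpha_i,\alpha_1-\alpha_i,\dots,\alpha_d-\alpha_i}$, where the term $\alpha_j-\alpha_i$ with $j=i$ is omitted (so the list consists of the $d$ vectors $\alpha_i$ and $\alpha_j-\alpha_i$, $j\neq i$). Such $\sigma$-algebras $Z_i$ exist, and for every choice of them and all (real or complex) $f_1,\dots,f_d\in L^\infty(\mu)$ both limits $$\lim_{T\to\infty}\frac1T\int_0^T f_1(T_{t\alpha_1}x)\cdots f_d(T_{t\alpha_d}x)\,dt$$ and $$\lim_{T\to\infty}\frac1T\int_0^T \mathbb E(f_1\mid Z_1)(T_{t\alpha_1}x)\cdots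 \mathbb E(f_d\mid Z_d)(T_{t\alpha_d}x)\,dt$$ exist in $L^2(\mu)$ and coincide. Moreover, if both limits exist pointwise for $\mu$-a.e. $x\in X$, then the two pointwise limits coincide for $\mu$-a.e. $x\in X$. -/

import Mathlib

open MeasureTheory ProbabilityTheory Filter
open scoped Topology ENNReal

/-- The `σ`-algebra `I(H)` of all measurable sets that are invariant under every element of the
subgroup `H`. -/
abbrev invariantSigma {G : Type*} [AddGroup G] (X : Type*) [MeasurableSpace X] [AddAction G X]
    (H : AddSubgroup G) : MeasurableSpace X :=
  ⨅ h : H, MeasurableSpace.invariants (fun x : X => (h : G) +ᵥ x)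

theorem measurableSet_invariantSigma {G : Type*} [AddGroup G] {X : Type*} [MeasurableSpace X]
    [AddAction G X] {H : AddSubgroup G} {s : Set X} :
    MeasurableSet[invariantSigma X H] s ↔
      MeasurableSet s ∧ ∀ h ∈ H, (fun x : X => h +ᵥ x) ⁻¹' s = s := by
  unfold invariantSigma
  rw [MeasurableSpace.measurableSet_iInf]
  simp only [MeasurableSpace.measurableSet_invariants]
  exact ⟨fun h => ⟨(h 0).1, fun g hg => (h ⟨g, hg⟩).2⟩, fun h g => ⟨h.1, h.2 g g.2⟩⟩

theorem invariantSigma_le {G : Type*} [AddGroup G] {X : Type*} [mX : MeasurableSpace X]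
    [AddAction G X] (H : AddSubgroup G) : invariantSigma X H ≤ mX :=
  fun _ hs => (measurableSet_invariantSigma.1 hs).1

theorem measurable_condExpKernel_prod {X : Type*} (m : MeasurableSpace X) [mX : MeasurableSpace X]
    [StandardBorelSpace X] (hm : m ≤ mX) (μ : Measure X) [IsProbabilityMeasure μ] :
    Measurable[mX] fun x => (condExpKernel μ m x).prod (condExpKernel μ m x) := by
  have h := (condExpKernel μ m ×ₖ condExpKernel μ m).measurable
  have h2 : (fun x => (condExpKernel μ m ×ₖ condExpKernel μ m) x)
      = fun x => (condExpKernel μ m x).prod (condExpKernel μ m x) :=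
    funext fun x => Kernel.prod_apply _ _ x
  rw [← h2]
  exact h.mono hm le_rfl

/-- The relatively independent self-product `μ ×_m μ` over the `σ`-algebra `m`: the measure
`∫ μ_x × μ_x dμ(x)`, where `x ↦ μ_x` is the disintegration of `μ` over `m`. -/
noncomputable def relProd {X : Type*} (m : MeasurableSpace X) [mX : MeasurableSpace X]
    [StandardBorelSpace X] (hm : m ≤ mX) (μ : ProbabilityMeasure X) : ProbabilityMeasure (X × X) :=
  ⟨(μ : Measure X).bind fun x =>
      (condExpKernel (μ : Measure X) m x).prod (condExpKernel (μ : Measure X) m x),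
    isProbabilityMeasure_bind (measurable_condExpKernel_prod m hm μ).aemeasurable
      (ae_of_all _ fun _ => inferInstance)⟩

/-- The defining property of the relatively independent self-product:
`∫ f ⊗ g d(μ ×_m μ) = ∫ 𝔼(f | m) 𝔼(g | m) dμ`. -/
theorem integral_relProd {X : Type*} (m : MeasurableSpace X) [mX : MeasurableSpace X]
    [StandardBorelSpace X] (hm : m ≤ mX) (μ : ProbabilityMeasure X) {f g : X → ℝ}
    (hf : Measurable f) (hg : Measurable g) {C : ℝ} (hfC : ∀ x, |f x| ≤ C) (hgC : ∀ x, |g x| ≤ C) :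
    ∫ p, f p.1 * g p.2 ∂(relProd m hm μ : Measure (X × X)) =
      ∫ x, ((μ : Measure X)[f | m]) x * ((μ : Measure X)[g | m]) x ∂(μ : Measure X) := by
  have hfi : Integrable f (μ : Measure X) :=
    Integrable.of_bound hf.aestronglyMeasurable C (ae_of_all _ hfC)
  have hgi : Integrable g (μ : Measure X) :=
    Integrable.of_bound hg.aestronglyMeasurable C (ae_of_all _ hgC)
  have hK : ((relProd m hm μ : ProbabilityMeasure (X × X)) : Measure (X × X)) =
      ((⟨_, measurable_condExpKernel_prod m hm μ⟩ : Kernel X (X × X)) ∘ₖ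
        Kernel.const Unit (μ : Measure X)) () := rfl
  have hint : Integrable (fun p : X × X => f p.1 * g p.2)
      ((relProd m hm μ : ProbabilityMeasure (X × X)) : Measure (X × X)) := by
    refine Integrable.of_bound (by fun_prop) (C * C) (ae_of_all _ fun p => ?_)
    rw [norm_mul]
    exact mul_le_mul (hfC _) (hgC _) (norm_nonneg _) ((abs_nonneg _).trans (hfC p.1))
  rw [hK] at hint ⊢
  rw [Kernel.integral_comp hint]
  simp only [Kernel.const_apply]
  refine integral_congr_ae ?_
  filter_upwards [condExp_ae_eq_integral_condExpKernel hm hfi,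
    condExp_ae_eq_integral_condExpKernel hm hgi] with x h1 h2
  rw [h1, h2]
  exact integral_prod_mul f g

/-- The cube `X^[k] = X^(2^k)`, with coordinates indexed by `{0,1}^k`. It carries the product
`σ`-algebra, and a group acting on `X` acts on it diagonally (`T^[k]`). -/
abbrev Cube (X : Type*) (k : ℕ) : Type _ := (Fin k → Bool) → X

/-- The identification of `X^[k] × X^[k]` with `X^[k+1]`: the last digit of a coordinate
selects the first or the second factor. -/
def cubeGlue {X : Type*} (k : ℕ) (p : Cube X k × Cube X k) : Cube X (k + 1) :=
  fun ε => if ε (Fin.last k) then p.2 (Fin.init ε) else p.1 (Fin.init ε)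

theorem measurable_cubeGlue {X : Type*} [MeasurableSpace X] (k : ℕ) :
    Measurable (cubeGlue (X := X) k) := by
  refine measurable_pi_lambda _ fun ε => ?_
  by_cases h : ε (Fin.last k)
  · simp only [cubeGlue, if_pos h]; fun_prop
  · simp only [cubeGlue, if_neg h]; fun_prop

/-- The Host-Kra measure `μ_{H₁,…,H_k}` on `X^[k]`: it is `μ` for `k = 0`, and
`μ_{H₁,…,H_{k+1}} = μ_{H₁,…,H_k} ×_{I_Δ(H_{k+1})} μ_{H₁,…,H_k}`, where `I_Δ(H_{k+1})` consists of
the measurable subsets of `X^[k]` invariant under the diagonal action of `H_{k+1}`. -/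
noncomputable def hostKraMeasure {G : Type*} [AddGroup G] {X : Type*} [MeasurableSpace X]
    [StandardBorelSpace X] [AddAction G X] (μ : ProbabilityMeasure X) :
    (k : ℕ) → (Fin k → AddSubgroup G) → ProbabilityMeasure (Cube X k)
  | 0, _ => μ.map (f := fun x _ => x) (by fun_prop)
  | k + 1, H =>
    (relProd (invariantSigma (Cube X k) (H (Fin.last k))) (invariantSigma_le _)
      (hostKraMeasure μ k (Fin.init H))).map (measurable_cubeGlue k).aemeasurable

/-- The Host-Kra seminorm `‖f‖_{H₁,…,H_k} = (∫ f^{⊗ 2^k} dμ_{H₁,…,H_k})^{1/2^k}`. -/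
noncomputable def hostKraSeminorm {G : Type*} [AddGroup G] {X : Type*} [MeasurableSpace X]
    [StandardBorelSpace X] [AddAction G X] (μ : ProbabilityMeasure X) {k : ℕ}
    (H : Fin k → AddSubgroup G) (f : X → ℝ) : ℝ :=
  (∫ y, ∏ ε, f (y ε) ∂(hostKraMeasure μ k H : Measure (Cube X k))) ^ ((1 : ℝ) / 2 ^ k)

/-- `Z` is the Host-Kra characteristic factor `Z_{H₁,…,H_k}`: the sub-`σ`-algebra such that, for all
`f ∈ L^∞(μ)`, `𝔼(f | Z) = 0` if and only if `‖f‖_{H₁,…,H_k} = 0`.  It is determined up to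
`μ`-null sets. -/
def IsHostKraFactor {G : Type*} [AddGroup G] {X : Type*} (Z : MeasurableSpace X)
    [mX : MeasurableSpace X] [StandardBorelSpace X] [AddAction G X] (μ : ProbabilityMeasure X)
    {k : ℕ} (H : Fin k → AddSubgroup G) : Prop :=
  Z ≤ mX ∧ ∀ f : X → ℝ, MemLp f ∞ (μ : Measure X) →
    ((μ : Measure X)[f | Z] =ᵐ[(μ : Measure X)] 0 ↔ hostKraSeminorm μ H f = 0)

/-- The one-parameter subgroups `(tβ)_{t ∈ ℝ}` for `β = α_i, α_j - α_i (j ≠ i)`, in this order. -/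
def factorSubgroups {E : Type*} [AddCommGroup E] [Module ℝ E] {d : ℕ} (α : Fin (d + 1) → E)
    (i : Fin (d + 1)) : Fin (d + 1) → AddSubgroup E :=
  Fin.cons (Submodule.span ℝ {α i}).toAddSubgroup
    fun j : Fin d => (Submodule.span ℝ {α (i.succAbove j) - α i}).toAddSubgroup

/-- The multiple average `(1/T) ∫₀ᵀ ∏ᵢ fᵢ(T_{tαᵢ} x) dt`. -/
noncomputable def multipleAverage {𝕜 : Type*} [RCLike 𝕜] {E : Type*} [AddCommGroup E] [Module ℝ E]
    {X : Type*} [AddAction E X] {n : ℕ} (α : Fin n → E) (f : Fin n → X → 𝕜) (T : ℝ) (x : X) : 𝕜 :=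
  (1 / T : ℝ) • ∫ t in (0 : ℝ)..T, ∏ i, f i ((t • α i) +ᵥ x)

/-- `F T` (for `T > 0`) and `L` lie in `L²(μ)`, and `F T → L` in `L²(μ)` as `T → ∞`. -/
def TendstoInL2 {𝕜 : Type*} [RCLike 𝕜] {X : Type*} [MeasurableSpace X] (μ : Measure X)
    (F : ℝ → X → 𝕜) (L : X → 𝕜) : Prop :=
  (∀ T > 0, MemLp (F T) 2 μ) ∧ MemLp L 2 μ ∧
    Tendsto (fun T => eLpNorm (F T - L) 2 μ) atTop (𝓝 0)

/-!
Convergence of multiple averages along commuting flows, and their characteristic factors.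

Everything is proved for one-parameter subgroups `c : ℝ →+ G` of an arbitrary commutative group
`G` acting on `X`, with joint measurability required only along each subgroup
(`IsMeasurableFlow`); the generality is needed because the induction below replaces `X` by a cube
`X^[k]` and `G` by a group of coordinatewise translations of that cube. Averages over `[0, T]` are
integrals against the probability measure `uniformTime T`, and functions are normalized to take
values in `[-1, 1]` (`UnitBounded`).

*The cube measures.* By the mean ergodic theorem (`tendsto_flowAverage`) the relatively independent
square over the invariant sets of a flow is described by limits of averages, so it is invariant
under the flow acting on one factor alone and under diagonal symmetries. Iterating, the Host-Kra
measures are invariant under the side transformations (`measurePreserving_cubeShift_side`), and a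
function on the cube invariant under all of them depends only on the coordinate `0`
(`exists_ae_eq_comp_eval_zero`). In particular the conditional expectation of `f(x₀)` given the
other coordinates has the form `φ(x₀)` (`exists_condExp_offBase_ae_eq`).

*The factor.* The sets which, placed at the coordinate `0`, are determined by the other coordinates
form the `σ`-algebra `hostKraFactor`, and `φ = 𝔼(f | hostKraFactor)`. The Gowers-Cauchy-Schwarz
inequality (`abs_integral_prod_cube_pow_le`) shows that the seminorm of `f` vanishes exactly when
`f(x₀)` is orthogonal to all functions of the other coordinates, that is, when `φ = 0`.

*Control.* Repeated use of van der Corput's inequality bounds a power of the `L²` norm of a long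
multiple average by a power of the seminorm of any one of its functions, up to a small error, for
the subgroups `a, b₁ - a, …, b_d - a` where `a` is the subgroup along which that function moves
(`tendsto_integral_sq_pointedAverage_zero`).

*Convergence.* The induction is on the number of functions (`isL2Cauchy_multiFlowAverage`). The
first function `f` may be replaced by `φ`, since `f - φ` has vanishing seminorm. The average is then
lifted to the cube, keeping the coordinate `0` equal to the given point; there `φ(x₀)` is a function
of the other coordinates, hence a limit of combinations of products of functions of single
coordinates `ε ≠ 0`. Every such function is invariant under one of the flows that move one side
of the cube through `0`, and so can be taken out of the average or merged with another function.
This leaves one function fewer.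

*Conclusion.* If `𝔼(f | Zᵢ) = 0`, the averages with `f` in place `i` tend to zero; replacing the
functions one at a time by their conditional expectations therefore does not change the limit
(`tendsto_eLpNorm_multiFlowAverage_condExp_sub`). Pointwise limits agree with limits in mean along
a subsequence.
-/

/-! ### Functions bounded by one, and uniform averages over `[0, T]` -/

/-- A measurable real function with values in `[-1, 1]`. -/
structure UnitBounded {X : Type*} [MeasurableSpace X] (f : X → ℝ) : Prop where
  measurable : Measurable f
  bound : ∀ x, |f x| ≤ 1

namespace UnitBounded

variable {X Y : Type*} [MeasurableSpace X] [MeasurableSpace Y]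

theorem comp {f : X → ℝ} (hf : UnitBounded f) {φ : Y → X} (hφ : Measurable φ) :
    UnitBounded fun y => f (φ y) :=
  ⟨hf.measurable.comp hφ, fun _ => hf.bound _⟩

theorem const {c : ℝ} (hc : |c| ≤ 1) : UnitBounded fun _ : X => c :=
  ⟨measurable_const, fun _ => hc⟩

theorem mul {f g : X → ℝ} (hf : UnitBounded f) (hg : UnitBounded g) :
    UnitBounded fun x => f x * g x :=
  ⟨hf.measurable.mul hg.measurable, fun x => by
    rw [abs_mul]; exact mul_le_one₀ (hf.bound x) (abs_nonneg _) (hg.bound x)⟩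

theorem prod {ι : Type*} {s : Finset ι} {f : ι → X → ℝ} (hf : ∀ i, UnitBounded (f i)) :
    UnitBounded fun x => ∏ i ∈ s, f i x :=
  ⟨Finset.measurable_prod _ fun i _ => (hf i).measurable, fun x => by
    rw [Finset.abs_prod]
    exact Finset.prod_le_one (fun _ _ => abs_nonneg _) fun i _ => (hf i).bound x⟩

theorem pow {f : X → ℝ} (hf : UnitBounded f) (n : ℕ) : UnitBounded fun x => f x ^ n :=
  ⟨hf.measurable.pow_const n, fun x => by
    rw [abs_pow]; exact pow_le_one₀ (abs_nonneg _) (hf.bound x)⟩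

theorem half_sub {f g : X → ℝ} (hf : UnitBounded f) (hg : UnitBounded g) :
    UnitBounded fun x => (f x - g x) / 2 :=
  ⟨(hf.measurable.sub hg.measurable).div_const 2, fun x => by
    have := abs_le.1 (hf.bound x); have := abs_le.1 (hg.bound x)
    rw [abs_le]; constructor <;> linarith⟩

theorem indicator {s : Set X} (hs : MeasurableSet s) :
    UnitBounded (s.indicator fun _ => (1 : ℝ)) :=
  ⟨measurable_const.indicator hs, fun x => by
    by_cases h : x ∈ s <;> simp [h]⟩

theorem integrable {f : X → ℝ} (hf : UnitBounded f) (μ : Measure X) [IsFiniteMeasure μ] :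
    Integrable f μ :=
  Integrable.of_bound hf.measurable.aestronglyMeasurable 1 (ae_of_all _ hf.bound)

theorem memLp {f : X → ℝ} (hf : UnitBounded f) (μ : Measure X) [IsFiniteMeasure μ] (p : ℝ≥0∞) :
    MemLp f p μ :=
  MemLp.of_bound hf.measurable.aestronglyMeasurable 1 (ae_of_all _ hf.bound)

theorem abs_integral_le {f : X → ℝ} (hf : UnitBounded f) (μ : Measure X)
    [IsProbabilityMeasure μ] : |∫ x, f x ∂μ| ≤ 1 := by
  have := norm_integral_le_of_norm_le_const (μ := μ) (f := f) (C := 1) (ae_of_all _ hf.bound)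
  simpa using this

theorem integral_left {f : Y × X → ℝ} (hf : UnitBounded f) (P : Measure Y)
    [IsProbabilityMeasure P] : UnitBounded fun x => ∫ y, f (y, x) ∂P :=
  ⟨(hf.measurable.stronglyMeasurable.integral_prod_left' (μ := P)).measurable, fun x =>
    (hf.comp (φ := fun y => (y, x)) (by fun_prop)).abs_integral_le P⟩

theorem integral_right {f : X × Y → ℝ} (hf : UnitBounded f) (P : Measure Y)
    [IsProbabilityMeasure P] : UnitBounded fun x => ∫ y, f (x, y) ∂P :=
  (hf.comp (φ := Prod.swap) measurable_swap).integral_left P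

theorem integral_swap {f : X × Y → ℝ} (hf : UnitBounded f) (μ : Measure X) (ν : Measure Y)
    [IsProbabilityMeasure μ] [IsProbabilityMeasure ν] :
    ∫ x, ∫ y, f (x, y) ∂ν ∂μ = ∫ y, ∫ x, f (x, y) ∂μ ∂ν :=
  integral_integral_swap (f := fun x y => f (x, y)) (hf.integrable _)

/-- A bounded conditional expectation has a version that is measurable over the small
`σ`-algebra and bounded everywhere. -/
theorem exists_condExp {X : Type*} (m : MeasurableSpace X) [mX : MeasurableSpace X] {f : X → ℝ}
    (hf : UnitBounded f) (μ : Measure X) [IsProbabilityMeasure μ] :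
    ∃ g : X → ℝ, Measurable[m] g ∧ (∀ x, |g x| ≤ 1) ∧ g =ᵐ[μ] μ[f | m] := by
  refine ⟨fun x => max (-1) (min 1 (μ[f | m] x)), ?_, fun x => ?_, ?_⟩
  · have h1 : Measurable[m] (μ[f | m]) := stronglyMeasurable_condExp.measurable
    exact (measurable_const).max (measurable_const.min h1)
  · rw [abs_le]
    exact ⟨le_max_left _ _, max_le (by norm_num) (min_le_left _ _)⟩
  · have := ae_bdd_abs_condExp_of_ae_bdd_abs (μ := μ) (m := m) (R := (1 : ℝ)) (f := f)
      (ae_of_all _ hf.bound)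
    filter_upwards [this] with x hx
    rw [abs_le] at hx
    rw [min_eq_right hx.2, max_eq_right hx.1]

end UnitBounded

theorem abs_integral_pow_le {X : Type*} [MeasurableSpace X] {f : X → ℝ} (hf : UnitBounded f)
    (P : Measure X) [IsProbabilityMeasure P] (n : ℕ) :
    |∫ x, f x ∂P| ^ n ≤ ∫ x, |f x| ^ n ∂P := by
  have ha : UnitBounded fun x => |f x| := ⟨hf.measurable.abs, fun x => by simpa using hf.bound x⟩
  refine (pow_le_pow_left₀ (abs_nonneg _) (abs_integral_le_integral_abs) n).trans ?_
  exact (convexOn_pow n).map_integral_le (continuous_pow n).continuousOn isClosed_Ici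
    (ae_of_all _ fun x => abs_nonneg (f x)) (ha.integrable P) ((ha.pow n).integrable P)

theorem sq_integral_le {X : Type*} [MeasurableSpace X] {f : X → ℝ} (hf : UnitBounded f)
    (P : Measure X) [IsProbabilityMeasure P] :
    (∫ x, f x ∂P) ^ 2 ≤ ∫ x, f x ^ 2 ∂P := by
  simpa using abs_integral_pow_le hf P 2

/-- The uniform probability measure on `[0, T]`, as the law of `T` times a uniform variable on
`[0, 1]`; this makes it a probability measure for every real `T`. -/
noncomputable def uniformTime (T : ℝ) : Measure ℝ :=
  (volume.restrict (Set.Ioc (0 : ℝ) 1)).map (T * ·)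

instance (T : ℝ) : IsProbabilityMeasure (uniformTime T) := by
  have : IsProbabilityMeasure (volume.restrict (Set.Ioc (0 : ℝ) 1)) := ⟨by simp⟩
  exact Measure.isProbabilityMeasure_map (by fun_prop)

theorem integral_uniformTime {E : Type*} [NormedAddCommGroup E] [NormedSpace ℝ E] {T : ℝ}
    (hT : 0 < T) (φ : ℝ → E) :
    ∫ t, φ t ∂uniformTime T = (1 / T) • ∫ t in (0 : ℝ)..T, φ t := by
  rw [uniformTime, (measurableEmbedding_mulLeft₀ hT.ne').integral_map,
    ← intervalIntegral.integral_of_le zero_le_one,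
    intervalIntegral.integral_comp_mul_left _ hT.ne']
  simp

theorem ae_uniformTime_mem {T : ℝ} (hT : 0 ≤ T) : ∀ᵐ t ∂uniformTime T, t ∈ Set.Icc 0 T := by
  refine (ae_map_iff (by fun_prop) measurableSet_Icc).2 ?_
  filter_upwards [ae_restrict_mem measurableSet_Ioc] with t ht
  exact ⟨by have := ht.1; positivity, mul_le_of_le_one_right hT ht.2⟩

theorem abs_integral_uniformTime_shift_sub_le {φ : ℝ → ℝ} (hφ : UnitBounded φ) {T : ℝ}
    (hT : 0 < T) (s : ℝ) :
    |∫ t, φ (t + s) ∂uniformTime T - ∫ t, φ t ∂uniformTime T| ≤ 2 * |s| / T := by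
  have hi : ∀ a b, IntervalIntegrable φ volume a b := fun a b =>
    ⟨hφ.integrable _, hφ.integrable _⟩
  have hb : ∀ a b, |∫ t in a..b, φ t| ≤ |b - a| := fun a b => by
    simpa using intervalIntegral.norm_integral_le_of_norm_le_const (a := a) (b := b) (f := φ)
      (C := 1) fun x _ => hφ.bound x
  rw [integral_uniformTime hT, integral_uniformTime hT, ← smul_sub,
    intervalIntegral.integral_comp_add_right φ s,
    intervalIntegral.integral_interval_sub_interval_comm (hi _ _) (hi _ _) (hi _ _), smul_eq_mul,
    abs_mul, abs_of_pos (by positivity : 0 < 1 / T), one_div, inv_mul_eq_div]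
  gcongr
  refine (abs_sub _ _).trans ?_
  have h1 := hb (0 + s) 0
  have h2 := hb (T + s) T
  simp only [zero_add, zero_sub, abs_neg] at h1
  rw [sub_add_cancel_left, abs_neg] at h2
  simp only [zero_add]
  linarith

/-! ### Measurable flows and the mean ergodic theorem -/

theorem eLpNorm_two_eq_ofReal {X E : Type*} [MeasurableSpace X] [NormedAddCommGroup E]
    {μ : Measure X} {w : X → E} (hw : MemLp w 2 μ) :
    eLpNorm w 2 μ = ENNReal.ofReal (√(∫ x, ‖w x‖ ^ 2 ∂μ)) := by
  rw [hw.eLpNorm_eq_integral_rpow_norm (by norm_num) (by norm_num), Real.sqrt_eq_rpow]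
  norm_num

theorem tendsto_eLpNorm_two_iff {ι X E : Type*} [MeasurableSpace X] [NormedAddCommGroup E]
    {μ : Measure X} {l : Filter ι} {w : ι → X → E} (hw : ∀ᶠ i in l, MemLp (w i) 2 μ) :
    Tendsto (fun i => eLpNorm (w i) 2 μ) l (𝓝 0) ↔
      Tendsto (fun i => ∫ x, ‖w i x‖ ^ 2 ∂μ) l (𝓝 0) := by
  have h0 : ∀ i, 0 ≤ ∫ x, ‖w i x‖ ^ 2 ∂μ := fun i => integral_nonneg fun x => by positivity
  have e1 : (fun i => eLpNorm (w i) 2 μ) =ᶠ[l]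
      fun i => ENNReal.ofReal (√(∫ x, ‖w i x‖ ^ 2 ∂μ)) :=
    hw.mono fun i hi => eLpNorm_two_eq_ofReal hi
  rw [tendsto_congr' e1]
  constructor
  · intro h
    have h2 := (ENNReal.tendsto_toReal ENNReal.zero_ne_top).comp h
    have h3 := h2.pow 2
    simp only [Function.comp_def, ENNReal.toReal_zero, ne_eq, OfNat.ofNat_ne_zero,
      not_false_eq_true, zero_pow] at h3
    refine h3.congr fun i => ?_
    rw [ENNReal.toReal_ofReal (Real.sqrt_nonneg _), Real.sq_sqrt (h0 i)]
  · intro h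
    have := ENNReal.tendsto_ofReal ((Real.continuous_sqrt.tendsto 0).comp h)
    simpa [Function.comp_def] using this

/-- A one-parameter subgroup `a` of `G` acts measurably on `X`, jointly in time and space. -/
def IsMeasurableFlow {G : Type*} [AddCommGroup G] (X : Type*) [MeasurableSpace X]
    [AddAction G X] (a : ℝ →+ G) : Prop :=
  Measurable fun p : ℝ × X => a p.1 +ᵥ p.2

namespace IsMeasurableFlow

variable {G : Type*} [AddCommGroup G] {X : Type*} [MeasurableSpace X] [AddAction G X]
  {a b : ℝ →+ G}

theorem vadd {Ω : Type*} [MeasurableSpace Ω] (ha : IsMeasurableFlow X a) {s : Ω → ℝ}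
    {ξ : Ω → X} (hs : Measurable s) (hξ : Measurable ξ) : Measurable fun z => a (s z) +ᵥ ξ z :=
  Measurable.comp (g := fun p : ℝ × X => a p.1 +ᵥ p.2) ha (hs.prodMk hξ)

theorem vadd_const (ha : IsMeasurableFlow X a) (t : ℝ) : Measurable fun x : X => a t +ᵥ x :=
  ha.vadd measurable_const measurable_id

theorem add (ha : IsMeasurableFlow X a) (hb : IsMeasurableFlow X b) :
    IsMeasurableFlow X (a + b) := by
  have := ha.vadd measurable_fst (hb.vadd measurable_fst measurable_snd)
  simpa only [IsMeasurableFlow, AddMonoidHom.add_apply, add_vadd] using this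

theorem neg (ha : IsMeasurableFlow X a) : IsMeasurableFlow X (-a) := by
  have := ha.vadd (s := fun p : ℝ × X => -p.1) measurable_fst.neg measurable_snd
  simpa only [IsMeasurableFlow, AddMonoidHom.neg_apply, map_neg] using this

theorem sub (ha : IsMeasurableFlow X a) (hb : IsMeasurableFlow X b) :
    IsMeasurableFlow X (a - b) := by
  rw [sub_eq_add_neg]; exact ha.add hb.neg

end IsMeasurableFlow

theorem integral_vadd_eq {G : Type*} [AddCommGroup G] {X : Type*} [MeasurableSpace X]
    [AddAction G X] [MeasurableConstVAdd G X] (μ : Measure X) [VAddInvariantMeasure G X μ]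
    (g : G) (f : X → ℝ) : ∫ x, f (g +ᵥ x) ∂μ = ∫ x, f x ∂μ :=
  (measurePreserving_vadd g μ).integral_comp (measurableEmbedding_const_vadd g) f

/-- The average of `F` over the piece of orbit `{a t +ᵥ x : 0 ≤ t ≤ T}`. -/
noncomputable def flowAverage {G : Type*} [AddCommGroup G] {X : Type*} [AddAction G X]
    (a : ℝ →+ G) (F : X → ℝ) (T : ℝ) (x : X) : ℝ :=
  ∫ t, F (a t +ᵥ x) ∂uniformTime T

section MeanErgodic

variable {G : Type*} [AddCommGroup G] {X : Type*} [MeasurableSpace X] [AddAction G X]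
  {a : ℝ →+ G} {F : X → ℝ}

theorem UnitBounded.flowAverage (ha : IsMeasurableFlow X a) (hF : UnitBounded F) (T : ℝ) :
    UnitBounded (flowAverage a F T) :=
  (hF.comp (φ := fun p : ℝ × X => a p.1 +ᵥ p.2) ha).integral_left (uniformTime T)

theorem tendsto_flowAverage_vadd_sub (ha : IsMeasurableFlow X a) (hF : UnitBounded F) (s : ℝ)
    (x : X) : Tendsto (fun N : ℕ => flowAverage a F N (a s +ᵥ x) - flowAverage a F N x)
      atTop (𝓝 0) := by
  have hφ : UnitBounded fun t : ℝ => F (a t +ᵥ x) :=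
    hF.comp (ha.vadd measurable_id measurable_const)
  have h : Tendsto (fun N : ℕ => 2 * |s| / (N : ℝ)) atTop (𝓝 0) :=
    tendsto_const_div_atTop_nhds_zero_nat _
  refine squeeze_zero_norm' ?_ h
  filter_upwards [eventually_gt_atTop 0] with N hN
  have := abs_integral_uniformTime_shift_sub_le hφ (T := N) (by exact_mod_cast hN) s
  simpa only [flowAverage, vadd_vadd, map_add, Real.norm_eq_abs] using this

theorem flowAverage_natCast_eq_sum (ha : IsMeasurableFlow X a) (hF : UnitBounded F) {N : ℕ}
    (hN : 0 < N) (x : X) :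
    flowAverage a F N x =
      (N : ℝ)⁻¹ * ∑ k ∈ Finset.range N, flowAverage a F 1 (a (k : ℝ) +ᵥ x) := by
  have hφ : UnitBounded fun t : ℝ => F (a t +ᵥ x) :=
    hF.comp (ha.vadd measurable_id measurable_const)
  have hi : ∀ c d, IntervalIntegrable (fun t : ℝ => F (a t +ᵥ x)) volume c d := fun c d =>
    ⟨hφ.integrable _, hφ.integrable _⟩
  simp only [flowAverage]
  rw [integral_uniformTime (by exact_mod_cast hN), smul_eq_mul, one_div]
  congr 1
  have := intervalIntegral.sum_integral_adjacent_intervals (n := N) (a := fun k : ℕ => (k : ℝ))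
    (f := fun t : ℝ => F (a t +ᵥ x)) (μ := volume) fun k _ => hi _ _
  simp only [Nat.cast_zero] at this
  rw [← this]
  refine Finset.sum_congr rfl fun k _ => ?_
  rw [integral_uniformTime one_pos]
  simp only [vadd_vadd, ← map_add]
  rw [intervalIntegral.integral_comp_add_right (fun t => F (a t +ᵥ x)) (k : ℝ)]
  simp [add_comm]

variable [MeasurableConstVAdd G X] (μ : Measure X) [IsProbabilityMeasure μ]
  [VAddInvariantMeasure G X μ]

/-- Convergence along integers, from the mean ergodic theorem for the time-one map applied to the
average of `F` over `[0, 1]`. -/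
theorem exists_tendsto_toLp_flowAverage (ha : IsMeasurableFlow X a) (hF : UnitBounded F) :
    ∃ g : Lp ℝ 2 μ, Tendsto (fun N : ℕ => ((hF.flowAverage ha N).memLp μ 2).toLp _) atTop
      (𝓝 g) := by
  have hp := measurePreserving_vadd (a 1) μ
  let U : Lp ℝ 2 μ →ₗᵢ[ℝ] Lp ℝ 2 μ := Lp.compMeasurePreservingₗᵢ ℝ _ hp
  have hm : ∀ (k : ℕ), MemLp (fun x => flowAverage a F 1 (a (k : ℝ) +ᵥ x)) 2 μ := fun k =>
    ((hF.flowAverage ha 1).comp (ha.vadd_const _)).memLp μ 2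
  have hU : ∀ k : ℕ, U^[k] (((hF.flowAverage ha 1).memLp μ 2).toLp _) = (hm k).toLp _ := by
    intro k
    induction k with
    | zero => simp
    | succ k ih =>
      rw [Function.iterate_succ_apply', ih]
      refine (Lp.toLp_compMeasurePreserving (hm k) hp).trans ?_
      congr 1
      funext x
      simp [vadd_vadd, ← map_add]
  refine ⟨_, (ContinuousLinearMap.tendsto_birkhoffAverage_orthogonalProjection
    U.toContinuousLinearMap U.norm_toContinuousLinearMap_le
    (((hF.flowAverage ha 1).memLp μ 2).toLp _)).congr' ?_⟩
  filter_upwards [eventually_gt_atTop 0] with N hN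
  have hs : MemLp (fun x => (N : ℝ)⁻¹ * ∑ k ∈ Finset.range N,
      flowAverage a F 1 (a (k : ℝ) +ᵥ x)) 2 μ :=
    (memLp_finsetSum _ fun k _ => hm k).const_mul _
  have e1 : ((hF.flowAverage ha N).memLp μ 2).toLp _ = hs.toLp _ := by
    congr 1
    funext x
    exact flowAverage_natCast_eq_sum ha hF hN x
  rw [e1]
  have e2 : birkhoffAverage ℝ (⇑U.toContinuousLinearMap) id N
      (((hF.flowAverage ha 1).memLp μ 2).toLp _) =
      (N : ℝ)⁻¹ • ∑ k ∈ Finset.range N, (hm k).toLp _ := by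
    simp only [birkhoffAverage, birkhoffSum, id]
    congr 1
    exact Finset.sum_congr rfl fun k _ => hU k
  rw [e2]
  refine Lp.ext ?_
  refine (Lp.coeFn_smul _ _).trans ?_
  have h3 : ⇑(∑ k ∈ Finset.range N, (hm k).toLp _) =ᵐ[μ]
      fun x => ∑ k ∈ Finset.range N, flowAverage a F 1 (a (k : ℝ) +ᵥ x) := by
    refine (Lp.coeFn_fun_finsetSum _ _).trans ?_
    have : ∀ᵐ x ∂μ, ∀ k : ℕ, (hm k).toLp _ x = flowAverage a F 1 (a (k : ℝ) +ᵥ x) :=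
      ae_all_iff.2 fun k => (hm k).coeFn_toLp
    filter_upwards [this] with x hx
    exact Finset.sum_congr rfl fun k _ => hx k
  filter_upwards [h3, hs.coeFn_toLp] with x h4 h5
  rw [h5, Pi.smul_apply, h4, smul_eq_mul]

theorem setIntegral_flowAverage (ha : IsMeasurableFlow X a) (hF : UnitBounded F) (T : ℝ)
    {s : Set X} (hs : MeasurableSet[invariantSigma X a.range] s) :
    ∫ x in s, flowAverage a F T x ∂μ = ∫ x in s, F x ∂μ := by
  obtain ⟨hsm, hinv⟩ := measurableSet_invariantSigma.1 hs
  have hK : UnitBounded fun p : X × ℝ => s.indicator (fun _ => (1 : ℝ)) p.1 * F (a p.2 +ᵥ p.1) :=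
    ((UnitBounded.indicator hsm).comp measurable_fst).mul
      (hF.comp (ha.vadd measurable_snd measurable_fst))
  have e : ∀ (f : X → ℝ), ∫ x in s, f x ∂μ = ∫ x, s.indicator (fun _ => (1 : ℝ)) x * f x ∂μ := by
    intro f
    rw [← integral_indicator hsm]
    refine integral_congr_ae (ae_of_all _ fun x => ?_)
    by_cases h : x ∈ s <;> simp [h]
  rw [e, e]
  simp only [flowAverage, ← integral_const_mul]
  rw [hK.integral_swap]
  have : ∀ t, ∫ x, s.indicator (fun _ => (1 : ℝ)) x * F (a t +ᵥ x) ∂μ =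
      ∫ x, s.indicator (fun _ => (1 : ℝ)) x * F x ∂μ := by
    intro t
    rw [← integral_vadd_eq μ (a t) (fun x => s.indicator (fun _ => (1 : ℝ)) x * F x)]
    refine integral_congr_ae (ae_of_all _ fun x => ?_)
    have h1 : (a t +ᵥ x ∈ s) ↔ x ∈ s := by
      have := hinv (a t) ⟨t, rfl⟩
      exact Set.ext_iff.1 this x
    by_cases h : x ∈ s
    · simp [h, h1.2 h]
    · simp [h, mt h1.1 h]
  simp [this]

/-- The mean ergodic theorem for a measurable flow: the averages of `F` along the flow converge in
`L²` to the conditional expectation on the strictly invariant sets.  An almost everywhere limit of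
a subsequence of the averages is strictly invariant on the set where it exists, which is why strict
invariance (rather than invariance modulo null sets) suffices. -/
theorem tendsto_flowAverage (ha : IsMeasurableFlow X a) (hF : UnitBounded F) :
    Tendsto (fun N : ℕ => ∫ x, (flowAverage a F N x - μ[F | invariantSigma X a.range] x) ^ 2 ∂μ)
      atTop (𝓝 0) := by
  obtain ⟨g, hg⟩ := exists_tendsto_toLp_flowAverage μ ha hF
  have hu := fun N : ℕ => hF.flowAverage ha (N : ℝ)
  have hgL : Tendsto (fun N : ℕ => eLpNorm (flowAverage a F N - ⇑g) 2 μ) atTop (𝓝 0) := by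
    have := (Lp.tendsto_Lp_iff_tendsto_eLpNorm' _ _).1 hg
    refine this.congr fun N => eLpNorm_congr_ae ?_
    filter_upwards [((hu N).memLp μ 2).coeFn_toLp] with x hx
    simp [hx]
  obtain ⟨ns, hns, hlim⟩ := (tendstoInMeasure_of_tendsto_eLpNorm (by norm_num)
    (fun N => (hu N).measurable.aestronglyMeasurable)
    (Lp.aestronglyMeasurable g) hgL).exists_seq_tendsto_ae
  let C : Set X := {x | ∃ l, Tendsto (fun k => flowAverage a F (ns k : ℝ) x) atTop (𝓝 l)}
  have hC : MeasurableSet C := measurableSet_exists_tendsto fun k => (hu (ns k)).measurable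
  let g' : X → ℝ := C.indicator fun x => limsup (fun k => flowAverage a F (ns k : ℝ) x) atTop
  have hg'm : Measurable g' := (Measurable.limsup fun k => (hu (ns k)).measurable).indicator hC
  have hg'l : ∀ x l, Tendsto (fun k => flowAverage a F (ns k : ℝ) x) atTop (𝓝 l) → g' x = l := by
    intro x l hl
    have : x ∈ C := ⟨l, hl⟩
    simp only [g', Set.indicator_of_mem this]
    exact hl.limsup_eq
  have hshift : ∀ s x l, Tendsto (fun k => flowAverage a F (ns k : ℝ) x) atTop (𝓝 l) →
      Tendsto (fun k => flowAverage a F (ns k : ℝ) (a s +ᵥ x)) atTop (𝓝 l) := by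
    intro s x l hl
    have := ((tendsto_flowAverage_vadd_sub ha hF s x).comp hns.tendsto_atTop).add hl
    simpa using this
  have hinv : ∀ s x, g' (a s +ᵥ x) = g' x := by
    intro s x
    by_cases hx : x ∈ C
    · obtain ⟨l, hl⟩ := hx
      rw [hg'l x l hl, hg'l _ l (hshift s x l hl)]
    · have hx' : a s +ᵥ x ∉ C := by
        rintro ⟨l, hl⟩
        refine hx ⟨l, ?_⟩
        simpa using hshift (-s) _ l hl
      simp [g', hx, hx']
  have hg'I : Measurable[invariantSigma X a.range] g' := by
    intro B hB
    refine measurableSet_invariantSigma.2 ⟨hg'm hB, ?_⟩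
    rintro _ ⟨s, rfl⟩
    ext x
    simp [hinv]
  have hg'g : g' =ᵐ[μ] g := by
    filter_upwards [hlim] with x hx
    exact hg'l x _ hx
  have hg'i : Integrable g' μ := ((Lp.memLp g).integrable (by norm_num)).congr hg'g.symm
  have hE : g' =ᵐ[μ] μ[F | invariantSigma X a.range] := by
    refine ae_eq_condExp_of_forall_setIntegral_eq (invariantSigma_le _) (hF.integrable μ)
      (fun s _ _ => hg'i.integrableOn) (fun s hs _ => ?_)
      hg'I.stronglyMeasurable.aestronglyMeasurable
    refine tendsto_nhds_unique ?_ (tendsto_const_nhds (x := ∫ x in s, F x ∂μ) (f := atTop (α := ℕ)))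
    have := tendsto_integral_of_dominated_convergence (μ := μ.restrict s)
      (F := fun k => flowAverage a F (ns k : ℝ)) (f := g') (fun _ => 1)
      (fun k => (hu (ns k)).measurable.aestronglyMeasurable) (integrable_const _)
      (fun k => ae_of_all _ (hu (ns k)).bound) (ae_restrict_of_ae ?_)
    · exact this.congr fun k => setIntegral_flowAverage μ ha hF _ hs
    · filter_upwards [hlim, hg'g] with x hx hx'
      rw [hx']; exact hx
  have hgE : ∀ N : ℕ, flowAverage a F (N : ℝ) - ⇑g =ᵐ[μ]
      fun x => flowAverage a F (N : ℝ) x - μ[F | invariantSigma X a.range] x := fun N => by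
    filter_upwards [hE, hg'g] with x h1 h2
    rw [Pi.sub_apply, ← h1, h2]
  have h1 := (tendsto_eLpNorm_two_iff (μ := μ) (l := atTop)
    (w := fun N : ℕ => flowAverage a F (N : ℝ) - ⇑g)
    (Eventually.of_forall fun N => ((hu N).memLp μ 2).sub (Lp.memLp g))).1 hgL
  refine h1.congr fun N => integral_congr_ae ?_
  filter_upwards [hgE N] with x hx
  rw [hx, Real.norm_eq_abs, sq_abs]

end MeanErgodic

/-! ### Relatively independent self-products over the invariant sets of a flow -/

/-- An integrable function whose integrals vanish over the preimages of a generating `π`-system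
has vanishing integral over the preimage of every measurable set. -/
theorem setIntegral_preimage_eq_zero_of_generateFrom {Ω W : Type*} [MeasurableSpace Ω]
    [mW : MeasurableSpace W] {μ : Measure Ω} {K : Ω → ℝ} (hK : Integrable K μ) {r : Ω → W}
    (hr : Measurable r) {C : Set (Set W)} (hC : mW = MeasurableSpace.generateFrom C)
    (hpi : IsPiSystem C) (huniv : Set.univ ∈ C) (h : ∀ s ∈ C, ∫ x in r ⁻¹' s, K x ∂μ = 0)
    {s : Set W} (hs : MeasurableSet s) : ∫ x in r ⁻¹' s, K x ∂μ = 0 := by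
  have htot : ∫ x, K x ∂μ = 0 := by simpa using h _ huniv
  induction s, hs using MeasurableSpace.induction_on_inter hC hpi with
  | empty => simp
  | basic t ht => exact h t ht
  | compl t ht ih =>
    rw [Set.preimage_compl]
    have := integral_add_compl (hr ht) hK
    linarith
  | iUnion f hd hf ih =>
    rw [Set.preimage_iUnion, integral_iUnion (fun i => hr (hf i))
      (fun i j hij => (hd hij).preimage r) hK.integrableOn]
    simp [ih]

/-- Convergence in mean square implies convergence of the integrals against a bounded function. -/
theorem UnitBounded.integral_sq_sub_le_tendsto {Ω : Type*} [MeasurableSpace Ω] (μ : Measure Ω)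
    [IsProbabilityMeasure μ] {B e : Ω → ℝ} {w : ℕ → Ω → ℝ} (hB : UnitBounded B)
    (hw : ∀ N, UnitBounded (w N)) (he : UnitBounded e)
    (h : Tendsto (fun N => ∫ x, (w N x - e x) ^ 2 ∂μ) atTop (𝓝 0)) :
    Tendsto (fun N => ∫ x, B x * w N x ∂μ) atTop (𝓝 (∫ x, B x * e x ∂μ)) := by
  rw [← tendsto_sub_nhds_zero_iff]
  have hs := (Real.continuous_sqrt.tendsto 0).comp h
  rw [Real.sqrt_zero] at hs
  refine squeeze_zero_norm (fun N => ?_) hs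
  rw [← integral_sub ((hB.mul (hw N)).integrable μ) ((hB.mul he).integrable μ)]
  have hd := (hw N).half_sub he
  have h1 := sq_integral_le (hB.mul hd) μ
  have h2 : ∫ x, (B x * ((w N x - e x) / 2)) ^ 2 ∂μ ≤ ∫ x, ((w N x - e x) / 2) ^ 2 ∂μ := by
    refine integral_mono (((hB.mul hd).pow 2).integrable μ) ((hd.pow 2).integrable μ) fun x => ?_
    simp only [mul_pow]
    have := (sq_le_one_iff_abs_le_one _).2 (hB.bound x)
    nlinarith [sq_nonneg ((w N x - e x) / 2)]
  have e1 : ∫ x, B x * w N x - B x * e x ∂μ = 2 * ∫ x, B x * ((w N x - e x) / 2) ∂μ := by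
    rw [← integral_const_mul]; congr 1; funext x; ring
  have e2 : ∫ x, ((w N x - e x) / 2) ^ 2 ∂μ = (∫ x, (w N x - e x) ^ 2 ∂μ) / 4 := by
    rw [← integral_div]; congr 1; funext x; ring
  rw [e1, Real.norm_eq_abs]
  refine Real.abs_le_sqrt ?_
  rw [e2] at h2
  nlinarith

theorem integral_mul_condExp_version {Ω : Type*} (m : MeasurableSpace Ω) [mΩ : MeasurableSpace Ω]
    (hm : m ≤ mΩ) (μ : Measure Ω) [IsProbabilityMeasure μ] {f e h : Ω → ℝ}
    (hf : UnitBounded f) (he : e =ᵐ[μ] μ[f | m]) (hh : Measurable[m] h) (hh1 : ∀ x, |h x| ≤ 1) :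
    ∫ x, h x * e x ∂μ = ∫ x, h x * f x ∂μ := by
  have hh' : UnitBounded h := ⟨hh.mono hm le_rfl, hh1⟩
  have h1 : μ[h * f | m] =ᵐ[μ] h * μ[f | m] :=
    condExp_mul_of_stronglyMeasurable_left hh.stronglyMeasurable
      ((hh'.mul hf).integrable μ) (hf.integrable μ)
  calc ∫ x, h x * e x ∂μ = ∫ x, (μ[h * f | m]) x ∂μ := by
        refine integral_congr_ae ?_
        filter_upwards [h1, he] with x hx hx'
        rw [hx, hx', Pi.mul_apply]
    _ = ∫ x, h x * f x ∂μ := integral_condExp hm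

theorem measurePreserving_prodMap_of_integral {Y : Type*} [MeasurableSpace Y]
    {ρ : Measure (Y × Y)} [IsProbabilityMeasure ρ]
    {φ ψ : Y → Y} (hφ : Measurable φ) (hψ : Measurable ψ)
    (h : ∀ f g : Y → ℝ, UnitBounded f → UnitBounded g →
      ∫ p, f (φ p.1) * g (ψ p.2) ∂ρ = ∫ p, f p.1 * g p.2 ∂ρ) :
    MeasurePreserving (Prod.map φ ψ) ρ ρ := by
  refine ⟨hφ.prodMap hψ, ?_⟩
  have : IsProbabilityMeasure (ρ.map (Prod.map φ ψ)) :=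
    Measure.isProbabilityMeasure_map (hφ.prodMap hψ).aemeasurable
  refine Measure.ext_prod fun {s t} hs ht => ?_
  have key : ∀ u v : Set Y, MeasurableSet u → MeasurableSet v → ρ.real (u ×ˢ v) =
      ∫ p, u.indicator (fun _ => (1 : ℝ)) p.1 * v.indicator (fun _ => (1 : ℝ)) p.2 ∂ρ := by
    intro u v hu hv
    rw [← integral_indicator_one (hu.prod hv)]
    refine integral_congr_ae (ae_of_all _ fun p => ?_)
    by_cases h1 : p.1 ∈ u <;> by_cases h2 : p.2 ∈ v <;> simp [Set.indicator, h1, h2]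
  rw [Measure.map_apply (hφ.prodMap hψ) (hs.prod ht)]
  have e : Prod.map φ ψ ⁻¹' s ×ˢ t = (φ ⁻¹' s) ×ˢ (ψ ⁻¹' t) := rfl
  rw [e, ← measureReal_eq_measureReal_iff, key _ _ (hφ hs) (hψ ht), key _ _ hs ht]
  exact h _ _ (UnitBounded.indicator hs) (UnitBounded.indicator ht)

section RelProd

variable {G : Type*} [AddCommGroup G] {Y : Type*} [MeasurableSpace Y] [StandardBorelSpace Y]
  [AddAction G Y] {a : ℝ →+ G} (ν : ProbabilityMeasure Y)

/-- The relatively independent self-product of `ν` over the sets invariant under the flow `a`. -/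
noncomputable abbrev flowRelProd (a : ℝ →+ G) (ν : ProbabilityMeasure Y) : Measure (Y × Y) :=
  (relProd (invariantSigma Y a.range) (invariantSigma_le _) ν : ProbabilityMeasure (Y × Y))

theorem integral_flowRelProd {f g ef eg : Y → ℝ} (hf : UnitBounded f) (hg : UnitBounded g)
    (hef : ef =ᵐ[(ν : Measure Y)] (ν : Measure Y)[f | invariantSigma Y a.range])
    (heg : eg =ᵐ[(ν : Measure Y)] (ν : Measure Y)[g | invariantSigma Y a.range]) :
    ∫ p, f p.1 * g p.2 ∂flowRelProd a ν = ∫ y, ef y * eg y ∂(ν : Measure Y) := by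
  rw [integral_relProd _ (invariantSigma_le _) ν hf.measurable hg.measurable hf.bound hg.bound]
  refine integral_congr_ae ?_
  filter_upwards [hef, heg] with x h1 h2
  rw [h1, h2]

theorem integral_flowRelProd_eq_integral_mul {f g eg : Y → ℝ} (hf : UnitBounded f)
    (hg : UnitBounded g) (hegm : Measurable[invariantSigma Y a.range] eg)
    (hegb : ∀ x, |eg x| ≤ 1)
    (heg : eg =ᵐ[(ν : Measure Y)] (ν : Measure Y)[g | invariantSigma Y a.range]) :
    ∫ p, f p.1 * g p.2 ∂flowRelProd a ν = ∫ y, f y * eg y ∂(ν : Measure Y) := by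
  obtain ⟨ef, -, -, hef⟩ := UnitBounded.exists_condExp (invariantSigma Y a.range) hf (ν : Measure Y)
  rw [integral_flowRelProd ν hf hg hef heg]
  simp only [mul_comm _ (eg _)]
  exact integral_mul_condExp_version _ (invariantSigma_le _) _ hf hef hegm hegb

/-- A function measurable over the invariant sets takes the same value at both factors: by the
defining property of the measure, `∫ (e(y₂) - e(y₁))² = 0`. -/
theorem flowRelProd_ae_eq_of_measurable {e : Y → ℝ}
    (he : Measurable[invariantSigma Y a.range] e) (heb : ∀ x, |e x| ≤ 1) :
    ∀ᵐ p ∂flowRelProd a ν, e p.2 = e p.1 := by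
  have hI := invariantSigma_le (X := Y) a.range
  have hcond : ∀ {e' : Y → ℝ}, Measurable[invariantSigma Y a.range] e' → (∀ x, |e' x| ≤ 1) →
      UnitBounded e' ∧ e' =ᵐ[(ν : Measure Y)] (ν : Measure Y)[e' | invariantSigma Y a.range] := by
    intro e' h1 h2
    have hu : UnitBounded e' := ⟨h1.mono hI le_rfl, h2⟩
    exact ⟨hu, by rw [condExp_of_stronglyMeasurable hI h1.stronglyMeasurable (hu.integrable _)]⟩
  obtain ⟨hu, hc⟩ := hcond he heb
  have hu2 := hu.pow 2
  have hc2 := (hcond (he.pow_const 2) hu2.bound).2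
  obtain ⟨hu1, hc1⟩ := hcond (e' := fun _ => 1) measurable_const (by simp)
  have h12 := integral_flowRelProd ν hu hu hc hc
  have h11 := integral_flowRelProd ν hu2 hu1 hc2 hc1
  have h22 := integral_flowRelProd ν hu1 hu2 hc1 hc2
  have hd : UnitBounded fun p : Y × Y => (e p.2 - e p.1) / 2 :=
    (hu.comp measurable_snd).half_sub (hu.comp measurable_fst)
  have h0 : ∫ p, ((e p.2 - e p.1) / 2) ^ 2 ∂flowRelProd a ν = 0 := by
    have i1 : Integrable (fun p : Y × Y => e p.1 * e p.2) (flowRelProd a ν) :=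
      ((hu.comp measurable_fst).mul (hu.comp measurable_snd)).integrable _
    have i2 : Integrable (fun p : Y × Y => e p.1 ^ 2 * 1) (flowRelProd a ν) :=
      ((hu2.comp measurable_fst).mul (hu1.comp measurable_snd)).integrable _
    have i3 : Integrable (fun p : Y × Y => 1 * e p.2 ^ 2) (flowRelProd a ν) :=
      ((hu1.comp measurable_fst).mul (hu2.comp measurable_snd)).integrable _
    have : ∀ p : Y × Y, ((e p.2 - e p.1) / 2) ^ 2 =
        (1 / 4) * (e p.1 ^ 2 * 1 + 1 * e p.2 ^ 2) - (1 / 2) * (e p.1 * e p.2) := fun p => by ring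
    simp only [this]
    have i4 : Integrable (fun p : Y × Y => e p.1 ^ 2 * 1 + 1 * e p.2 ^ 2) (flowRelProd a ν) :=
      i2.add i3
    rw [integral_sub (i4.const_mul _) (i1.const_mul _), integral_const_mul,
      integral_const_mul, integral_add i2 i3, h11, h22, h12]
    simp only [mul_one, one_mul, pow_two]
    ring
  have := (integral_eq_zero_iff_of_nonneg (fun p => sq_nonneg _) ((hd.pow 2).integrable _)).1 h0
  filter_upwards [this] with p hp
  have : ((e p.2 - e p.1) / 2) ^ 2 = 0 := hp
  have := pow_eq_zero_iff (two_ne_zero) |>.1 this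
  linarith

theorem measurePreserving_flowRelProd_fst :
    MeasurePreserving Prod.fst (flowRelProd a ν) (ν : Measure Y) := by
  refine ⟨measurable_fst, ?_⟩
  have : IsProbabilityMeasure ((flowRelProd a ν).map Prod.fst) :=
    Measure.isProbabilityMeasure_map measurable_fst.aemeasurable
  refine Measure.ext fun s hs => ?_
  rw [Measure.map_apply measurable_fst hs, ← measureReal_eq_measureReal_iff]
  have h1 : UnitBounded fun _ : Y => (1 : ℝ) := UnitBounded.const (by simp)
  have := integral_flowRelProd_eq_integral_mul (a := a) ν (UnitBounded.indicator hs) h1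
    (eg := fun _ => 1) measurable_const (by simp)
    (by rw [condExp_const (invariantSigma_le _)])
  simp only [mul_one] at this
  rw [← integral_indicator_one hs, ← integral_indicator_one (measurable_fst hs)]
  exact this

theorem measurePreserving_flowRelProd_snd_marginal :
    MeasurePreserving Prod.snd (flowRelProd a ν) (ν : Measure Y) := by
  refine ⟨measurable_snd, ?_⟩
  have : IsProbabilityMeasure ((flowRelProd a ν).map Prod.snd) :=
    Measure.isProbabilityMeasure_map measurable_snd.aemeasurable
  refine Measure.ext fun s hs => ?_
  rw [Measure.map_apply measurable_snd hs, ← measureReal_eq_measureReal_iff]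
  have h1 : UnitBounded fun _ : Y => (1 : ℝ) := UnitBounded.const (by simp)
  obtain ⟨e, hem, heb, he⟩ := UnitBounded.exists_condExp (invariantSigma Y a.range)
    (UnitBounded.indicator hs) (ν : Measure Y)
  have := integral_flowRelProd_eq_integral_mul (a := a) ν h1 (UnitBounded.indicator hs) hem heb he
  simp only [one_mul] at this
  rw [← integral_indicator_one hs, ← integral_indicator_one (measurable_snd hs)]
  refine Eq.trans this ?_
  rw [integral_congr_ae he, integral_condExp (invariantSigma_le _)]
  rfl

variable [MeasurableConstVAdd G Y] [VAddInvariantMeasure G Y (ν : Measure Y)]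

theorem tendsto_integral_mul_flowAverage (ha : IsMeasurableFlow Y a) {f g : Y → ℝ}
    (hf : UnitBounded f) (hg : UnitBounded g) :
    Tendsto (fun N : ℕ => ∫ y, f y * flowAverage a g N y ∂(ν : Measure Y)) atTop
      (𝓝 (∫ p, f p.1 * g p.2 ∂flowRelProd a ν)) := by
  obtain ⟨eg, hegm, hegb, heg⟩ :=
    UnitBounded.exists_condExp (invariantSigma Y a.range) hg (ν : Measure Y)
  rw [integral_flowRelProd_eq_integral_mul ν hf hg hegm hegb heg]
  refine UnitBounded.integral_sq_sub_le_tendsto _ hf (fun N => hg.flowAverage ha N)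
    ⟨hegm.mono (invariantSigma_le _) le_rfl, hegb⟩ ?_
  refine (tendsto_flowAverage (ν : Measure Y) ha hg).congr fun N => integral_congr_ae ?_
  filter_upwards [heg] with x hx
  rw [hx]

/-- Both sides compute the squared `L²` norm of `𝔼(f | I)`. -/
theorem tendsto_integral_sq_flowAverage (ha : IsMeasurableFlow Y a) {f : Y → ℝ}
    (hf : UnitBounded f) :
    Tendsto (fun N : ℕ => ∫ y, flowAverage a f N y ^ 2 ∂(ν : Measure Y)) atTop
      (𝓝 (∫ p, f p.1 * f p.2 ∂flowRelProd a ν)) := by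
  obtain ⟨e, hem, heb, he⟩ :=
    UnitBounded.exists_condExp (invariantSigma Y a.range) hf (ν : Measure Y)
  have heu : UnitBounded e := ⟨hem.mono (invariantSigma_le _) le_rfl, heb⟩
  have hlim : Tendsto (fun N : ℕ => ∫ y, (flowAverage a f N y - e y) ^ 2 ∂(ν : Measure Y))
      atTop (𝓝 0) := by
    refine (tendsto_flowAverage (ν : Measure Y) ha hf).congr fun N => integral_congr_ae ?_
    filter_upwards [he] with x hx
    rw [hx]
  have h1 := UnitBounded.integral_sq_sub_le_tendsto (ν : Measure Y) heu
    (fun N => hf.flowAverage ha N) heu hlim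
  have h2 := (hlim.add (h1.const_mul 2)).sub_const (∫ y, e y * e y ∂(ν : Measure Y))
  rw [integral_flowRelProd ν hf hf he he]
  have e0 : ∀ c : ℝ, 0 + 2 * c - c = c := fun c => by ring
  rw [e0] at h2
  refine h2.congr fun N => ?_
  have hA := hf.flowAverage ha (N : ℝ)
  have i1 : Integrable (fun y => flowAverage a f N y ^ 2) (ν : Measure Y) :=
    (hA.pow 2).integrable _
  have i2 : Integrable (fun y => e y * flowAverage a f N y) (ν : Measure Y) :=
    (heu.mul hA).integrable _
  have i3 : Integrable (fun y => e y * e y) (ν : Measure Y) := (heu.mul heu).integrable _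
  have : ∀ y, (flowAverage a f N y - e y) ^ 2 =
      flowAverage a f N y ^ 2 - 2 * (e y * flowAverage a f N y) + e y * e y := fun y => by ring
  simp only [this]
  have i4 : Integrable (fun y => flowAverage a f N y ^ 2 - 2 * (e y * flowAverage a f N y))
    (ν : Measure Y) := i1.sub (i2.const_mul 2)
  rw [integral_add i4 i3, integral_sub i1 (i2.const_mul 2), integral_const_mul]
  ring

/-- A transformation preserving `ν` and commuting with the flow acts diagonally on the
relatively independent self-product. -/
theorem measurePreserving_flowRelProd_diag (ha : IsMeasurableFlow Y a) {c : Y → Y}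
    (hc : MeasurePreserving c (ν : Measure Y) (ν : Measure Y))
    (hcomm : ∀ t y, c (a t +ᵥ y) = a t +ᵥ c y) :
    MeasurePreserving (Prod.map c c) (flowRelProd a ν) (flowRelProd a ν) := by
  refine measurePreserving_prodMap_of_integral hc.measurable hc.measurable fun f g hf hg => ?_
  refine tendsto_nhds_unique (tendsto_integral_mul_flowAverage ν ha (hf.comp hc.measurable)
    (hg.comp hc.measurable)) ((tendsto_integral_mul_flowAverage ν ha hf hg).congr fun N => ?_)
  have : ∀ y, flowAverage a (fun y => g (c y)) N y = flowAverage a g N (c y) := fun y => by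
    simp [flowAverage, hcomm]
  simp only [this]
  rw [← hc.map_eq, integral_map hc.measurable.aemeasurable, hc.map_eq]
  rw [hc.map_eq]
  exact (hf.mul (hg.flowAverage ha N)).measurable.aestronglyMeasurable

/-- The flow may act on the second factor alone, since it does not change conditional expectations
on its invariant sets. -/
theorem measurePreserving_flowRelProd_snd (ha : IsMeasurableFlow Y a) (s : ℝ) :
    MeasurePreserving (Prod.map id (a s +ᵥ ·)) (flowRelProd a ν) (flowRelProd a ν) := by
  refine measurePreserving_prodMap_of_integral measurable_id (ha.vadd_const s)
    fun f g hf hg => ?_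
  refine tendsto_nhds_unique (tendsto_integral_mul_flowAverage ν ha hf
    (hg.comp (ha.vadd_const s))) ?_
  have h0 := tendsto_integral_mul_flowAverage ν ha hf hg
  have hdiff : Tendsto (fun N : ℕ => ∫ y, f y *
      (flowAverage a g N (a s +ᵥ y) - flowAverage a g N y) ∂(ν : Measure Y)) atTop (𝓝 0) := by
    have := tendsto_integral_of_dominated_convergence (μ := (ν : Measure Y))
      (F := fun (N : ℕ) y => f y * (flowAverage a g N (a s +ᵥ y) - flowAverage a g N y))
      (f := fun y => f y * 0) (fun _ => 2) (fun N => ?_) (integrable_const _)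
      (fun N => ae_of_all _ fun y => ?_)
      (ae_of_all _ fun y => (tendsto_flowAverage_vadd_sub ha hg s y).const_mul _)
    · simpa using this
    · have := (hg.flowAverage ha N).measurable
      exact (hf.measurable.mul ((this.comp (ha.vadd_const s)).sub this)).aestronglyMeasurable
    · rw [Real.norm_eq_abs, abs_mul]
      have h1 := hf.bound y
      have h2 := (hg.flowAverage ha N).bound y
      have h3 := (hg.flowAverage ha N).bound (a s +ᵥ y)
      have h4 := abs_sub (flowAverage a g N (a s +ᵥ y)) (flowAverage a g N y)
      have h5 := abs_nonneg (flowAverage a g N (a s +ᵥ y) - flowAverage a g N y)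
      nlinarith
  have h1 := hdiff.add h0
  rw [zero_add] at h1
  refine h1.congr fun N => ?_
  have hg' := hg.flowAverage ha (N : ℝ)
  rw [← integral_add]
  · refine integral_congr_ae (ae_of_all _ fun y => ?_)
    have : flowAverage a (fun y => g (a s +ᵥ y)) N y = flowAverage a g N (a s +ᵥ y) := by
      simp [flowAverage, vadd_vadd, add_comm]
    simp only [this]
    ring
  · simp only [mul_sub]
    exact ((hf.mul (hg'.comp (ha.vadd_const s))).integrable _).sub ((hf.mul hg').integrable _)
  · exact (hf.mul hg').integrable _

/-- A function on the relatively independent self-product that is invariant under the flow acting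
on the second factor depends on the first factor only. Tested against a product `f ⊗ g`, such a
function does not see the difference between `g` and its averages along the flow, hence between `g`
and `𝔼(g | I)`, which takes the same values on both factors. -/
theorem exists_ae_eq_comp_fst (ha : IsMeasurableFlow Y a) {F : Y × Y → ℝ} (hF : UnitBounded F)
    (hinv : ∀ s, ∀ᵐ p ∂flowRelProd a ν, F (p.1, a s +ᵥ p.2) = F p) :
    ∃ Φ : Y → ℝ, UnitBounded Φ ∧ F =ᵐ[flowRelProd a ν] fun p => Φ p.1 := by
  set ρ := flowRelProd a ν with hρ
  obtain ⟨E, hEm, hEb, hE⟩ := UnitBounded.exists_condExp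
    (MeasurableSpace.comap Prod.fst inferInstance) hF ρ
  obtain ⟨Φ₀, hΦ₀m, hΦ₀⟩ := hEm.exists_eq_measurable_comp
  have hEΦ : ∀ p, E p = Φ₀ p.1 := fun p => congrFun hΦ₀ p
  let Φ : Y → ℝ := fun y => max (-1) (min 1 (Φ₀ y))
  have hΦ : UnitBounded Φ := ⟨measurable_const.max (measurable_const.min hΦ₀m), fun y => by
    rw [abs_le]; exact ⟨le_max_left _ _, max_le (by norm_num) (min_le_left _ _)⟩⟩
  have hEΦ' : ∀ p, E p = Φ p.1 := fun p => by
    have := abs_le.1 (hEb p)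
    rw [hEΦ] at this ⊢
    simp only [Φ]
    rw [min_eq_right this.2, max_eq_right this.1]
  refine ⟨Φ, hΦ, ?_⟩
  have hK : UnitBounded fun p => (F p - Φ p.1) / 2 := hF.half_sub (hΦ.comp measurable_fst)
  suffices h : ∀ f g : Y → ℝ, UnitBounded f → UnitBounded g →
      ∫ p, F p * (f p.1 * g p.2) ∂ρ = ∫ p, Φ p.1 * (f p.1 * g p.2) ∂ρ by
    have h0 : (fun p => (F p - Φ p.1) / 2) =ᵐ[ρ] 0 := by
      refine (hK.integrable ρ).ae_eq_zero_of_forall_setIntegral_eq_zero fun s hs _ => ?_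
      refine setIntegral_preimage_eq_zero_of_generateFrom (hK.integrable ρ) measurable_id
        generateFrom_prod.symm isPiSystem_prod
        ⟨Set.univ, MeasurableSet.univ, Set.univ, MeasurableSet.univ, Set.univ_prod_univ⟩ ?_ hs
      rintro _ ⟨u, hu, v, hv, rfl⟩
      have h1 := h _ _ (UnitBounded.indicator hu) (UnitBounded.indicator hv)
      have hR := ((UnitBounded.indicator hu).comp (φ := Prod.fst (α := Y) (β := Y))
        measurable_fst).mul ((UnitBounded.indicator hv).comp (φ := Prod.snd (α := Y) (β := Y))
        measurable_snd)
      rw [Set.preimage_id, ← integral_indicator (MeasurableSet.prod hu hv)]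
      have h2 : ∀ p : Y × Y, (u ×ˢ v).indicator (fun p => (F p - Φ p.1) / 2) p =
          (1 / 2) * (F p * (u.indicator (fun _ => (1 : ℝ)) p.1 * v.indicator (fun _ => 1) p.2)
            - Φ p.1 * (u.indicator (fun _ => (1 : ℝ)) p.1 * v.indicator (fun _ => 1) p.2)) := by
        intro p
        by_cases h1 : p.1 ∈ u <;> by_cases h2 : p.2 ∈ v <;> simp [Set.indicator, h1, h2]
        ring
      simp only [h2]
      rw [integral_const_mul, integral_sub ((hF.mul hR).integrable ρ)
        (((hΦ.comp measurable_fst).mul hR).integrable ρ), h1, sub_self, mul_zero]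
    filter_upwards [h0] with p hp
    have : (F p - Φ p.1) / 2 = 0 := hp
    linarith
  intro f g hf hg
  obtain ⟨e, hem, heb, he⟩ := UnitBounded.exists_condExp (invariantSigma Y a.range) hg
    (ν : Measure Y)
  have heu : UnitBounded e := ⟨hem.mono (invariantSigma_le _) le_rfl, heb⟩
  have hf1 : UnitBounded fun p : Y × Y => f p.1 := hf.comp measurable_fst
  have hFf : UnitBounded fun p : Y × Y => F p * f p.1 := hF.mul hf1
  have step1 : ∀ N : ℕ, ∫ p, F p * f p.1 * flowAverage a g N p.2 ∂ρ =
      ∫ p, F p * (f p.1 * g p.2) ∂ρ := by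
    intro N
    have hJ : UnitBounded fun z : (Y × Y) × ℝ => F z.1 * f z.1.1 * g (a z.2 +ᵥ z.1.2) :=
      (hFf.comp measurable_fst).mul
        (hg.comp (ha.vadd measurable_snd (measurable_snd.comp measurable_fst)))
    simp only [flowAverage, ← integral_const_mul]
    rw [hJ.integral_swap ρ (uniformTime N)]
    have : ∀ s, ∫ p, F p * f p.1 * g (a s +ᵥ p.2) ∂ρ = ∫ p, F p * (f p.1 * g p.2) ∂ρ := by
      intro s
      have hmp := measurePreserving_flowRelProd_snd ν ha s
      have hm : AEStronglyMeasurable (fun p : Y × Y => F p * (f p.1 * g p.2))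
          ((flowRelProd a ν).map (Prod.map id (a s +ᵥ ·))) :=
        (hF.mul (hf1.mul (hg.comp measurable_snd))).measurable.aestronglyMeasurable
      have e1 := integral_map hmp.measurable.aemeasurable hm
      rw [hmp.map_eq] at e1
      rw [hρ, e1]
      refine integral_congr_ae ?_
      filter_upwards [hinv s] with p hp
      simp only [Prod.map, id]
      rw [hp]; ring
    simp [this]
  have step2 : Tendsto (fun N : ℕ => ∫ p, F p * f p.1 * flowAverage a g N p.2 ∂ρ) atTop
      (𝓝 (∫ p, F p * f p.1 * e p.2 ∂ρ)) := by
    refine UnitBounded.integral_sq_sub_le_tendsto ρ hFf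
      (fun N => (hg.flowAverage ha N).comp measurable_snd) (heu.comp measurable_snd) ?_
    refine (tendsto_flowAverage (ν : Measure Y) ha hg).congr fun N => ?_
    have hm : AEStronglyMeasurable (fun y => (flowAverage a g N y - e y) ^ 2)
        ((flowRelProd a ν).map Prod.snd) :=
      (((hg.flowAverage ha N).measurable.sub heu.measurable).pow_const 2).aestronglyMeasurable
    have e1 := integral_map measurable_snd.aemeasurable hm
    rw [(measurePreserving_flowRelProd_snd_marginal ν).map_eq] at e1
    rw [hρ, ← e1]
    refine integral_congr_ae ?_
    filter_upwards [he] with x hx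
    rw [hx]
  simp only [step1] at step2
  rw [tendsto_nhds_unique tendsto_const_nhds step2]
  have step3 : ∫ p, F p * f p.1 * e p.2 ∂ρ = ∫ p, (f p.1 * e p.1) * F p ∂ρ := by
    refine integral_congr_ae ?_
    filter_upwards [flowRelProd_ae_eq_of_measurable ν hem heb] with p hp
    rw [hp]; ring
  have hfe := hf.mul heu
  have step4 : ∫ p, (f p.1 * e p.1) * F p ∂ρ = ∫ p, (f p.1 * e p.1) * E p ∂ρ := by
    refine (integral_mul_condExp_version (MeasurableSpace.comap Prod.fst inferInstance)
      measurable_fst.comap_le ρ hF hE (h := fun p => f p.1 * e p.1) ?_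
      (hfe.comp measurable_fst).bound).symm
    exact hfe.measurable.comp (comap_measurable Prod.fst)
  have step5 : ∫ p, (f p.1 * e p.1) * E p ∂ρ = ∫ y, (Φ y * f y) * e y ∂(ν : Measure Y) := by
    have hm : AEStronglyMeasurable (fun y => (Φ y * f y) * e y)
        ((flowRelProd a ν).map Prod.fst) :=
      ((hΦ.mul hf).mul heu).measurable.aestronglyMeasurable
    have e1 := integral_map measurable_fst.aemeasurable hm
    rw [(measurePreserving_flowRelProd_fst ν).map_eq] at e1
    rw [e1]
    refine integral_congr_ae (ae_of_all _ fun p => ?_)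
    simp only [hEΦ' p]; ring
  rw [step3, step4, step5, ← integral_flowRelProd_eq_integral_mul ν (hΦ.mul hf) hg hem heb he]
  refine integral_congr_ae (ae_of_all _ fun p => ?_)
  simp only; ring

end RelProd

/-! ### Invariance of the cube measures under side transformations -/

section Cube

variable {G : Type*} [AddCommGroup G] {X : Type*} [AddAction G X]

/-- The transformation of the cube `X^[k]` acting by `c ε` on the coordinate `ε`. -/
def cubeShift {k : ℕ} (c : Cube G k) (y : Cube X k) : Cube X k := fun ε => c ε +ᵥ y ε

/-- The element of `G^[k]` equal to `g` on the side `ε j = 1` and to zero on the opposite side. -/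
def sideElement {k : ℕ} (j : Fin k) (g : G) : Cube G k := fun ε => if ε j then g else 0

theorem cubeShift_cubeGlue {k : ℕ} (c c' : Cube G k) (p : Cube X k × Cube X k) :
    cubeShift (cubeGlue k (c, c')) (cubeGlue k p) =
      cubeGlue k (Prod.map (cubeShift c) (cubeShift c') p) := by
  funext ε
  by_cases h : ε (Fin.last k) <;> simp [cubeShift, cubeGlue, h]

theorem sideElement_castSucc {k : ℕ} (j : Fin k) (g : G) :
    sideElement j.castSucc g = cubeGlue k (sideElement j g, sideElement j g) := by
  funext ε
  by_cases h : ε (Fin.last k) <;> simp [sideElement, cubeGlue, h] <;> rfl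

theorem sideElement_last {k : ℕ} (g : G) :
    sideElement (Fin.last k) g = cubeGlue k ((0 : Cube G k), fun _ => g) := by
  funext ε
  by_cases h : ε (Fin.last k) <;> simp [sideElement, cubeGlue, h]

theorem cubeShift_zero {k : ℕ} : cubeShift (X := X) (0 : Cube G k) = id := by
  funext y ε; simp [cubeShift]

theorem cubeShift_vadd {k : ℕ} (c : Cube G k) (g : G) (y : Cube X k) :
    cubeShift c (g +ᵥ y) = g +ᵥ cubeShift c y := by
  funext ε; simp [cubeShift, vadd_vadd, add_comm]

variable [MeasurableSpace X] [MeasurableConstVAdd G X]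

theorem measurable_cubeShift {k : ℕ} (c : Cube G k) : Measurable (cubeShift (X := X) c) :=
  measurable_pi_lambda _ fun ε => (measurable_const_vadd (c ε)).comp (measurable_pi_apply ε)

theorem measurableEmbedding_cubeShift {k : ℕ} (c : Cube G k) :
    MeasurableEmbedding (cubeShift (X := X) c) :=
  MeasurableEquiv.measurableEmbedding
    { toFun := cubeShift c
      invFun := cubeShift (-c)
      left_inv := fun y => by funext ε; simp [cubeShift]
      right_inv := fun y => by funext ε; simp [cubeShift]
      measurable_toFun := measurable_cubeShift c
      measurable_invFun := measurable_cubeShift (-c) }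

omit [MeasurableConstVAdd G X] in
theorem IsMeasurableFlow.cube {a : ℝ →+ G} (ha : IsMeasurableFlow X a) (k : ℕ) :
    IsMeasurableFlow (Cube X k) a :=
  measurable_pi_lambda _ fun ε =>
    ha.vadd measurable_fst ((measurable_pi_apply ε).comp measurable_snd)

variable [StandardBorelSpace X] (μ : ProbabilityMeasure X)

/-- The Host-Kra measure of a family of one-parameter subgroups. -/
noncomputable abbrev cubeMeasure {k : ℕ} (e : Fin k → ℝ →+ G) : ProbabilityMeasure (Cube X k) :=
  hostKraMeasure μ k fun i => (e i).range

omit [MeasurableConstVAdd G X] in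
theorem cubeMeasure_succ {k : ℕ} (e : Fin (k + 1) → ℝ →+ G) :
    (cubeMeasure μ e : Measure (Cube X (k + 1))) =
      (flowRelProd (e (Fin.last k)) (cubeMeasure μ (Fin.init e))).map (cubeGlue k) := rfl

omit [MeasurableConstVAdd G X] in
theorem measurePreserving_cubeGlue {k : ℕ} (e : Fin (k + 1) → ℝ →+ G) :
    MeasurePreserving (cubeGlue k) (flowRelProd (e (Fin.last k)) (cubeMeasure μ (Fin.init e)))
      (cubeMeasure μ e : Measure (Cube X (k + 1))) :=
  ⟨measurable_cubeGlue k, rfl⟩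

omit [MeasurableConstVAdd G X] in
theorem measurePreserving_cubeMeasure_zero (e : Fin 0 → ℝ →+ G) :
    MeasurePreserving (fun x _ => x) (μ : Measure X) (cubeMeasure μ e : Measure (Cube X 0)) :=
  ⟨by fun_prop, rfl⟩

omit [MeasurableConstVAdd G X] in
theorem measurePreserving_cubeMeasure_succ {k : ℕ} (e : Fin (k + 1) → ℝ →+ G)
    {φ ψ : Cube X k → Cube X k} {Φ : Cube X (k + 1) → Cube X (k + 1)} (hΦ : Measurable Φ)
    (h : MeasurePreserving (Prod.map φ ψ)
      (flowRelProd (e (Fin.last k)) (cubeMeasure μ (Fin.init e)))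
      (flowRelProd (e (Fin.last k)) (cubeMeasure μ (Fin.init e))))
    (hc : ∀ p, Φ (cubeGlue k p) = cubeGlue k (Prod.map φ ψ p)) :
    MeasurePreserving Φ (cubeMeasure μ e : Measure (Cube X (k + 1))) (cubeMeasure μ e) := by
  refine ⟨hΦ, ?_⟩
  have h1 := ((measurePreserving_cubeGlue μ e).comp h).map_eq
  rw [cubeMeasure_succ, Measure.map_map hΦ (measurable_cubeGlue k)]
  rw [cubeMeasure_succ] at h1
  rw [← h1]
  congr 1
  funext p
  exact hc p

variable [VAddInvariantMeasure G X (μ : Measure X)]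

theorem measurePreserving_cube_vadd {k : ℕ} {e : Fin k → ℝ →+ G}
    (he : ∀ i, IsMeasurableFlow X (e i)) (g : G) :
    MeasurePreserving (fun y : Cube X k => g +ᵥ y) (cubeMeasure μ e : Measure (Cube X k))
      (cubeMeasure μ e) := by
  induction k generalizing g with
  | zero =>
    refine ⟨measurable_const_vadd g, ?_⟩
    have h0 := measurePreserving_cubeMeasure_zero μ e
    have := (h0.comp (measurePreserving_vadd g (μ : Measure X))).map_eq
    rw [← h0.map_eq, Measure.map_map (measurable_const_vadd g) h0.measurable, h0.map_eq, ← this]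
    rfl
  | succ k ih =>
    have ih' := fun g => ih (e := Fin.init e) (fun i => he _) g
    have : VAddInvariantMeasure G (Cube X k)
        (cubeMeasure μ (Fin.init e) : Measure (Cube X k)) :=
      ⟨fun c s hs => (ih' c).measure_preimage hs.nullMeasurableSet⟩
    refine measurePreserving_cubeMeasure_succ μ e (measurable_const_vadd g)
      (measurePreserving_flowRelProd_diag _ ((he (Fin.last k)).cube k) (ih' g)
        fun t y => by rw [vadd_vadd, vadd_vadd, add_comm]) fun p => ?_
    funext ε
    by_cases h : ε (Fin.last k) <;> simp [cubeGlue, h]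

theorem vaddInvariantMeasure_cubeMeasure {k : ℕ} {e : Fin k → ℝ →+ G}
    (he : ∀ i, IsMeasurableFlow X (e i)) :
    VAddInvariantMeasure G (Cube X k) (cubeMeasure μ e : Measure (Cube X k)) :=
  ⟨fun c _ hs => (measurePreserving_cube_vadd μ he c).measure_preimage hs.nullMeasurableSet⟩

/-- The transformation moving one side of the cube along the corresponding flow preserves the cube
measure: for the last side it acts on the second factor alone, for the others diagonally. -/
theorem measurePreserving_cubeShift_side {k : ℕ} {e : Fin k → ℝ →+ G}
    (he : ∀ i, IsMeasurableFlow X (e i)) (j : Fin k) (s : ℝ) :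
    MeasurePreserving (cubeShift (sideElement j (e j s))) (cubeMeasure μ e : Measure (Cube X k))
      (cubeMeasure μ e) := by
  induction k with
  | zero => exact j.elim0
  | succ k ih =>
    have := vaddInvariantMeasure_cubeMeasure μ (e := Fin.init e) fun i => he _
    induction j using Fin.lastCases with
    | last =>
      refine measurePreserving_cubeMeasure_succ μ e (measurable_cubeShift _)
        (measurePreserving_flowRelProd_snd _ ((he (Fin.last k)).cube k) s) fun p => ?_
      rw [sideElement_last, cubeShift_cubeGlue, cubeShift_zero]
      rfl
    | cast j =>
      refine measurePreserving_cubeMeasure_succ μ e (measurable_cubeShift _)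
        (measurePreserving_flowRelProd_diag _ ((he (Fin.last k)).cube k)
          (ih (e := Fin.init e) (fun i => he _) j) fun t y => cubeShift_vadd _ _ _) fun p => ?_
      rw [sideElement_castSucc, cubeShift_cubeGlue]
      rfl

omit [MeasurableConstVAdd G X] [VAddInvariantMeasure G X (μ : Measure X)] in
theorem measurePreserving_cube_eval {k : ℕ} (e : Fin k → ℝ →+ G) (ε : Fin k → Bool) :
    MeasurePreserving (fun y : Cube X k => y ε) (cubeMeasure μ e : Measure (Cube X k))
      (μ : Measure X) := by
  induction k with
  | zero =>
    refine ⟨measurable_pi_apply ε, ?_⟩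
    have h0 := measurePreserving_cubeMeasure_zero μ e
    rw [← h0.map_eq, Measure.map_map (measurable_pi_apply ε) h0.measurable]
    exact Measure.map_id
  | succ k ih =>
    refine ⟨measurable_pi_apply ε, ?_⟩
    rw [cubeMeasure_succ, Measure.map_map (measurable_pi_apply ε) (measurable_cubeGlue k)]
    have ih' := ih (Fin.init e) (Fin.init ε)
    by_cases h : ε (Fin.last k)
    · rw [← (ih'.comp (measurePreserving_flowRelProd_snd_marginal (a := e (Fin.last k)) _)).map_eq]
      congr 1
      funext p
      simp [cubeGlue, h]
    · rw [← (ih'.comp (measurePreserving_flowRelProd_fst (a := e (Fin.last k)) _)).map_eq]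
      congr 1
      funext p
      simp [cubeGlue, h]

/-! ### Side-invariant functions and the dual factor -/

/-- A function on the cube invariant under all side transformations fixing the coordinate `0`
depends on that coordinate only. -/
theorem exists_ae_eq_comp_eval_zero {k : ℕ} {e : Fin k → ℝ →+ G}
    (he : ∀ i, IsMeasurableFlow X (e i)) {F : Cube X k → ℝ} (hF : UnitBounded F)
    (hinv : ∀ j s, ∀ᵐ y ∂(cubeMeasure μ e : Measure (Cube X k)),
      F (cubeShift (sideElement j (e j s)) y) = F y) :
    ∃ φ : X → ℝ, UnitBounded φ ∧
      F =ᵐ[(cubeMeasure μ e : Measure (Cube X k))] fun y => φ (y fun _ => false) := by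
  induction k with
  | zero =>
    refine ⟨fun x => F fun _ => x, hF.comp (by fun_prop), ae_of_all _ fun y => ?_⟩
    congr 1
    funext ε
    congr 1
    exact Subsingleton.elim _ _
  | succ k ih =>
    have := vaddInvariantMeasure_cubeMeasure μ (e := Fin.init e) fun i => he _
    have hglue := measurePreserving_cubeGlue μ e
    obtain ⟨Φ, hΦ, hFΦ⟩ := exists_ae_eq_comp_fst (cubeMeasure μ (Fin.init e))
      ((he (Fin.last k)).cube k) (hF.comp (measurable_cubeGlue k)) (fun s => by
        have := hglue.quasiMeasurePreserving.ae (hinv (Fin.last k) s)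
        filter_upwards [this] with p hp
        rw [sideElement_last, cubeShift_cubeGlue, cubeShift_zero] at hp
        exact hp)
    have hfst := measurePreserving_flowRelProd_fst (a := e (Fin.last k))
      (cubeMeasure μ (Fin.init e))
    obtain ⟨φ, hφ, hΦφ⟩ := ih (e := Fin.init e) (fun i => he _) hΦ (fun j s => by
      have hd := measurePreserving_flowRelProd_diag (cubeMeasure μ (Fin.init e))
        ((he (Fin.last k)).cube k) (measurePreserving_cubeShift_side μ (e := Fin.init e)
          (fun i => he _) j s) fun t y => cubeShift_vadd _ _ _
      have h1 := hglue.quasiMeasurePreserving.ae (hinv j.castSucc s)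
      have h2 := hd.quasiMeasurePreserving.ae hFΦ
      have h3 : ∀ᵐ p ∂flowRelProd (e (Fin.last k)) (cubeMeasure μ (Fin.init e)),
          Φ (cubeShift (sideElement j (Fin.init e j s)) p.1) = Φ p.1 := by
        filter_upwards [h1, h2, hFΦ] with p hp1 hp2 hp3
        rw [sideElement_castSucc, cubeShift_cubeGlue] at hp1
        rw [← hp3, ← hp1]
        exact hp2.symm
      rw [← hfst.map_eq]
      refine (ae_map_iff hfst.measurable.aemeasurable ?_).2 h3
      exact measurableSet_eq_fun (hΦ.measurable.comp (measurable_cubeShift _)) hΦ.measurable)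
    refine ⟨φ, hφ, ?_⟩
    have h4 : ∀ᵐ p ∂flowRelProd (e (Fin.last k)) (cubeMeasure μ (Fin.init e)),
        F (cubeGlue k p) = φ (cubeGlue k p fun _ => false) := by
      filter_upwards [hFΦ, hfst.quasiMeasurePreserving.ae hΦφ] with p h1 h2
      rw [h1, h2]
      simp [cubeGlue, Fin.init_def]
    rw [cubeMeasure_succ]
    exact (ae_map_iff (measurable_cubeGlue k).aemeasurable (measurableSet_eq_fun hF.measurable
      (hφ.measurable.comp (measurable_pi_apply _)))).2 h4

/-- The index set of the coordinates of the cube other than `0`. -/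
abbrev OffBase (k : ℕ) : Type := {ε : Fin k → Bool // ε ≠ fun _ => false}

/-- The projection of the cube forgetting the coordinate `0`. -/
def offBase {X : Type*} {k : ℕ} (y : Cube X k) (ε : OffBase k) : X := y ε

omit [AddAction G X] [MeasurableConstVAdd G X] [StandardBorelSpace X] in
theorem measurable_offBase {k : ℕ} : Measurable (offBase (X := X) (k := k)) :=
  measurable_pi_lambda _ fun _ => measurable_pi_apply _

/-- The `σ`-algebra on the cube of the events that do not depend on the coordinate `0`. -/
abbrev offBaseSigma (X : Type*) [MeasurableSpace X] (k : ℕ) : MeasurableSpace (Cube X k) :=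
  MeasurableSpace.comap offBase inferInstance

/-- The conditional expectation of a function of the coordinate `0`, given all other coordinates,
is again a function of the coordinate `0`: it is invariant under the side transformations, since
these fix the coordinate `0` and preserve both the measure and the `σ`-algebra of the other
coordinates. -/
theorem exists_condExp_offBase_ae_eq {k : ℕ} {e : Fin k → ℝ →+ G}
    (he : ∀ i, IsMeasurableFlow X (e i)) {f : X → ℝ} (hf : UnitBounded f) :
    ∃ φ : X → ℝ, UnitBounded φ ∧
      (cubeMeasure μ e : Measure (Cube X k))[fun y => f (y fun _ => false) | offBaseSigma X k]
        =ᵐ[(cubeMeasure μ e : Measure (Cube X k))] fun y => φ (y fun _ => false) := by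
  set ν : Measure (Cube X k) := (cubeMeasure μ e : Measure (Cube X k))
  have hm : offBaseSigma X k ≤ (inferInstance : MeasurableSpace (Cube X k)) :=
    measurable_offBase.comap_le
  have hf0 : UnitBounded fun y : Cube X k => f (y fun _ => false) := hf.comp (measurable_pi_apply _)
  obtain ⟨P, hPm, hPb, hP⟩ := UnitBounded.exists_condExp (offBaseSigma X k) hf0 ν
  have hPu : UnitBounded P := ⟨hPm.mono hm le_rfl, hPb⟩
  have hoff : ∀ c : Cube G k,
      Measurable[offBaseSigma X k, offBaseSigma X k] (cubeShift (X := X) c) := by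
    intro c
    refine measurable_comap_iff.2 ?_
    have : (offBase ∘ cubeShift (X := X) c) =
        (fun z : OffBase k → X => fun ε : OffBase k => c ε.1 +ᵥ z ε) ∘ offBase := rfl
    rw [this]
    refine Measurable.comp ?_ (comap_measurable _)
    exact measurable_pi_lambda _ fun ε =>
      (measurable_const_vadd (c ε.1)).comp (measurable_pi_apply ε)
  obtain ⟨φ, hφ, hPφ⟩ := exists_ae_eq_comp_eval_zero μ he hPu (fun j s => by
    set c := sideElement (k := k) j (e j s)
    have hc := measurePreserving_cubeShift_side μ he j s
    have hce := measurableEmbedding_cubeShift (X := X) c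
    have : (fun y => P (cubeShift c y)) =ᵐ[ν]
        ν[fun y => f (y fun _ => false) | offBaseSigma X k] := by
      refine ae_eq_condExp_of_forall_setIntegral_eq hm (hf0.integrable ν)
        (fun s _ _ => ((hPu.comp (measurable_cubeShift c)).integrable ν).integrableOn)
        (fun S hS _ => ?_) ?_
      · have hS' : MeasurableSet[offBaseSigma X k] (cubeShift (X := X) (-c) ⁻¹' S) := hoff (-c) hS
        have hpre : S = cubeShift c ⁻¹' (cubeShift (X := X) (-c) ⁻¹' S) := by
          ext y
          have : cubeShift (-c) (cubeShift c y) = y := by funext ε; simp [cubeShift]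
          simp [this]
        rw [hpre, hc.setIntegral_preimage_emb hce, setIntegral_congr_ae (hm _ hS')
          (hP.mono fun y hy _ => hy), setIntegral_condExp hm (hf0.integrable ν) hS',
          ← hc.setIntegral_preimage_emb hce]
        refine integral_congr_ae (ae_of_all _ fun y => ?_)
        simp [cubeShift, sideElement]
      · exact (hPm.comp (hoff c)).stronglyMeasurable.aestronglyMeasurable
    exact this.trans hP.symm)
  exact ⟨φ, hφ, hP.symm.trans hPφ⟩

end Cube

/-! ### The Gowers-Cauchy-Schwarz inequality and the characteristic factor -/

section Gowers

theorem prod_cubeGlue {X : Type*} {k : ℕ} (g : (Fin (k + 1) → Bool) → X → ℝ)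
    (p : Cube X k × Cube X k) :
    ∏ ε, g ε (cubeGlue k p ε) =
      (∏ η : Fin k → Bool, g (Fin.snoc (α := fun _ => Bool) η false) (p.1 η)) *
        ∏ η : Fin k → Bool, g (Fin.snoc (α := fun _ => Bool) η true) (p.2 η) := by
  rw [← (Fin.snocEquiv (fun _ : Fin (k + 1) => Bool)).prod_comp, Fintype.prod_prod_type,
    Fintype.prod_bool, mul_comm]
  congr 1 <;> refine Finset.prod_congr rfl fun η _ => ?_ <;>
    simp [Fin.snocEquiv, cubeGlue, Fin.init_snoc]

theorem snoc_false {k : ℕ} :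
    Fin.snoc (α := fun _ => Bool) (fun _ : Fin k => false) false = fun _ => false := by
  funext i
  induction i using Fin.lastCases <;> simp

theorem prod_cube_eq {X : Type*} {k : ℕ} (g : (Fin k → Bool) → X → ℝ) (y : Cube X k) :
    ∏ ε, g ε (y ε) = g (fun _ => false) (y fun _ => false) * ∏ ε : OffBase k, g ε (y ε) :=
  Fintype.prod_eq_mul_prod_subtype_ne _ _

theorem UnitBounded.prod_cube {X : Type*} [MeasurableSpace X] {k : ℕ} {g : (Fin k → Bool) → X → ℝ}
    (hg : ∀ ε, UnitBounded (g ε)) : UnitBounded fun y : Cube X k => ∏ ε, g ε (y ε) :=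
  UnitBounded.prod fun ε => (hg ε).comp (measurable_pi_apply ε)

variable {G : Type*} [AddCommGroup G] {X : Type*} [AddAction G X] [MeasurableSpace X]
  [StandardBorelSpace X] (μ : ProbabilityMeasure X)

/-- The integral `∫ f^{⊗ 2^k} dμ_{H₁,…,H_k}`, whose `2^k`-th root is the Host-Kra seminorm. -/
noncomputable def cubeForm {k : ℕ} (e : Fin k → ℝ →+ G) (f : X → ℝ) : ℝ :=
  ∫ y, ∏ ε, f (y ε) ∂(cubeMeasure μ e : Measure (Cube X k))

theorem integral_prod_cubeMeasure_succ {k : ℕ} (e : Fin (k + 1) → ℝ →+ G)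
    {g : (Fin (k + 1) → Bool) → X → ℝ} (hg : ∀ ε, UnitBounded (g ε)) :
    ∫ y, ∏ ε, g ε (y ε) ∂(cubeMeasure μ e : Measure (Cube X (k + 1))) =
      ∫ p, (∏ η : Fin k → Bool, g (Fin.snoc (α := fun _ => Bool) η false) (p.1 η)) *
        (∏ η : Fin k → Bool, g (Fin.snoc (α := fun _ => Bool) η true) (p.2 η))
        ∂flowRelProd (e (Fin.last k)) (cubeMeasure μ (Fin.init e)) := by
  rw [cubeMeasure_succ, integral_map (measurable_cubeGlue k).aemeasurable
    (UnitBounded.prod_cube hg).measurable.aestronglyMeasurable]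
  simp only [prod_cubeGlue]

theorem cubeForm_succ {k : ℕ} (e : Fin (k + 1) → ℝ →+ G) {f : X → ℝ} (hf : UnitBounded f) :
    cubeForm μ e f = ∫ p, (∏ η : Fin k → Bool, f (p.1 η)) * (∏ η : Fin k → Bool, f (p.2 η))
        ∂flowRelProd (e (Fin.last k)) (cubeMeasure μ (Fin.init e)) :=
  integral_prod_cubeMeasure_succ μ e fun _ => hf

/-- The Cauchy-Schwarz inequality for the relatively independent self-product. -/
theorem sq_integral_flowRelProd_le {Y : Type*} [MeasurableSpace Y] [StandardBorelSpace Y]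
    [AddAction G Y] {a : ℝ →+ G} (ν : ProbabilityMeasure Y) {f g : Y → ℝ} (hf : UnitBounded f)
    (hg : UnitBounded g) :
    (∫ p, f p.1 * g p.2 ∂flowRelProd a ν) ^ 2 ≤ ∫ p, f p.1 * f p.2 ∂flowRelProd a ν := by
  obtain ⟨ef, hfm, hfb, hef⟩ := UnitBounded.exists_condExp (invariantSigma Y a.range) hf
    (ν : Measure Y)
  obtain ⟨eg, hgm, hgb, heg⟩ := UnitBounded.exists_condExp (invariantSigma Y a.range) hg
    (ν : Measure Y)
  have h1 : UnitBounded ef := ⟨hfm.mono (invariantSigma_le _) le_rfl, hfb⟩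
  have h2 : UnitBounded eg := ⟨hgm.mono (invariantSigma_le _) le_rfl, hgb⟩
  rw [integral_flowRelProd ν hf hg hef heg, integral_flowRelProd ν hf hf hef hef]
  refine (sq_integral_le (h1.mul h2) _).trans ?_
  refine integral_mono (((h1.mul h2).pow 2).integrable _) ((h1.mul h1).integrable _) fun y => ?_
  have := (sq_le_one_iff_abs_le_one _).2 (hgb y)
  simp only
  nlinarith [sq_nonneg (ef y)]

theorem integral_prod_mul_flowAverage {k : ℕ} {e : Fin k → ℝ →+ G} {a : ℝ →+ G}
    (ha : IsMeasurableFlow X a) {g : (Fin k → Bool) → X → ℝ} (hg : ∀ ε, UnitBounded (g ε))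
    (T : ℝ) :
    ∫ y, (∏ ε, g ε (y ε)) * flowAverage a (fun y : Cube X k => ∏ ε, g ε (y ε)) T y
        ∂(cubeMeasure μ e : Measure (Cube X k)) =
      ∫ h, ∫ y, ∏ ε, (g ε (y ε) * g ε (a h +ᵥ y ε)) ∂(cubeMeasure μ e : Measure (Cube X k))
        ∂uniformTime T := by
  have hF : UnitBounded fun y : Cube X k => ∏ ε, g ε (y ε) := UnitBounded.prod_cube hg
  have hJ : UnitBounded fun z : Cube X k × ℝ =>
      (∏ ε, g ε (z.1 ε)) * ∏ ε, g ε ((a z.2 +ᵥ z.1) ε) :=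
    (hF.comp measurable_fst).mul
      (hF.comp (φ := fun z : Cube X k × ℝ => a z.2 +ᵥ z.1)
        ((ha.cube k).vadd measurable_snd measurable_fst))
  simp only [flowAverage, ← integral_const_mul]
  rw [hJ.integral_swap]
  simp only [Finset.prod_mul_distrib]
  rfl

variable [MeasurableConstVAdd G X] [VAddInvariantMeasure G X (μ : Measure X)]

/-- The Gowers-Cauchy-Schwarz inequality for functions bounded by one, in the form where all
functions but the one at the coordinate `0` are estimated trivially. -/
theorem abs_integral_prod_cube_pow_le {k : ℕ} {e : Fin (k + 1) → ℝ →+ G}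
    (he : ∀ i, IsMeasurableFlow X (e i)) {g : (Fin (k + 1) → Bool) → X → ℝ}
    (hg : ∀ ε, UnitBounded (g ε)) :
    |∫ y, ∏ ε, g ε (y ε) ∂(cubeMeasure μ e : Measure (Cube X (k + 1)))| ^ 2 ^ (k + 1) ≤
      cubeForm μ e (g fun _ => false) := by
  induction k with
  | zero =>
    rw [integral_prod_cubeMeasure_succ μ e hg, cubeForm_succ μ e (hg _)]
    have h := sq_integral_flowRelProd_le (a := e (Fin.last 0)) (cubeMeasure μ (Fin.init e))
      (UnitBounded.prod_cube fun η => hg (Fin.snoc (α := fun _ => Bool) η false))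
      (UnitBounded.prod_cube fun η => hg (Fin.snoc (α := fun _ => Bool) η true))
    have hη : ∀ η : Fin 0 → Bool, Fin.snoc (α := fun _ => Bool) η false = fun _ => false :=
      fun η => by rw [← snoc_false]; congr 1; exact Subsingleton.elim _ _
    simp only [hη] at h ⊢
    simpa using h
  | succ k ih =>
    set a := e (Fin.last (k + 1))
    set ν := cubeMeasure μ (Fin.init e)
    have ha : IsMeasurableFlow X a := he _
    have hinv : VAddInvariantMeasure G (Cube X (k + 1)) (ν : Measure (Cube X (k + 1))) :=
      vaddInvariantMeasure_cubeMeasure μ fun i => he _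
    set gf : (Fin (k + 1) → Bool) → X → ℝ := fun η => g (Fin.snoc (α := fun _ => Bool) η false)
    have hgf : ∀ η, UnitBounded (gf η) := fun η => hg _
    set F : Cube X (k + 1) → ℝ := fun y => ∏ η, gf η (y η)
    have hF : UnitBounded F := UnitBounded.prod_cube hgf
    set f := g fun _ => false
    have hf : UnitBounded f := hg _
    set F₀ : Cube X (k + 1) → ℝ := fun y => ∏ η, f (y η)
    have hF₀ : UnitBounded F₀ := UnitBounded.prod_cube fun _ => hf
    have h1 : |∫ y, ∏ ε, g ε (y ε) ∂(cubeMeasure μ e : Measure (Cube X (k + 2)))| ^ 2 ≤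
        ∫ p, F p.1 * F p.2 ∂flowRelProd a ν := by
      rw [integral_prod_cubeMeasure_succ μ e hg, sq_abs]
      exact sq_integral_flowRelProd_le ν hF
        (UnitBounded.prod_cube fun η => hg (Fin.snoc (α := fun _ => Bool) η true))
    have hgf0 : gf (fun _ => false) = f := by simp only [gf, snoc_false, f]
    have h2 : |∫ p, F p.1 * F p.2 ∂flowRelProd a ν| ^ 2 ^ (k + 1) ≤ cubeForm μ e f := by
      rw [cubeForm_succ μ e hf]
      refine le_of_tendsto_of_tendsto'
        (((tendsto_integral_mul_flowAverage ν (ha.cube _) hF hF).abs).pow (2 ^ (k + 1)))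
        (tendsto_integral_mul_flowAverage ν (ha.cube _) hF₀ hF₀) fun N => ?_
      rw [integral_prod_mul_flowAverage μ ha hgf, integral_prod_mul_flowAverage μ ha fun _ => hf]
      have hu : ∀ q : (Fin (k + 1) → Bool) → X → ℝ, (∀ η, UnitBounded (q η)) →
          UnitBounded fun h : ℝ => ∫ y, ∏ ε, (q ε (y ε) * q ε (a h +ᵥ y ε))
            ∂(ν : Measure (Cube X (k + 1))) := by
        intro q hq
        have : UnitBounded fun z : Cube X (k + 1) × ℝ =>
            ∏ ε, (q ε (z.1 ε) * q ε (a z.2 +ᵥ z.1 ε)) :=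
          UnitBounded.prod fun ε => ((hq ε).comp (by fun_prop)).mul
            ((hq ε).comp (ha.vadd measurable_snd
              ((measurable_pi_apply ε).comp measurable_fst)))
        exact this.integral_left _
      have hu1 := hu gf hgf
      refine (abs_integral_pow_le hu1 _ _).trans ?_
      have hu2 : UnitBounded fun h : ℝ => |∫ y, ∏ ε, (gf ε (y ε) * gf ε (a h +ᵥ y ε))
            ∂(ν : Measure (Cube X (k + 1)))| ^ 2 ^ (k + 1) :=
        UnitBounded.pow ⟨hu1.measurable.abs, fun h => by simpa using hu1.bound h⟩ _
      refine integral_mono (hu2.integrable _) ((hu _ fun _ => hf).integrable _) fun h => ?_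
      have := ih (e := Fin.init e) (fun i => he _)
        (g := fun η x => gf η x * gf η (a h +ᵥ x)) fun η => (hgf η).mul
          ((hgf η).comp (ha.vadd_const h))
      rw [hgf0] at this
      exact this
    calc _ = (|∫ y, ∏ ε, g ε (y ε) ∂(cubeMeasure μ e : Measure (Cube X (k + 2)))| ^ 2)
          ^ 2 ^ (k + 1) := by rw [← pow_mul, ← pow_succ']
      _ ≤ |∫ p, F p.1 * F p.2 ∂flowRelProd a ν| ^ 2 ^ (k + 1) :=
        pow_le_pow_left₀ (by positivity) (h1.trans (le_abs_self _)) _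
      _ ≤ _ := h2

theorem cubeForm_nonneg {k : ℕ} {e : Fin (k + 1) → ℝ →+ G}
    (he : ∀ i, IsMeasurableFlow X (e i)) {f : X → ℝ} (hf : UnitBounded f) :
    0 ≤ cubeForm μ e f :=
  le_trans (by positivity) (abs_integral_prod_cube_pow_le μ he (g := fun _ => f) fun _ => hf)

/-- The seminorm of `f` vanishes if and only if `f` at the coordinate `0` has vanishing conditional
expectation given the other coordinates. One direction is the Gowers-Cauchy-Schwarz inequality for
indicators of boxes; the other holds because the remaining factors of `f^{⊗ 2^k}` are functions of
the other coordinates. -/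
theorem cubeForm_eq_zero_iff {k : ℕ} {e : Fin (k + 1) → ℝ →+ G}
    (he : ∀ i, IsMeasurableFlow X (e i)) {f : X → ℝ} (hf : UnitBounded f) :
    cubeForm μ e f = 0 ↔
      (cubeMeasure μ e : Measure (Cube X (k + 1)))[fun y => f (y fun _ => false) |
        offBaseSigma X (k + 1)] =ᵐ[(cubeMeasure μ e : Measure (Cube X (k + 1)))] 0 := by
  set ν : Measure (Cube X (k + 1)) := (cubeMeasure μ e : Measure (Cube X (k + 1)))
  have hm : offBaseSigma X (k + 1) ≤ (inferInstance : MeasurableSpace (Cube X (k + 1))) :=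
    measurable_offBase.comap_le
  have hf0 : UnitBounded fun y : Cube X (k + 1) => f (y fun _ => false) :=
    hf.comp (measurable_pi_apply _)
  constructor
  · intro h0
    refine (ae_eq_condExp_of_forall_setIntegral_eq hm (hf0.integrable ν)
      (fun s _ _ => integrableOn_zero) (fun S hS _ => ?_)
      aestronglyMeasurable_zero).symm
    obtain ⟨S', hS', rfl⟩ := hS
    simp only [integral_zero]
    symm
    refine setIntegral_preimage_eq_zero_of_generateFrom (hf0.integrable ν) measurable_offBase
      generateFrom_pi.symm isPiSystem_pi ?_ ?_ hS'
    · exact ⟨fun _ => Set.univ, fun _ _ => MeasurableSet.univ, Set.pi_univ _⟩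
    rintro _ ⟨B, hB, rfl⟩
    have hB' : ∀ ε : OffBase (k + 1), MeasurableSet (B ε) := fun ε => hB ε (Set.mem_univ _)
    let g : (Fin (k + 1) → Bool) → X → ℝ := fun ε =>
      if h : ε ≠ fun _ => false then (B ⟨ε, h⟩).indicator fun _ => 1 else f
    have hg0 : g (fun _ => false) = f := by simp [g]
    have hgB : ∀ ε : OffBase (k + 1), g ε = (B ε).indicator fun _ => 1 := fun ε => by
      simp [g, ε.2]
    have hg : ∀ ε, UnitBounded (g ε) := by
      intro ε
      by_cases h : ε ≠ fun _ => false
      · simp only [g, h, ne_eq, not_false_eq_true, dite_true]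
        exact UnitBounded.indicator (hB' _)
      · push Not at h
        subst h
        rw [hg0]; exact hf
    have h1 := abs_integral_prod_cube_pow_le μ he hg
    rw [hg0, h0] at h1
    have h2 := pow_eq_zero_iff (by positivity) |>.1 (le_antisymm h1 (by positivity))
    rw [abs_eq_zero] at h2
    rw [← integral_indicator (measurable_offBase (MeasurableSet.univ_pi hB')), ← h2]
    refine integral_congr_ae (ae_of_all _ fun y => ?_)
    simp only [prod_cube_eq, hg0, hgB]
    by_cases hy : y ∈ offBase ⁻¹' Set.univ.pi B
    · rw [Set.indicator_of_mem hy, Finset.prod_eq_one, mul_one]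
      intro ε _
      exact Set.indicator_of_mem (hy ε (Set.mem_univ _)) _
    · rw [Set.indicator_of_notMem hy]
      have : ∃ ε, y ε.1 ∉ B ε := by
        by_contra hc
        push Not at hc
        exact hy fun ε _ => hc ε
      obtain ⟨ε, hε⟩ := this
      rw [Finset.prod_eq_zero (Finset.mem_univ ε) (Set.indicator_of_notMem hε _), mul_zero]
  · intro h0
    have h := integral_mul_condExp_version (offBaseSigma X (k + 1)) hm ν hf0
      (e := fun _ => 0) (h := fun y => ∏ ε : OffBase (k + 1), f (y ε)) h0.symm ?_
      (UnitBounded.prod (X := Cube X (k + 1)) (s := Finset.univ)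
        fun ε : OffBase (k + 1) => hf.comp (measurable_pi_apply ε.1)).bound
    · simp only [mul_zero, integral_zero] at h
      rw [cubeForm, h]
      refine integral_congr_ae (ae_of_all _ fun y => ?_)
      simp only
      rw [prod_cube_eq (fun _ => f), mul_comm]
    · have : Measurable fun z : OffBase (k + 1) → X => ∏ ε, f (z ε) :=
        Finset.measurable_prod _ fun ε _ => hf.measurable.comp (measurable_pi_apply ε)
      exact this.comp (comap_measurable offBase)

/-- The characteristic factor of the Host-Kra seminorm: the events which, placed at the coordinate
`0` of the cube, are determined by the other coordinates up to null sets. -/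
@[reducible] def hostKraFactor {k : ℕ} (e : Fin k → ℝ →+ G) : MeasurableSpace X where
  MeasurableSet' B := MeasurableSet B ∧ ∃ A, MeasurableSet[offBaseSigma X k] A ∧
    (fun y : Cube X k => y fun _ => false) ⁻¹' B
      =ᵐ[(cubeMeasure μ e : Measure (Cube X k))] A
  measurableSet_empty :=
    ⟨MeasurableSet.empty, ∅, @MeasurableSet.empty _ (offBaseSigma X k), by simp⟩
  measurableSet_compl := by
    rintro B ⟨hB, A, hA, hBA⟩
    exact ⟨hB.compl, Aᶜ, hA.compl, hBA.compl⟩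
  measurableSet_iUnion := by
    intro B h
    choose hB A hA hBA using h
    refine ⟨MeasurableSet.iUnion hB, ⋃ i, A i, MeasurableSet.iUnion hA, ?_⟩
    rw [Set.preimage_iUnion]
    exact Filter.EventuallyEq.countable_iUnion hBA

omit [MeasurableConstVAdd G X] [VAddInvariantMeasure G X (μ : Measure X)] in
theorem hostKraFactor_le {k : ℕ} (e : Fin k → ℝ →+ G) :
    hostKraFactor μ e ≤ (inferInstance : MeasurableSpace X) := fun _ hB => hB.1

omit [MeasurableConstVAdd G X] [VAddInvariantMeasure G X (μ : Measure X)] in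
/-- If the conditional expectation of `f` at the coordinate `0` given the other coordinates is `φ`
at the coordinate `0`, then `φ` is the conditional expectation of `f` on the characteristic
factor. -/
theorem condExp_hostKraFactor {k : ℕ} {e : Fin k → ℝ →+ G} {f φ : X → ℝ} (hf : UnitBounded f)
    (hφ : UnitBounded φ)
    (h : (cubeMeasure μ e : Measure (Cube X k))[fun y => f (y fun _ => false) | offBaseSigma X k]
        =ᵐ[(cubeMeasure μ e : Measure (Cube X k))] fun y => φ (y fun _ => false)) :
    φ =ᵐ[(μ : Measure X)] (μ : Measure X)[f | hostKraFactor μ e] := by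
  set ν : Measure (Cube X k) := (cubeMeasure μ e : Measure (Cube X k))
  have hm : offBaseSigma X k ≤ (inferInstance : MeasurableSpace (Cube X k)) :=
    measurable_offBase.comap_le
  have hf0 : UnitBounded fun y : Cube X k => f (y fun _ => false) :=
    hf.comp (measurable_pi_apply _)
  have hev := measurePreserving_cube_eval μ e fun _ => false
  have hint : ∀ {u : X → ℝ}, UnitBounded u → ∀ {B : Set X}, MeasurableSet B →
      ∫ x in B, u x ∂(μ : Measure X) =
        ∫ y in (fun y : Cube X k => y fun _ => false) ⁻¹' B, u (y fun _ => false) ∂ν := by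
    intro u hu B hB
    rw [← hev.map_eq, setIntegral_map hB hu.measurable.aestronglyMeasurable
      hev.measurable.aemeasurable]
  refine ae_eq_condExp_of_forall_setIntegral_eq (hostKraFactor_le μ e) (hf.integrable _)
    (fun s _ _ => (hφ.integrable _).integrableOn) (fun B hB _ => ?_) ?_
  · obtain ⟨hBm, A, hA, hBA⟩ := hB
    rw [hint hφ hBm, hint hf hBm, setIntegral_congr_set hBA, setIntegral_congr_set hBA,
      ← setIntegral_condExp hm (hf0.integrable ν) hA]
    exact setIntegral_congr_ae (hm _ hA) (h.mono fun y hy _ => hy.symm)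
  · refine Measurable.aestronglyMeasurable (m := hostKraFactor μ e) fun U hU =>
      ⟨hφ.measurable hU, ν[fun y => f (y fun _ => false) | offBaseSigma X k] ⁻¹' U,
        stronglyMeasurable_condExp.measurable hU, ?_⟩
    filter_upwards [h] with y hy
    have : (y ∈ (fun y : Cube X k => y fun _ => false) ⁻¹' (φ ⁻¹' U)) =
        (y ∈ ν[fun y => f (y fun _ => false) | offBaseSigma X k] ⁻¹' U) := by
      simp only [Set.mem_preimage, hy]
    exact this

theorem exists_unitBounded_of_memLp_top {X : Type*} [MeasurableSpace X] {μ : Measure X}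
    {f : X → ℝ} (hf : MemLp f ∞ μ) :
    ∃ C > 0, ∃ g : X → ℝ, UnitBounded g ∧ f =ᵐ[μ] fun x => C * g x := by
  obtain ⟨C, hC⟩ : ∃ C : ℝ, ∀ᵐ x ∂μ, |f x| ≤ C := by
    refine ⟨(eLpNorm f ∞ μ).toReal, ?_⟩
    rw [eLpNorm_exponent_top]
    filter_upwards [ae_le_eLpNormEssSup (f := f) (μ := μ)] with x hx
    have hne : eLpNormEssSup f μ ≠ ∞ := by
      rw [← eLpNorm_exponent_top]; exact hf.eLpNorm_ne_top
    have := ENNReal.toReal_mono hne hx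
    simpa using this
  refine ⟨|C| + 1, by positivity, fun x => max (-1) (min 1 (hf.aestronglyMeasurable.mk f x
    / (|C| + 1))), ⟨?_, fun x => ?_⟩, ?_⟩
  · exact measurable_const.max (measurable_const.min
      (hf.aestronglyMeasurable.stronglyMeasurable_mk.measurable.div_const _))
  · rw [abs_le]; exact ⟨le_max_left _ _, max_le (by norm_num) (min_le_left _ _)⟩
  · filter_upwards [hC, hf.aestronglyMeasurable.ae_eq_mk] with x h1 h2
    rw [← h2]
    have hp : 0 < |C| + 1 := by positivity
    have h3 : |f x / (|C| + 1)| ≤ 1 := by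
      rw [abs_div, abs_of_pos hp, div_le_one hp]
      linarith [le_abs_self C]
    rw [abs_le] at h3
    rw [min_eq_right h3.2, max_eq_right h3.1]
    field_simp

theorem hostKraSeminorm_eq_zero_iff {k : ℕ} {e : Fin (k + 1) → ℝ →+ G}
    (he : ∀ i, IsMeasurableFlow X (e i)) {f g : X → ℝ} {C : ℝ} (hC : C ≠ 0) (hg : UnitBounded g)
    (hfg : f =ᵐ[(μ : Measure X)] fun x => C * g x) :
    hostKraSeminorm μ (fun i => (e i).range) f = 0 ↔ cubeForm μ e g = 0 := by
  have h1 : ∫ y, ∏ ε, f (y ε) ∂(cubeMeasure μ e : Measure (Cube X (k + 1))) =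
      C ^ 2 ^ (k + 1) * cubeForm μ e g := by
    rw [cubeForm, ← integral_const_mul]
    refine integral_congr_ae ?_
    have : ∀ᵐ y ∂(cubeMeasure μ e : Measure (Cube X (k + 1))), ∀ ε, f (y ε) = C * g (y ε) :=
      ae_all_iff.2 fun ε => (measurePreserving_cube_eval μ e ε).quasiMeasurePreserving.ae hfg
    filter_upwards [this] with y hy
    simp [hy, Finset.prod_mul_distrib]
  have h2 := cubeForm_nonneg μ he hg
  have h3 : 0 < C ^ 2 ^ (k + 1) := by
    rw [pow_succ', pow_mul]
    positivity
  rw [hostKraSeminorm]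
  change (∫ y, ∏ ε, f (y ε) ∂(cubeMeasure μ e : Measure (Cube X (k + 1)))) ^ _ = 0 ↔ _
  rw [h1, Real.rpow_eq_zero (by positivity) (by positivity), mul_eq_zero]
  simp [h3.ne']

/-- The factor determined by the coordinates other than `0` is the characteristic factor of the
Host-Kra seminorm. -/
theorem isHostKraFactor_hostKraFactor {k : ℕ} {e : Fin (k + 1) → ℝ →+ G}
    (he : ∀ i, IsMeasurableFlow X (e i)) :
    IsHostKraFactor (hostKraFactor μ e) μ fun i => (e i).range := by
  refine ⟨hostKraFactor_le μ e, fun f hf => ?_⟩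
  obtain ⟨C, hC, g, hg, hfg⟩ := exists_unitBounded_of_memLp_top hf
  rw [hostKraSeminorm_eq_zero_iff μ he hC.ne' hg hfg, cubeForm_eq_zero_iff μ he hg]
  obtain ⟨φ, hφ, hφg⟩ := exists_condExp_offBase_ae_eq μ he hg
  have h1 := condExp_hostKraFactor μ hg hφ hφg
  have h2 : (μ : Measure X)[f | hostKraFactor μ e] =ᵐ[(μ : Measure X)] fun x => C * φ x := by
    have h3 : f =ᵐ[(μ : Measure X)] C • g := hfg
    refine (condExp_congr_ae h3).trans ((condExp_smul C g _).trans ?_)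
    filter_upwards [h1] with x hx
    simp [hx]
  have hev := measurePreserving_cube_eval μ e fun _ => false
  have h4 : ((μ : Measure X)[f | hostKraFactor μ e] =ᵐ[(μ : Measure X)] 0) ↔
      ∀ᵐ x ∂(μ : Measure X), φ x = 0 := by
    constructor
    · intro h
      filter_upwards [h, h2] with x h5 h6
      rw [h6] at h5
      exact (mul_eq_zero.1 h5).resolve_left hC.ne'
    · intro h
      filter_upwards [h, h2] with x h5 h6
      rw [h6, h5, mul_zero, Pi.zero_apply]
  have h5 : (∀ᵐ x ∂(μ : Measure X), φ x = 0) ↔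
      ∀ᵐ y ∂(cubeMeasure μ e : Measure (Cube X (k + 1))), φ (y fun _ => false) = 0 := by
    rw [← hev.map_eq]
    exact ae_map_iff hev.measurable.aemeasurable
      (measurableSet_eq_fun hφ.measurable measurable_const)
  rw [h4, h5]
  constructor
  · intro h
    filter_upwards [h, hφg] with y h6 h7
    rw [h7, h6, Pi.zero_apply]
  · intro h
    filter_upwards [h, hφg] with y h6 h7
    rw [← h7, h6, Pi.zero_apply]

end Gowers

/-! ### Van der Corput's inequality and seminorm control of multiple averages -/

theorem pow_le_pow_add_mul {M r δ : ℝ} (hM : 0 ≤ M) (hM1 : M ≤ 1) (hr : 0 ≤ r) (hr1 : r ≤ 1)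
    (hδ : 0 ≤ δ) (h : M ≤ r + δ) (n : ℕ) : M ^ n ≤ r ^ n + n * δ := by
  induction n with
  | zero => simp
  | succ n ih =>
    have h1 : M ^ n ≤ 1 := pow_le_one₀ hM hM1
    have h2 : 0 ≤ M ^ n := by positivity
    push_cast
    calc M ^ (n + 1) = M ^ n * M := pow_succ _ _
      _ ≤ M ^ n * (r + δ) := by gcongr
      _ ≤ M ^ n * r + δ := by nlinarith
      _ ≤ (r ^ n + n * δ) * r + δ := by gcongr
      _ ≤ r ^ (n + 1) + (n + 1) * δ := by
        have : n * δ * r ≤ n * δ := mul_le_of_le_one_right (by positivity) hr1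
        rw [pow_succ]; linarith

/-- A reverse Fatou lemma: pointwise asymptotic upper bounds can be integrated. -/
theorem eventually_integral_le_integral_add {Z : Type*} [MeasurableSpace Z] (P : Measure Z)
    [IsProbabilityMeasure P] {φ : ℝ → Z → ℝ} {U : Z → ℝ} (hφ : ∀ T, UnitBounded (φ T))
    (hU : UnitBounded U) (h : ∀ z, ∀ ε > 0, ∀ᶠ T in atTop, φ T z ≤ U z + ε) {ε : ℝ}
    (hε : 0 < ε) : ∀ᶠ T in atTop, ∫ z, φ T z ∂P ≤ ∫ z, U z ∂P + ε := by
  have hm : ∀ T, Measurable fun z => max (φ T z - U z) 0 := fun T =>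
    ((hφ T).measurable.sub hU.measurable).max measurable_const
  have hb : ∀ T z, ‖max (φ T z - U z) 0‖ ≤ 2 := fun T z => by
    have h1 := abs_le.1 ((hφ T).bound z)
    have h2 := abs_le.1 (hU.bound z)
    rw [Real.norm_eq_abs, abs_of_nonneg (le_max_right _ _)]
    exact max_le (by linarith) (by norm_num)
  have hlim := tendsto_integral_filter_of_dominated_convergence (μ := P) (l := atTop)
    (F := fun (T : ℝ) z => max (φ T z - U z) 0) (f := fun _ => 0) (fun _ => 2)
    (Eventually.of_forall fun T => (hm T).aestronglyMeasurable)
    (Eventually.of_forall fun T => ae_of_all _ (hb T)) (integrable_const _)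
    (ae_of_all _ fun z => by
      refine tendsto_order.2 ⟨fun c hc => Eventually.of_forall fun T =>
        hc.trans_le (le_max_right _ _), fun c hc => ?_⟩
      filter_upwards [h z (c / 2) (by linarith)] with T hT
      exact max_lt (by linarith) hc)
  rw [integral_zero] at hlim
  filter_upwards [hlim.eventually (gt_mem_nhds hε)] with T hT
  have hi : Integrable (fun z => max (φ T z - U z) 0) P :=
    Integrable.of_bound (hm T).aestronglyMeasurable 2 (ae_of_all _ (hb T))
  calc ∫ z, φ T z ∂P ≤ ∫ z, (U z + max (φ T z - U z) 0) ∂P := by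
        refine integral_mono ((hφ T).integrable P) ((hU.integrable P).add hi) fun z => ?_
        have := le_max_left (φ T z - U z) 0
        simp only
        linarith
    _ = ∫ z, U z ∂P + ∫ z, max (φ T z - U z) 0 ∂P := integral_add (hU.integrable P) hi
    _ ≤ _ := by linarith

/-- Van der Corput's inequality: a long average of `v` is, up to `O(S / T)`, controlled by the
correlations of the translates of `v` by at most `S`. -/
theorem integral_sq_average_le {X : Type*} [MeasurableSpace X] (μ : Measure X)
    [IsProbabilityMeasure μ] {v : ℝ × X → ℝ} (hv : UnitBounded v) {S T : ℝ} (hS : 0 ≤ S)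
    (hT : 0 < T) :
    ∫ x, (∫ t, v (t, x) ∂uniformTime T) ^ 2 ∂μ ≤
      ∫ z, ∫ t, ∫ x, v (t - z.1, x) * v (t - z.2, x) ∂μ ∂uniformTime T
        ∂(uniformTime S).prod (uniformTime S) + 4 * S / T := by
  set A : X → ℝ := fun x => ∫ t, v (t, x) ∂uniformTime T
  set B : X → ℝ := fun x => ∫ t, ∫ s, v (t - s, x) ∂uniformTime S ∂uniformTime T
  have hA : UnitBounded A := hv.integral_left _
  have hv3 : UnitBounded fun p : (ℝ × X) × ℝ => v (p.1.1 - p.2, p.1.2) := hv.comp (by fun_prop)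
  have hIs : UnitBounded fun p : ℝ × X => ∫ s, v (p.1 - s, p.2) ∂uniformTime S :=
    hv3.integral_right _
  have hB : UnitBounded B := hIs.integral_left _
  have hAB : ∀ x, |A x - B x| ≤ 2 * S / T := by
    intro x
    have hBs : B x = ∫ s, ∫ t, v (t - s, x) ∂uniformTime T ∂uniformTime S :=
      UnitBounded.integral_swap (f := fun p : ℝ × ℝ => v (p.1 - p.2, x))
        (hv.comp (by fun_prop)) _ _
    have hin : UnitBounded fun s => ∫ t, v (t - s, x) ∂uniformTime T :=
      UnitBounded.integral_left (f := fun p : ℝ × ℝ => v (p.1 - p.2, x))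
        (hv.comp (by fun_prop)) _
    have hA' : A x = ∫ _s, A x ∂uniformTime S := by simp
    rw [hBs, hA', ← integral_sub (integrable_const _) (hin.integrable _)]
    have := norm_integral_le_of_norm_le_const (μ := uniformTime S)
      (f := fun s => A x - ∫ t, v (t - s, x) ∂uniformTime T) (C := 2 * S / T) ?_
    · simpa using this
    filter_upwards [ae_uniformTime_mem hS] with s hs
    have h1 := abs_integral_uniformTime_shift_sub_le (φ := fun t => v (t, x))
      (hv.comp (by fun_prop)) hT (-s)
    rw [Real.norm_eq_abs, abs_sub_comm]
    refine h1.trans ?_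
    rw [abs_neg, abs_of_nonneg hs.1]
    have := hs.2
    gcongr
  have h1 : ∫ x, A x ^ 2 ∂μ ≤ ∫ x, B x ^ 2 ∂μ + 4 * S / T := by
    have hc : ∫ x, (B x ^ 2 + 4 * S / T) ∂μ = ∫ x, B x ^ 2 ∂μ + 4 * S / T := by
      rw [integral_add ((hB.pow 2).integrable μ) (integrable_const _)]; simp
    rw [← hc]
    refine integral_mono ((hA.pow 2).integrable μ)
      (((hB.pow 2).integrable μ).add (integrable_const _)) fun x => ?_
    have h2 := hAB x
    have h3 := abs_le.1 (hA.bound x)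
    have h4 := abs_le.1 (hB.bound x)
    have h5 : A x ^ 2 - B x ^ 2 ≤ |A x - B x| * 2 := by
      calc A x ^ 2 - B x ^ 2 = (A x - B x) * (A x + B x) := by ring
        _ ≤ |(A x - B x) * (A x + B x)| := le_abs_self _
        _ = |A x - B x| * |A x + B x| := abs_mul _ _
        _ ≤ _ := by
          gcongr
          rw [abs_le]; constructor <;> linarith
    have e : 4 * S / T = 2 * S / T * 2 := by ring
    simp only
    rw [e]; linarith
  refine h1.trans (add_le_add_left ?_ _)
  set P := (uniformTime S).prod (uniformTime S)
  have hJ : UnitBounded fun p : (X × ℝ) × (ℝ × ℝ) =>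
      v (p.1.2 - p.2.1, p.1.1) * v (p.1.2 - p.2.2, p.1.1) :=
    (hv.comp (by fun_prop)).mul (hv.comp (by fun_prop))
  have h2 : ∀ x, B x ^ 2 ≤ ∫ z, ∫ t, v (t - z.1, x) * v (t - z.2, x) ∂uniformTime T ∂P := by
    intro x
    refine (sq_integral_le (hIs.comp (φ := fun t => (t, x)) (by fun_prop)) _).trans_eq ?_
    have : ∀ t, (∫ s, v (t - s, x) ∂uniformTime S) ^ 2 =
        ∫ z, v (t - z.1, x) * v (t - z.2, x) ∂P := fun t => by
      rw [pow_two]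
      exact (integral_prod_mul (μ := uniformTime S) (ν := uniformTime S)
        (fun s => v (t - s, x)) fun s => v (t - s, x)).symm
    simp only [this]
    exact UnitBounded.integral_swap
      (f := fun p : ℝ × (ℝ × ℝ) => v (p.1 - p.2.1, x) * v (p.1 - p.2.2, x))
      ((hv.comp (by fun_prop)).mul (hv.comp (by fun_prop))) _ _
  have hJ' : UnitBounded fun p : (X × (ℝ × ℝ)) × ℝ =>
      v (p.2 - p.1.2.1, p.1.1) * v (p.2 - p.1.2.2, p.1.1) :=
    (hv.comp (by fun_prop)).mul (hv.comp (by fun_prop))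
  have h3 : UnitBounded fun p : X × (ℝ × ℝ) =>
      ∫ t, v (t - p.2.1, p.1) * v (t - p.2.2, p.1) ∂uniformTime T := hJ'.integral_right _
  calc ∫ x, B x ^ 2 ∂μ
      ≤ ∫ x, ∫ z, ∫ t, v (t - z.1, x) * v (t - z.2, x) ∂uniformTime T ∂P ∂μ :=
        integral_mono ((hB.pow 2).integrable μ) ((h3.integral_right P).integrable μ) h2
    _ = ∫ z, ∫ x, ∫ t, v (t - z.1, x) * v (t - z.2, x) ∂uniformTime T ∂μ ∂P :=
        h3.integral_swap μ P
    _ = _ := by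
        congr 1
        funext z
        exact UnitBounded.integral_swap
          (f := fun p : X × ℝ => v (p.2 - z.1, p.1) * v (p.2 - z.2, p.1))
          ((hv.comp (by fun_prop)).mul (hv.comp (by fun_prop))) _ _

section Control

variable {G : Type*} [AddCommGroup G] {X : Type*} [AddAction G X]

/-- The multiple average `∫ f(a t x) ∏ⱼ gⱼ(bⱼ t x) dt` over `[0, T]`, with one of its functions
singled out. -/
noncomputable def pointedAverage {d : ℕ} (a : ℝ →+ G) (b : Fin d → ℝ →+ G) (f : X → ℝ)
    (g : Fin d → X → ℝ) (T : ℝ) (x : X) : ℝ :=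
  ∫ t, f (a t +ᵥ x) * ∏ j, g j (b j t +ᵥ x) ∂uniformTime T

/-- The one-parameter subgroups `a, b₁ - a, …, b_d - a` whose seminorm controls the role of the
function moving along `a` in a multiple average. -/
def pointedFlows {d : ℕ} (a : ℝ →+ G) (b : Fin d → ℝ →+ G) : Fin (d + 1) → ℝ →+ G :=
  Fin.cons a fun j => b j - a

theorem pointedFlows_init {d : ℕ} (a : ℝ →+ G) (b : Fin (d + 1) → ℝ →+ G) :
    (Fin.init (pointedFlows a b) : Fin (d + 1) → ℝ →+ G) = pointedFlows a (Fin.init b) := by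
  funext i
  refine Fin.cases ?_ (fun j => ?_) i
  · rfl
  · rfl

theorem pointedFlows_last {d : ℕ} (a : ℝ →+ G) (b : Fin (d + 1) → ℝ →+ G) :
    pointedFlows a b (Fin.last (d + 1)) = b (Fin.last d) - a := rfl

variable [MeasurableSpace X]

theorem isMeasurableFlow_pointedFlows {d : ℕ} {a : ℝ →+ G} {b : Fin d → ℝ →+ G}
    (ha : IsMeasurableFlow X a) (hb : ∀ j, IsMeasurableFlow X (b j)) (i : Fin (d + 1)) :
    IsMeasurableFlow X (pointedFlows a b i) := by
  refine Fin.cases ?_ (fun j => ?_) i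
  · exact ha
  · exact (hb j).sub ha

theorem unitBounded_pointedProduct {d : ℕ} {a : ℝ →+ G} {b : Fin d → ℝ →+ G} {f : X → ℝ}
    {g : Fin d → X → ℝ} (ha : IsMeasurableFlow X a) (hb : ∀ j, IsMeasurableFlow X (b j))
    (hf : UnitBounded f) (hg : ∀ j, UnitBounded (g j)) :
    UnitBounded fun p : ℝ × X => f (a p.1 +ᵥ p.2) * ∏ j, g j (b j p.1 +ᵥ p.2) :=
  (hf.comp (φ := fun p : ℝ × X => a p.1 +ᵥ p.2) ha).mul
    (UnitBounded.prod fun j => (hg j).comp (φ := fun p : ℝ × X => b j p.1 +ᵥ p.2) (hb j))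

theorem unitBounded_pointedAverage {d : ℕ} {a : ℝ →+ G} {b : Fin d → ℝ →+ G} {f : X → ℝ}
    {g : Fin d → X → ℝ} (ha : IsMeasurableFlow X a) (hb : ∀ j, IsMeasurableFlow X (b j))
    (hf : UnitBounded f) (hg : ∀ j, UnitBounded (g j)) (T : ℝ) :
    UnitBounded (pointedAverage a b f g T) :=
  (unitBounded_pointedProduct ha hb hf hg).integral_left _

/-- The correlation `x ↦ f(c z₁ x) f(c z₂ x)` of two translates of `f` along the flow `c`. -/
def flowCorrelation (c : ℝ →+ G) (f : X → ℝ) (z : ℝ × ℝ) (x : X) : ℝ :=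
  f (c z.1 +ᵥ x) * f (c z.2 +ᵥ x)

theorem unitBounded_flowCorrelation {c : ℝ →+ G} {f : X → ℝ} (hc : IsMeasurableFlow X c)
    (hf : UnitBounded f) : UnitBounded fun p : (ℝ × ℝ) × X => flowCorrelation c f p.1 p.2 :=
  (hf.comp (hc.vadd (by fun_prop) measurable_snd)).mul
    (hf.comp (hc.vadd (by fun_prop) measurable_snd))

variable [StandardBorelSpace X] (μ : ProbabilityMeasure X)

theorem unitBounded_cubeForm_flowCorrelation {k : ℕ} (e : Fin k → ℝ →+ G) {c : ℝ →+ G} {f : X → ℝ}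
    (hc : IsMeasurableFlow X c) (hf : UnitBounded f) :
    UnitBounded fun z => cubeForm μ e (flowCorrelation c f z) := by
  have : UnitBounded fun p : (ℝ × ℝ) × Cube X k => ∏ ε, flowCorrelation c f p.1 (p.2 ε) :=
    UnitBounded.prod fun ε => (unitBounded_flowCorrelation hc hf).comp
      (φ := fun p : (ℝ × ℝ) × Cube X k => (p.1, p.2 ε)) (by fun_prop)
  exact this.integral_right _

theorem cubeForm_zero (e : Fin 0 → ℝ →+ G) {f : X → ℝ} (hf : UnitBounded f) :
    cubeForm μ e f = ∫ x, f x ∂(μ : Measure X) := by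
  have h0 := measurePreserving_cubeMeasure_zero μ e
  rw [cubeForm, ← h0.map_eq, integral_map h0.measurable.aemeasurable
    (UnitBounded.prod_cube fun _ => hf).measurable.aestronglyMeasurable]
  simp

variable [MeasurableConstVAdd G X] [VAddInvariantMeasure G X (μ : Measure X)]

/-- The recursive description of the seminorms by averaged correlations. -/
theorem tendsto_integral_cubeForm_flowCorrelation {k : ℕ} {e : Fin (k + 1) → ℝ →+ G}
    (he : ∀ i, IsMeasurableFlow X (e i)) {f : X → ℝ} (hf : UnitBounded f) :
    Tendsto (fun N : ℕ => ∫ z, cubeForm μ (Fin.init e) (flowCorrelation (e (Fin.last k)) f z)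
      ∂(uniformTime N).prod (uniformTime N)) atTop (𝓝 (cubeForm μ e f)) := by
  have hinv : VAddInvariantMeasure G (Cube X k)
      (cubeMeasure μ (Fin.init e) : Measure (Cube X k)) :=
    vaddInvariantMeasure_cubeMeasure μ fun i => he _
  have ha := he (Fin.last k)
  have hF : UnitBounded fun y : Cube X k => ∏ ε, f (y ε) := UnitBounded.prod_cube fun _ => hf
  rw [cubeForm_succ μ e hf]
  refine (tendsto_integral_sq_flowAverage (cubeMeasure μ (Fin.init e)) (ha.cube k) hF).congr
    fun N => ?_
  have h1 : ∀ y : Cube X k, flowAverage (e (Fin.last k)) (fun y : Cube X k => ∏ ε, f (y ε)) N y ^ 2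
      = ∫ z, ∏ ε, flowCorrelation (e (Fin.last k)) f z (y ε)
        ∂(uniformTime N).prod (uniformTime N) := by
    intro y
    rw [pow_two, flowAverage]
    refine (integral_prod_mul (μ := uniformTime N) (ν := uniformTime N) _ _).symm.trans ?_
    simp only [flowCorrelation, Finset.prod_mul_distrib]
    rfl
  simp only [h1]
  have : UnitBounded fun p : Cube X k × (ℝ × ℝ) =>
      ∏ ε, flowCorrelation (e (Fin.last k)) f p.2 (p.1 ε) :=
    UnitBounded.prod fun ε => (unitBounded_flowCorrelation ha hf).comp
      (φ := fun p : Cube X k × (ℝ × ℝ) => (p.2, p.1 ε)) (by fun_prop)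
  exact this.integral_swap _ _

/-- The case of a single function in the control of multiple averages by seminorms. -/
theorem eventually_integral_sq_flowAverage_le {a : ℝ →+ G} (ha : IsMeasurableFlow X a)
    (b : Fin 0 → ℝ →+ G) {f : X → ℝ} (hf : UnitBounded f) (g : Fin 0 → X → ℝ) {ε : ℝ}
    (hε : 0 < ε) :
    ∀ᶠ T in atTop, ∫ x, pointedAverage a b f g T x ^ 2 ∂(μ : Measure X) ≤
      cubeForm μ (pointedFlows a b) f + ε := by
  have hlim := tendsto_integral_cubeForm_flowCorrelation μ
    (isMeasurableFlow_pointedFlows ha (b := b) fun j => j.elim0) hf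
  obtain ⟨N, hN⟩ := (hlim.eventually
    (gt_mem_nhds (lt_add_of_pos_right _ (half_pos hε)))).exists
  have hT0 : Tendsto (fun T : ℝ => 4 * (N : ℝ) / T) atTop (𝓝 0) :=
    tendsto_const_nhds.div_atTop tendsto_id
  filter_upwards [eventually_gt_atTop 0, hT0.eventually (gt_mem_nhds (half_pos hε))] with T hT hT1
  have hvdc := integral_sq_average_le (μ : Measure X)
    (hf.comp (φ := fun p : ℝ × X => a p.1 +ᵥ p.2) ha) (S := N) (by positivity) hT
  have e1 : ∀ x, pointedAverage a b f g T x = ∫ t, f (a t +ᵥ x) ∂uniformTime T := by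
    intro x; simp [pointedAverage]
  simp only [e1]
  refine hvdc.trans ?_
  have e2 : ∀ (z : ℝ × ℝ) (t : ℝ),
      ∫ x, f (a (t - z.1) +ᵥ x) * f (a (t - z.2) +ᵥ x) ∂(μ : Measure X) =
        cubeForm μ (Fin.init (pointedFlows a b)) (flowCorrelation a f z) := by
    intro z t
    rw [cubeForm_zero μ _ ((unitBounded_flowCorrelation ha hf).comp
      (φ := fun x => (z, x)) (by fun_prop)),
      ← integral_vadd_eq (μ : Measure X) (a (z.1 + z.2 - t))]
    congr 1
    funext x
    simp only [vadd_vadd, ← map_add, flowCorrelation]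
    rw [mul_comm]
    congr 4 <;> ring
  simp only [e2, integral_const, probReal_univ, one_smul]
  have e3 : pointedFlows a b (Fin.last 0) = a := rfl
  rw [e3] at hN
  linarith

/-- Control of multiple averages by the Host-Kra seminorm of a single function. The induction
removes the last function `g_d`: the `L²` norm of the average is written as a correlation with
`g_d`, and van der Corput's inequality eliminates `g_d` at the cost of replacing `f` by its
correlations along `b_d - a`. -/
theorem exists_eventually_integral_sq_pointedAverage_pow_le (d : ℕ) :
    ∃ q : ℕ, 0 < q ∧ ∀ {a : ℝ →+ G} {b : Fin d → ℝ →+ G} {f : X → ℝ} {g : Fin d → X → ℝ},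
      IsMeasurableFlow X a → (∀ j, IsMeasurableFlow X (b j)) → UnitBounded f →
      (∀ j, UnitBounded (g j)) → ∀ ε > 0, ∀ᶠ T in atTop,
        (∫ x, pointedAverage a b f g T x ^ 2 ∂(μ : Measure X)) ^ q ≤
          cubeForm μ (pointedFlows a b) f + ε := by
  induction d with
  | zero =>
    refine ⟨1, one_pos, fun {a b f g} ha _ hf _ ε hε => ?_⟩
    simpa only [pow_one] using eventually_integral_sq_flowAverage_le μ ha b hf g hε
  | succ d ih =>
    obtain ⟨q, hq, ih⟩ := ih
    refine ⟨4 * q, by positivity, fun {a b f g} ha hb hf hg ε hε => ?_⟩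
    set bl := b (Fin.last d) with hbl
    have hbl' : IsMeasurableFlow X bl := hb _
    set c := bl - a with hcdef
    have hc : IsMeasurableFlow X c := hbl'.sub ha
    let fz : ℝ × ℝ → X → ℝ := flowCorrelation c f
    let gz : ℝ × ℝ → Fin d → X → ℝ := fun z j =>
      flowCorrelation (bl - b j.castSucc) (g j.castSucc) z
    let Φ : ℝ → ℝ × ℝ → ℝ := fun T z =>
      ∫ x, pointedAverage a (Fin.init b) (fz z) (gz z) T x ^ 2 ∂(μ : Measure X)
    have hfz : UnitBounded fun p : (ℝ × ℝ) × X => fz p.1 p.2 := unitBounded_flowCorrelation hc hf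
    have hgz : ∀ j, UnitBounded fun p : (ℝ × ℝ) × X => gz p.1 j p.2 := fun j =>
      unitBounded_flowCorrelation (hbl'.sub (hb _)) (hg _)
    have havg : ∀ T, UnitBounded fun p : (ℝ × ℝ) × X =>
        pointedAverage a (Fin.init b) (fz p.1) (gz p.1) T p.2 := by
      intro T
      have : UnitBounded fun w : ((ℝ × ℝ) × X) × ℝ =>
          fz w.1.1 (a w.2 +ᵥ w.1.2) * ∏ j, gz w.1.1 j (b j.castSucc w.2 +ᵥ w.1.2) :=
        (hfz.comp (φ := fun w : ((ℝ × ℝ) × X) × ℝ => (w.1.1, a w.2 +ᵥ w.1.2))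
          ((by fun_prop : Measurable fun w : ((ℝ × ℝ) × X) × ℝ => w.1.1).prodMk
            (ha.vadd measurable_snd (by fun_prop)))).mul
          (UnitBounded.prod fun j => (hgz j).comp
            (φ := fun w : ((ℝ × ℝ) × X) × ℝ => (w.1.1, b j.castSucc w.2 +ᵥ w.1.2))
            ((by fun_prop : Measurable fun w : ((ℝ × ℝ) × X) × ℝ => w.1.1).prodMk
              ((hb _).vadd measurable_snd (by fun_prop))))
      exact this.integral_right _
    have hΦ : ∀ T, UnitBounded (Φ T) := fun T => ((havg T).pow 2).integral_right _
    have hU : UnitBounded fun z => cubeForm μ (pointedFlows a (Fin.init b)) (fz z) :=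
      unitBounded_cubeForm_flowCorrelation μ _ hc hf
    -- a finite averaging range `N` for the correlations, close to optimal
    have hlim := tendsto_integral_cubeForm_flowCorrelation μ
      (isMeasurableFlow_pointedFlows ha hb) hf
    rw [pointedFlows_init, pointedFlows_last] at hlim
    obtain ⟨N, hN⟩ := (hlim.eventually
      (gt_mem_nhds (lt_add_of_pos_right _ (by positivity : 0 < ε / 3)))).exists
    set P := (uniformTime (N : ℝ)).prod (uniformTime (N : ℝ))
    have hIH := eventually_integral_le_integral_add P (φ := fun T z => Φ T z ^ q)
      (fun T => (hΦ T).pow q) hU (fun z δ hδ => ih ha (fun j => hb _)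
        (hfz.comp (φ := fun x => (z, x)) (by fun_prop))
        (fun j => (hgz j).comp (φ := fun x => (z, x)) (by fun_prop)) δ hδ)
      (by positivity : 0 < ε / 3)
    have hT0 : Tendsto (fun T : ℝ => ((2 * q : ℕ) : ℝ) * (4 * (N : ℝ) / T)) atTop (𝓝 0) := by
      have := (tendsto_const_nhds (x := 4 * (N : ℝ)).div_atTop tendsto_id).const_mul
        (((2 * q : ℕ) : ℝ))
      simpa using this
    filter_upwards [eventually_gt_atTop 0, hIH,
      hT0.eventually (gt_mem_nhds (by positivity : 0 < ε / 3))] with T hT hT1 hT2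
    set w := pointedAverage a b f g T with hw
    have hwu : UnitBounded w := unitBounded_pointedAverage ha hb hf hg T
    let v : ℝ × X → ℝ := fun p => w (bl (-p.1) +ᵥ p.2) *
      (f (c (-p.1) +ᵥ p.2) * ∏ j : Fin d, g j.castSucc ((bl - b j.castSucc) (-p.1) +ᵥ p.2))
    have hv : UnitBounded v := by
      have hn : Measurable fun p : ℝ × X => -p.1 := by fun_prop
      exact (hwu.comp (hbl'.vadd hn measurable_snd)).mul
        ((hf.comp (hc.vadd hn measurable_snd)).mul (UnitBounded.prod fun j =>
          (hg j.castSucc).comp ((hbl'.sub (hb j.castSucc)).vadd hn measurable_snd)))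
    -- the squared norm of the average is a correlation with the last function
    have hnorm : ∫ x, w x ^ 2 ∂(μ : Measure X) =
        ∫ x, g (Fin.last d) x * ∫ t, v (t, x) ∂uniformTime T ∂(μ : Measure X) := by
      have hu := unitBounded_pointedProduct ha hb hf hg
      have e1 : ∀ x, w x ^ 2 = ∫ t, w x * (f (a t +ᵥ x) * ∏ j, g j (b j t +ᵥ x))
          ∂uniformTime T := fun x => by
        rw [pow_two, integral_const_mul]; rfl
      simp only [e1, ← integral_const_mul]
      rw [UnitBounded.integral_swap
        (f := fun p : X × ℝ => w p.1 * (f (a p.2 +ᵥ p.1) * ∏ j, g j (b j p.2 +ᵥ p.1)))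
        ((hwu.comp measurable_fst).mul (hu.comp measurable_swap)),
        UnitBounded.integral_swap (f := fun p : X × ℝ => g (Fin.last d) p.1 * v (p.2, p.1))
        (((hg _).comp measurable_fst).mul (hv.comp measurable_swap))]
      congr 1
      funext t
      rw [← integral_vadd_eq (μ : Measure X) (bl (-t))]
      congr 1
      funext x
      have e2 : ∀ b' : ℝ →+ G, b' t +ᵥ (bl (-t) +ᵥ x) = (bl - b') (-t) +ᵥ x := fun b' => by
        rw [vadd_vadd]; congr 1; simp only [map_neg, AddMonoidHom.sub_apply]; abel
      rw [Fin.prod_univ_castSucc, ← hbl, e2 a, e2 bl]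
      simp only [e2, v, sub_self, AddMonoidHom.zero_apply, zero_vadd, ← hcdef]
      ring
    have hM0 : (∫ x, w x ^ 2 ∂(μ : Measure X)) ^ 2 ≤
        ∫ x, (∫ t, v (t, x) ∂uniformTime T) ^ 2 ∂(μ : Measure X) := by
      have hvi : UnitBounded fun x => ∫ t, v (t, x) ∂uniformTime T := hv.integral_left _
      rw [hnorm]
      refine (sq_integral_le ((hg _).mul hvi) _).trans ?_
      refine integral_mono ((((hg _).mul hvi).pow 2).integrable _)
        ((hvi.pow 2).integrable _) fun x => ?_
      have := (sq_le_one_iff_abs_le_one _).2 ((hg (Fin.last d)).bound x)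
      simp only [mul_pow]
      exact mul_le_of_le_one_left (sq_nonneg _) this
    let J : ℝ × ℝ → ℝ := fun z => ∫ t, ∫ x, v (t - z.1, x) * v (t - z.2, x) ∂(μ : Measure X)
      ∂uniformTime T
    have hvdc : ∫ x, (∫ t, v (t, x) ∂uniformTime T) ^ 2 ∂(μ : Measure X) ≤
        ∫ z, J z ∂P + 4 * N / T :=
      integral_sq_average_le (μ : Measure X) hv (by positivity) hT
    have hJu : UnitBounded J := by
      have : UnitBounded fun p : ((ℝ × ℝ) × ℝ) × X =>
          v (p.1.2 - p.1.1.1, p.2) * v (p.1.2 - p.1.1.2, p.2) :=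
        (hv.comp (by fun_prop)).mul (hv.comp (by fun_prop))
      exact (this.integral_right (μ : Measure X)).integral_right _
    -- after translating by `bl t`, the correlations are averages of one function fewer
    have hJ : ∀ z, |J z| ^ 2 ≤ Φ T z := by
      intro z
      have hWu : UnitBounded (flowCorrelation bl w z) :=
        (unitBounded_flowCorrelation hbl' hwu).comp (φ := fun x => (z, x)) (by fun_prop)
      have hAu : UnitBounded (pointedAverage a (Fin.init b) (fz z) (gz z) T) :=
        (havg T).comp (φ := fun x => (z, x)) (by fun_prop)
      have hJz : J z = ∫ x, flowCorrelation bl w z x *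
          pointedAverage a (Fin.init b) (fz z) (gz z) T x ∂(μ : Measure X) := by
        have hprod : UnitBounded fun p : X × ℝ => fz z (a p.2 +ᵥ p.1) *
            ∏ j, gz z j (b j.castSucc p.2 +ᵥ p.1) :=
          (unitBounded_pointedProduct ha (fun j => hb j.castSucc)
            (hfz.comp (φ := fun x => (z, x)) (by fun_prop))
            (fun j => (hgz j).comp (φ := fun x => (z, x)) (by fun_prop))).comp measurable_swap
        simp only [pointedAverage, ← integral_const_mul]
        rw [UnitBounded.integral_swap
          (f := fun p : X × ℝ => flowCorrelation bl w z p.1 * (fz z (a p.2 +ᵥ p.1) *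
            ∏ j, gz z j (Fin.init b j p.2 +ᵥ p.1)))
          ((hWu.comp measurable_fst).mul hprod)]
        simp only [J]
        congr 1
        funext t
        rw [← integral_vadd_eq (μ : Measure X) (bl t)]
        congr 1
        funext x
        have e2 : ∀ (b' : ℝ →+ G) (s : ℝ), (bl - b') (-(t - s)) +ᵥ (bl t +ᵥ x) =
            (bl - b') s +ᵥ (b' t +ᵥ x) := fun b' s => by
          rw [vadd_vadd, vadd_vadd]; congr 1
          simp only [map_neg, map_sub, AddMonoidHom.sub_apply]; abel
        have e3 : ∀ s : ℝ, bl (-(t - s)) +ᵥ (bl t +ᵥ x) = bl s +ᵥ x := fun s => by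
          rw [vadd_vadd, ← map_add]; congr 2; ring
        simp only [v, fz, gz, flowCorrelation, hcdef, e2, e3, Fin.init, Finset.prod_mul_distrib]
        ring
      rw [sq_abs, hJz]
      refine (sq_integral_le (hWu.mul hAu) _).trans ?_
      refine integral_mono (((hWu.mul hAu).pow 2).integrable _)
        ((hAu.pow 2).integrable _) fun x => ?_
      have := (sq_le_one_iff_abs_le_one _).2 (hWu.bound x)
      simp only [mul_pow]
      exact mul_le_of_le_one_left (sq_nonneg _) this
    have hwsq := hwu.pow 2
    have hm0 : 0 ≤ ∫ x, w x ^ 2 ∂(μ : Measure X) := integral_nonneg fun x => sq_nonneg _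
    have hm1 : ∫ x, w x ^ 2 ∂(μ : Measure X) ≤ 1 :=
      (le_abs_self _).trans (hwsq.abs_integral_le _)
    have hfin := pow_le_pow_add_mul (M := (∫ x, w x ^ 2 ∂(μ : Measure X)) ^ 2)
      (r := |∫ z, J z ∂P|) (δ := 4 * N / T) (by positivity) (pow_le_one₀ hm0 hm1) (abs_nonneg _)
      (hJu.abs_integral_le P) (by positivity)
      ((hM0.trans hvdc).trans (by gcongr; exact le_abs_self _)) (2 * q)
    have hJq : |∫ z, J z ∂P| ^ (2 * q) ≤ ∫ z, Φ T z ^ q ∂P := by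
      refine (abs_integral_pow_le hJu P (2 * q)).trans ?_
      refine integral_mono (UnitBounded.integrable ⟨hJu.measurable.abs.pow_const _, fun z => ?_⟩ P)
        (((hΦ T).pow q).integrable P) fun z => ?_
      · rw [abs_pow, abs_abs]; exact pow_le_one₀ (abs_nonneg _) (hJu.bound z)
      · simp only
        rw [pow_mul]
        exact pow_le_pow_left₀ (by positivity) (hJ z) q
    have e4 : (∫ x, w x ^ 2 ∂(μ : Measure X)) ^ (4 * q) =
        ((∫ x, w x ^ 2 ∂(μ : Measure X)) ^ 2) ^ (2 * q) := by
      rw [← pow_mul]; congr 1; ring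
    rw [e4]
    linarith

/-- If the seminorm of one of the functions vanishes, the multiple averages tend to zero. -/
theorem tendsto_integral_sq_pointedAverage_zero {d : ℕ} {a : ℝ →+ G} {b : Fin d → ℝ →+ G}
    {f : X → ℝ} {g : Fin d → X → ℝ} (ha : IsMeasurableFlow X a)
    (hb : ∀ j, IsMeasurableFlow X (b j)) (hf : UnitBounded f) (hg : ∀ j, UnitBounded (g j))
    (h0 : cubeForm μ (pointedFlows a b) f = 0) :
    Tendsto (fun T => ∫ x, pointedAverage a b f g T x ^ 2 ∂(μ : Measure X)) atTop (𝓝 0) := by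
  obtain ⟨q, hq, h⟩ := exists_eventually_integral_sq_pointedAverage_pow_le (G := G) μ d
  have hn : ∀ T, 0 ≤ ∫ x, pointedAverage a b f g T x ^ 2 ∂(μ : Measure X) := fun T =>
    integral_nonneg fun x => sq_nonneg _
  refine tendsto_order.2 ⟨fun c hc => Eventually.of_forall fun T => hc.trans_le (hn T),
    fun c hc => ?_⟩
  have hcq : 0 < c ^ q := pow_pos hc q
  filter_upwards [h ha hb hf hg (c ^ q / 2) (by positivity)] with T hT
  rw [h0, zero_add] at hT
  exact lt_of_pow_lt_pow_left₀ q hc.le (by linarith)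

end Control

/-! ### Families of functions that are Cauchy in `L²` -/

/-- The family `u T` is Cauchy in `L²(μ)` as `T → ∞`. -/
structure IsL2Cauchy {X E : Type*} [MeasurableSpace X] [NormedAddCommGroup E] (μ : Measure X)
    (u : ℝ → X → E) : Prop where
  aestronglyMeasurable : ∀ T, AEStronglyMeasurable (u T) μ
  tendsto : Tendsto (fun p : ℝ × ℝ => eLpNorm (u p.1 - u p.2) 2 μ) (atTop ×ˢ atTop) (𝓝 0)

namespace IsL2Cauchy

variable {X E : Type*} [MeasurableSpace X] [NormedAddCommGroup E] {μ : Measure X}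
  {u v : ℝ → X → E}

theorem of_le {F : Type*} [NormedAddCommGroup F] {w : ℝ → X → F} (hv : IsL2Cauchy μ w)
    (hu : ∀ T, AEStronglyMeasurable (u T) μ)
    (h : ∀ S T, eLpNorm (u S - u T) 2 μ ≤ eLpNorm (w S - w T) 2 μ) : IsL2Cauchy μ u :=
  ⟨hu, tendsto_of_tendsto_of_tendsto_of_le_of_le tendsto_const_nhds hv.tendsto
    (fun _ => zero_le) fun p => h p.1 p.2⟩

theorem add (hu : IsL2Cauchy μ u) (hv : IsL2Cauchy μ v) :
    IsL2Cauchy μ fun T => u T + v T := by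
  refine ⟨fun T => (hu.1 T).add (hv.1 T), ?_⟩
  have := hu.tendsto.add hv.tendsto
  rw [add_zero] at this
  refine tendsto_of_tendsto_of_tendsto_of_le_of_le tendsto_const_nhds this
    (fun _ => zero_le) fun p => ?_
  have e : (u p.1 + v p.1) - (u p.2 + v p.2) = (u p.1 - u p.2) + (v p.1 - v p.2) := by abel
  simp only [e]
  exact eLpNorm_add_le ((hu.1 _).sub (hu.1 _)) ((hv.1 _).sub (hv.1 _)) (by norm_num)

theorem const_smul {𝕜 : Type*} [NormedField 𝕜] [NormedSpace 𝕜 E] (hu : IsL2Cauchy μ u) (c : 𝕜) :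
    IsL2Cauchy μ fun T => c • u T := by
  refine ⟨fun T => (hu.1 T).const_smul c, ?_⟩
  have := ENNReal.Tendsto.const_mul (a := ‖c‖ₑ) hu.tendsto (Or.inr (by simp))
  rw [mul_zero] at this
  refine this.congr fun p => ?_
  rw [← smul_sub, eLpNorm_const_smul]

theorem zero : IsL2Cauchy μ fun _ => (0 : X → E) := by
  refine ⟨fun T => aestronglyMeasurable_zero, ?_⟩
  simp

theorem sum {ι : Type*} {s : Finset ι} {u : ι → ℝ → X → E} (hu : ∀ i, IsL2Cauchy μ (u i)) :
    IsL2Cauchy μ fun T => ∑ i ∈ s, u i T := by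
  classical
  induction s using Finset.induction_on with
  | empty => simpa using zero
  | insert i s hi ih => simpa [Finset.sum_insert hi] using (hu i).add ih

theorem of_tendsto {L : X → E} (hu : ∀ T, AEStronglyMeasurable (u T) μ)
    (hL : AEStronglyMeasurable L μ)
    (h : Tendsto (fun T => eLpNorm (u T - L) 2 μ) atTop (𝓝 0)) : IsL2Cauchy μ u := by
  refine ⟨hu, ?_⟩
  have := (h.comp (tendsto_fst (f := atTop) (g := atTop (α := ℝ)))).add
    (h.comp (tendsto_snd (f := atTop (α := ℝ)) (g := atTop)))
  rw [add_zero] at this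
  refine tendsto_of_tendsto_of_tendsto_of_le_of_le tendsto_const_nhds this
    (fun _ => zero_le) fun p => ?_
  have e : u p.1 - u p.2 = (u p.1 - L) - (u p.2 - L) := by abel
  simp only [e]
  exact eLpNorm_sub_le ((hu _).sub hL) ((hu _).sub hL) (by norm_num)

theorem of_approx (hu : ∀ T, AEStronglyMeasurable (u T) μ)
    (h : ∀ ε > (0 : ℝ), ∃ v, IsL2Cauchy μ v ∧
      ∀ T, eLpNorm (u T - v T) 2 μ ≤ ENNReal.ofReal ε) : IsL2Cauchy μ u := by
  refine ⟨hu, ENNReal.tendsto_nhds_zero.2 fun δ hδ => ?_⟩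
  obtain ⟨ε, hε, hεδ⟩ : ∃ ε > (0 : ℝ), ENNReal.ofReal ε ≤ δ / 3 := by
    rcases eq_or_ne δ ∞ with rfl | hδ'
    · exact ⟨1, one_pos, by simp [ENNReal.top_div]⟩
    · refine ⟨(δ / 3).toReal, ENNReal.toReal_pos ?_ ?_, ?_⟩
      · exact (ENNReal.div_pos hδ.ne' (by norm_num)).ne'
      · exact (ENNReal.div_lt_top hδ' (by norm_num)).ne
      · rw [ENNReal.ofReal_toReal (ENNReal.div_lt_top hδ' (by norm_num)).ne]
  obtain ⟨v, hv, hvu⟩ := h ε hε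
  have hδ3 : 0 < δ / 3 := ENNReal.div_pos hδ.ne' (by norm_num)
  filter_upwards [ENNReal.tendsto_nhds_zero.1 hv.tendsto _ hδ3] with p hp
  have e : u p.1 - u p.2 = (u p.1 - v p.1) + (v p.1 - v p.2) - (u p.2 - v p.2) := by abel
  rw [e]
  have hm : ∀ T, AEStronglyMeasurable (u T - v T) μ := fun T => (hu T).sub (hv.1 T)
  calc _ ≤ eLpNorm (u p.1 - v p.1) 2 μ + eLpNorm (v p.1 - v p.2) 2 μ
        + eLpNorm (u p.2 - v p.2) 2 μ :=
      (eLpNorm_sub_le ((hm _).add ((hv.1 _).sub (hv.1 _))) (hm _) (by norm_num)).trans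
        (add_le_add_left (eLpNorm_add_le (hm _) ((hv.1 _).sub (hv.1 _)) (by norm_num)) _)
    _ ≤ δ / 3 + δ / 3 + δ / 3 :=
      add_le_add (add_le_add ((hvu _).trans hεδ) hp) ((hvu _).trans hεδ)
    _ = δ := ENNReal.add_thirds δ

theorem comp_iff {Y : Type*} [MeasurableSpace Y] {ν : Measure Y} {π : Y → X}
    (hπ : MeasurePreserving π ν μ) (hu : ∀ T, AEStronglyMeasurable (u T) μ) :
    IsL2Cauchy ν (fun T => u T ∘ π) ↔ IsL2Cauchy μ u := by
  have e : ∀ p : ℝ × ℝ, eLpNorm (u p.1 ∘ π - u p.2 ∘ π) 2 ν = eLpNorm (u p.1 - u p.2) 2 μ :=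
    fun p => eLpNorm_comp_measurePreserving ((hu p.1).sub (hu p.2)) hπ
  constructor
  · intro h
    exact ⟨hu, h.tendsto.congr e⟩
  · intro h
    exact ⟨fun T => (hu T).comp_measurePreserving hπ, h.tendsto.congr fun p => (e p).symm⟩

end IsL2Cauchy

/-! ### Multiple averages as functions of one entry -/

section Pointed

variable {G : Type*} [AddCommGroup G] {X : Type*} [AddAction G X] [MeasurableSpace X]
  {d : ℕ} {a : ℝ →+ G} {b : Fin d → ℝ →+ G} {g : Fin d → X → ℝ}

theorem pointedAverage_sum {ι : Type*} (s : Finset ι) (r : ι → ℝ) {h : ι → X → ℝ}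
    (ha : IsMeasurableFlow X a) (hb : ∀ j, IsMeasurableFlow X (b j))
    (hh : ∀ i, UnitBounded (h i)) (hg : ∀ j, UnitBounded (g j)) (T : ℝ) :
    pointedAverage a b (fun x => ∑ i ∈ s, r i * h i x) g T =
      ∑ i ∈ s, r i • pointedAverage a b (h i) g T := by
  funext x
  simp only [pointedAverage, Finset.sum_apply, Pi.smul_apply, smul_eq_mul, Finset.sum_mul]
  rw [integral_finsetSum]
  · refine Finset.sum_congr rfl fun i _ => ?_
    rw [← integral_const_mul]
    simp only [mul_assoc]
  · intro i _
    simp only [mul_assoc]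
    exact (((unitBounded_pointedProduct ha hb (hh i) hg).comp (φ := fun t => (t, x))
      (by fun_prop)).integrable _).const_mul _

theorem pointedAverage_sub {h h' : X → ℝ} (ha : IsMeasurableFlow X a)
    (hb : ∀ j, IsMeasurableFlow X (b j)) (hh : UnitBounded h) (hh' : UnitBounded h')
    (hg : ∀ j, UnitBounded (g j)) (T : ℝ) :
    pointedAverage a b h g T - pointedAverage a b h' g T =
      (2 : ℝ) • pointedAverage a b (fun x => (h x - h' x) / 2) g T := by
  have hi : ∀ {k : X → ℝ}, UnitBounded k → ∀ x, Integrable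
      (fun t => k (a t +ᵥ x) * ∏ j, g j (b j t +ᵥ x)) (uniformTime T) := fun hk x =>
    ((unitBounded_pointedProduct ha hb hk hg).comp (φ := fun t => (t, x))
      (by fun_prop)).integrable _
  funext x
  simp only [pointedAverage, Pi.sub_apply, Pi.smul_apply, smul_eq_mul]
  rw [← integral_sub (hi hh x) (hi hh' x), ← integral_const_mul]
  congr 1
  funext t
  ring

variable [MeasurableConstVAdd G X] (μ : Measure X) [IsProbabilityMeasure μ]
  [VAddInvariantMeasure G X μ]

/-- An average is bounded in `L²` by each of its functions, the others being bounded by one. -/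
theorem integral_sq_pointedAverage_le {f : X → ℝ} (ha : IsMeasurableFlow X a)
    (hb : ∀ j, IsMeasurableFlow X (b j)) (hf : UnitBounded f) (hg : ∀ j, UnitBounded (g j))
    (T : ℝ) : ∫ x, pointedAverage a b f g T x ^ 2 ∂μ ≤ ∫ x, f x ^ 2 ∂μ := by
  have hu := unitBounded_pointedProduct ha hb hf hg
  have hfa : UnitBounded fun p : X × ℝ => f (a p.2 +ᵥ p.1) ^ 2 :=
    (hf.pow 2).comp (ha.vadd measurable_snd measurable_fst)
  calc ∫ x, pointedAverage a b f g T x ^ 2 ∂μ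
      ≤ ∫ x, ∫ t, f (a t +ᵥ x) ^ 2 ∂uniformTime T ∂μ := by
        refine integral_mono (((unitBounded_pointedAverage ha hb hf hg T).pow 2).integrable μ)
          ((hfa.integral_right _).integrable μ) fun x => ?_
        refine (sq_integral_le (hu.comp (φ := fun t => (t, x)) (by fun_prop)) _).trans ?_
        refine integral_mono (((hu.pow 2).comp (φ := fun t => (t, x)) (by fun_prop)).integrable _)
          ((hfa.comp (φ := fun t => (x, t)) (by fun_prop)).integrable _) fun t => ?_
        simp only [mul_pow]
        refine mul_le_of_le_one_right (sq_nonneg _) ?_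
        have : |∏ j, g j (b j t +ᵥ x)| ≤ 1 := by
          rw [Finset.abs_prod]
          exact Finset.prod_le_one (fun _ _ => abs_nonneg _) fun j _ => (hg j).bound _
        exact (sq_le_one_iff_abs_le_one _).2 this
    _ = ∫ t, ∫ x, f (a t +ᵥ x) ^ 2 ∂μ ∂uniformTime T := hfa.integral_swap μ _
    _ = ∫ x, f x ^ 2 ∂μ := by
        have : ∀ t, ∫ x, f (a t +ᵥ x) ^ 2 ∂μ = ∫ x, f x ^ 2 ∂μ := fun t =>
          integral_vadd_eq μ (a t) fun x => f x ^ 2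
        simp [this]

theorem eLpNorm_pointedAverage_sub_le {h h' : X → ℝ} (ha : IsMeasurableFlow X a)
    (hb : ∀ j, IsMeasurableFlow X (b j)) (hh : UnitBounded h) (hh' : UnitBounded h')
    (hg : ∀ j, UnitBounded (g j)) (T : ℝ) :
    eLpNorm (pointedAverage a b h g T - pointedAverage a b h' g T) 2 μ ≤
      eLpNorm (h - h') 2 μ := by
  have hd := hh.half_sub hh'
  have e : h - h' = (2 : ℝ) • fun x => (h x - h' x) / 2 := by
    funext x; simp only [Pi.sub_apply, Pi.smul_apply, smul_eq_mul]; ring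
  rw [pointedAverage_sub ha hb hh hh' hg, e, eLpNorm_const_smul, eLpNorm_const_smul,
    eLpNorm_two_eq_ofReal ((unitBounded_pointedAverage ha hb hd hg T).memLp μ 2),
    eLpNorm_two_eq_ofReal (hd.memLp μ 2)]
  refine mul_le_mul' le_rfl (ENNReal.ofReal_le_ofReal (Real.sqrt_le_sqrt ?_))
  simp only [Real.norm_eq_abs, sq_abs]
  exact integral_sq_pointedAverage_le μ ha hb hd hg T

theorem isL2Cauchy_pointedAverage_of_approx {f : X → ℝ} (ha : IsMeasurableFlow X a)
    (hb : ∀ j, IsMeasurableFlow X (b j)) (hf : UnitBounded f) (hg : ∀ j, UnitBounded (g j))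
    (h : ∀ ε > (0 : ℝ), ∃ f', UnitBounded f' ∧ IsL2Cauchy μ (pointedAverage a b f' g) ∧
      eLpNorm (f - f') 2 μ ≤ ENNReal.ofReal ε) : IsL2Cauchy μ (pointedAverage a b f g) := by
  refine IsL2Cauchy.of_approx
    (fun T => (unitBounded_pointedAverage ha hb hf hg T).measurable.aestronglyMeasurable)
    fun ε hε => ?_
  obtain ⟨f', hf', hc, hε'⟩ := h ε hε
  exact ⟨_, hc, fun T => (eLpNorm_pointedAverage_sub_le μ ha hb hf hf' hg T).trans hε'⟩

/-- The functions `f` for which the averages are Cauchy form a closed linear space, so that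
indicators of a generating `π`-system suffice. -/
theorem isL2Cauchy_pointedAverage_of_generateFrom {W : Type*} [mW : MeasurableSpace W] {r : X → W}
    (hr : Measurable r) {C : Set (Set W)} (hC : mW = MeasurableSpace.generateFrom C)
    (hpi : IsPiSystem C) (huniv : Set.univ ∈ C) (ha : IsMeasurableFlow X a)
    (hb : ∀ j, IsMeasurableFlow X (b j)) (hg : ∀ j, UnitBounded (g j))
    (h : ∀ s ∈ C, IsL2Cauchy μ (pointedAverage a b ((r ⁻¹' s).indicator fun _ => 1) g))
    {f : W → ℝ} (hf : UnitBounded f) :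
    IsL2Cauchy μ (pointedAverage a b (fun x => f (r x)) g) := by
  have hsum : ∀ {ι : Type} (s : Finset ι) (c : ι → ℝ) (k : ι → X → ℝ), (∀ i, UnitBounded (k i)) →
      (∀ i, IsL2Cauchy μ (pointedAverage a b (k i) g)) →
      IsL2Cauchy μ (pointedAverage a b (fun x => ∑ i ∈ s, c i * k i x) g) := by
    intro ι s c k hk hkc
    have e : pointedAverage a b (fun x => ∑ i ∈ s, c i * k i x) g =
        fun T => ∑ i ∈ s, c i • pointedAverage a b (k i) g T :=
      funext fun T => pointedAverage_sum s c ha hb hk hg T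
    rw [e]
    exact IsL2Cauchy.sum fun i => (hkc i).const_smul (c i)
  have hset : ∀ s : Set W, MeasurableSet s →
      IsL2Cauchy μ (pointedAverage a b ((r ⁻¹' s).indicator fun _ => 1) g) := by
    intro s hs
    induction s, hs using MeasurableSpace.induction_on_inter hC hpi with
    | empty =>
      have := hsum (∅ : Finset ℕ) (fun _ => 0) (fun _ _ => 0)
        (fun _ => UnitBounded.const (by simp)) (fun _ => ?_)
      · simpa using this
      · have e : pointedAverage a b (fun _ : X => (0 : ℝ)) g = fun _ => 0 := by
          funext T x; simp [pointedAverage]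
        rw [e]; exact IsL2Cauchy.zero
    | basic t ht => exact h t ht
    | compl t ht ih =>
      have := hsum (Finset.univ : Finset Bool) (fun i => if i then 1 else -1)
        (fun i => if i then (r ⁻¹' Set.univ).indicator fun _ => 1 else
          (r ⁻¹' t).indicator fun _ => 1)
        (fun i => by
          cases i
          · exact UnitBounded.indicator (hr ht)
          · exact UnitBounded.indicator (hr MeasurableSet.univ))
        (fun i => by
          cases i
          · exact ih
          · exact h _ huniv)
      convert this using 2
      funext x
      by_cases hx : r x ∈ t <;> simp [Set.indicator, hx]
    | iUnion F hd hF ih =>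
      refine isL2Cauchy_pointedAverage_of_approx μ ha hb
        (UnitBounded.indicator (hr (MeasurableSet.iUnion hF))) hg fun ε hε => ?_
      -- the finite subunions exhaust the union in `L²`
      have hlim : Tendsto (fun N : ℕ => ∫ x, ((r ⁻¹' ⋃ i, F i).indicator (fun _ => (1 : ℝ)) x -
          (r ⁻¹' ⋃ i ∈ Finset.range N, F i).indicator (fun _ => (1 : ℝ)) x) ^ 2 ∂μ) atTop
          (𝓝 0) := by
        have hmeas : ∀ N : ℕ, UnitBounded ((r ⁻¹' ⋃ i ∈ Finset.range N, F i).indicator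
            fun _ => (1 : ℝ)) := fun N =>
          UnitBounded.indicator (hr (Finset.measurableSet_biUnion _ fun i _ => hF i))
        have := tendsto_integral_of_dominated_convergence (μ := μ)
          (F := fun (N : ℕ) x => ((r ⁻¹' ⋃ i, F i).indicator (fun _ => (1 : ℝ)) x -
          (r ⁻¹' ⋃ i ∈ Finset.range N, F i).indicator (fun _ => (1 : ℝ)) x) ^ 2)
          (f := fun _ => 0) (fun _ => 1) (fun N => ?_) (integrable_const _)
          (fun N => ae_of_all _ fun x => ?_) (ae_of_all _ fun x => ?_)
        · simpa using this
        · exact (((UnitBounded.indicator (hr (MeasurableSet.iUnion hF))).measurable.sub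
            (hmeas N).measurable).pow_const 2).aestronglyMeasurable
        · by_cases h1 : x ∈ r ⁻¹' ⋃ i, F i <;>
            by_cases h2 : x ∈ r ⁻¹' ⋃ i ∈ Finset.range N, F i <;>
            simp only [Set.indicator, h1, h2] <;> norm_num
        · by_cases h1 : x ∈ r ⁻¹' ⋃ i, F i
          · obtain ⟨i, hi⟩ := Set.mem_iUnion.1 h1
            refine tendsto_const_nhds.congr' ?_
            filter_upwards [eventually_gt_atTop i] with N hN
            have h2 : x ∈ r ⁻¹' ⋃ i ∈ Finset.range N, F i :=
              Set.mem_biUnion (Finset.mem_coe.2 (Finset.mem_range.2 hN)) hi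
            rw [Set.indicator_of_mem h1, Set.indicator_of_mem h2]; norm_num
          · refine tendsto_const_nhds.congr fun N => ?_
            have h2 : x ∉ r ⁻¹' ⋃ i ∈ Finset.range N, F i := fun h2 => h1
              (Set.iUnion₂_subset_iUnion _ _ h2)
            rw [Set.indicator_of_notMem h1, Set.indicator_of_notMem h2]; norm_num
      have hlim' := (Real.continuous_sqrt.tendsto 0).comp hlim
      rw [Real.sqrt_zero] at hlim'
      obtain ⟨N, hN⟩ := (hlim'.eventually (gt_mem_nhds hε)).exists
      have hUN : MeasurableSet (⋃ i ∈ Finset.range N, F i) :=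
        Finset.measurableSet_biUnion _ fun i _ => hF i
      refine ⟨_, UnitBounded.indicator (hr hUN), ?_, ?_⟩
      · have := hsum (Finset.range N) (fun _ => 1) (fun i => (r ⁻¹' F i).indicator fun _ => 1)
          (fun i => UnitBounded.indicator (hr (hF i))) ih
        convert this using 2
        funext x
        simp only [one_mul]
        have hpd : (Finset.range N : Set ℕ).PairwiseDisjoint fun i => r ⁻¹' F i :=
          fun i _ j _ hij => (hd hij).preimage r
        rw [Set.preimage_iUnion₂, Finset.indicator_biUnion_apply _ _ hpd]
      · have hm : MemLp ((r ⁻¹' ⋃ i, F i).indicator (fun _ => (1 : ℝ)) -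
            (r ⁻¹' ⋃ i ∈ Finset.range N, F i).indicator (fun _ => (1 : ℝ))) 2 μ :=
          ((UnitBounded.indicator (hr (MeasurableSet.iUnion hF))).memLp μ 2).sub
            ((UnitBounded.indicator (hr hUN)).memLp μ 2)
        rw [eLpNorm_two_eq_ofReal hm]
        refine ENNReal.ofReal_le_ofReal ?_
        simp only [Real.norm_eq_abs, sq_abs, Pi.sub_apply]
        exact hN.le
  refine isL2Cauchy_pointedAverage_of_approx μ ha hb (hf.comp hr) hg fun ε hε => ?_
  -- uniform approximation by the rounded function `⌊N f⌋ / N`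
  obtain ⟨N, hN0, hN⟩ : ∃ N : ℕ, 0 < N ∧ (1 : ℝ) / N ≤ ε := by
    obtain ⟨N, hN⟩ := exists_nat_gt (1 / ε)
    have h0 : 0 < (N : ℝ) := (by positivity : 0 < 1 / ε).trans hN
    exact ⟨N, by exact_mod_cast h0, by rw [div_le_iff₀ h0]; rw [div_lt_iff₀ hε] at hN; linarith⟩
  have hNr : (0 : ℝ) < N := by exact_mod_cast hN0
  have hfl : ∀ w, ⌊N * f w⌋ ∈ Finset.Icc (-(N : ℤ)) N := fun w => by
    have := abs_le.1 (hf.bound w)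
    rw [Finset.mem_Icc]
    constructor
    · rw [Int.le_floor]; push_cast; nlinarith
    · have : (⌊N * f w⌋ : ℝ) ≤ N := (Int.floor_le _).trans (by nlinarith)
      exact_mod_cast this
  have hms : ∀ k : ℤ, MeasurableSet {w | ⌊N * f w⌋ = k} := fun k =>
    (Int.measurable_floor.comp (hf.measurable.const_mul _)) (measurableSet_singleton k)
  have hround : ∀ w, ∑ k ∈ Finset.Icc (-(N : ℤ)) N,
      ((k : ℝ) / N) * {w | ⌊N * f w⌋ = k}.indicator (fun _ => (1 : ℝ)) w = (⌊N * f w⌋ : ℝ) / N := by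
    intro w
    rw [Finset.sum_eq_single_of_mem _ (hfl w)]
    · simp
    · intro k _ hk
      rw [Set.indicator_of_notMem (by simpa using hk.symm), mul_zero]
  refine ⟨fun x => ∑ k ∈ Finset.Icc (-(N : ℤ)) N,
      ((k : ℝ) / N) * (r ⁻¹' {w | ⌊N * f w⌋ = k}).indicator (fun _ => (1 : ℝ)) x, ⟨?_, fun x => ?_⟩,
      hsum _ _ _ (fun k => UnitBounded.indicator (hr (hms k))) fun k => hset _ (hms k), ?_⟩
  · exact Finset.measurable_sum _ fun k _ => (measurable_const.indicator (hr (hms k))).const_mul _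
  · refine (congrArg abs (hround (r x))).trans_le ?_
    have := Finset.mem_Icc.1 (hfl (r x))
    rw [abs_div, abs_of_pos hNr, div_le_one hNr, abs_le]
    exact ⟨by exact_mod_cast this.1, by exact_mod_cast this.2⟩
  · refine (eLpNorm_le_of_ae_bound (C := 1 / N) (ae_of_all _ fun x => ?_)).trans ?_
    · rw [Pi.sub_apply]
      have e := hround (r x)
      have : ∑ k ∈ Finset.Icc (-(N : ℤ)) N, ((k : ℝ) / N) *
          (r ⁻¹' {w | ⌊N * f w⌋ = k}).indicator (fun _ => (1 : ℝ)) x = (⌊N * f (r x)⌋ : ℝ) / N := e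
      rw [this]
      have h1 := Int.floor_le (N * f (r x))
      have h2 := Int.lt_floor_add_one (N * f (r x))
      have e2 : f (r x) - (⌊N * f (r x)⌋ : ℝ) / N = (N * f (r x) - ⌊N * f (r x)⌋) / N := by
        field_simp
      rw [e2, Real.norm_eq_abs, abs_div, abs_of_pos hNr, abs_of_nonneg (by linarith)]
      gcongr
      linarith
    · simpa using ENNReal.ofReal_le_ofReal hN

end Pointed

/-! ### Convergence of multiple averages along commuting flows -/

/-- The multiple average `∫ ∏ᵢ fᵢ(cᵢ t x) dt` over `[0, T]`. -/
noncomputable def multiFlowAverage {𝕜 : Type*} [RCLike 𝕜] {G : Type*} [AddCommGroup G] {X : Type*}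
    [AddAction G X] {n : ℕ} (c : Fin n → ℝ →+ G) (f : Fin n → X → 𝕜) (T : ℝ) (x : X) : 𝕜 :=
  ∫ t, ∏ i, f i (c i t +ᵥ x) ∂uniformTime T

section Lift

variable {G : Type*} [AddCommGroup G] {X : Type*} [AddAction G X] [MeasurableSpace X]
  [MeasurableConstVAdd G X] [StandardBorelSpace X] (μ : ProbabilityMeasure X) {k : ℕ}
  (e : Fin k → ℝ →+ G)

/-- The group of all coordinatewise translations of the cube that preserve the cube measure. -/
def cubeStabilizer : AddSubgroup (Cube G k) where
  carrier := {c | MeasurePreserving (cubeShift c) (cubeMeasure μ e : Measure (Cube X k))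
    (cubeMeasure μ e)}
  zero_mem' := by
    simp only [Set.mem_ofPred_eq, cubeShift_zero]
    exact MeasurePreserving.id _
  add_mem' := by
    intro c c' hc hc'
    have h : cubeShift (X := X) (c + c') = cubeShift c ∘ cubeShift c' := by
      funext y ε; simp [cubeShift, add_vadd]
    simp only [Set.mem_ofPred_eq, h]
    exact hc.comp hc'
  neg_mem' := by
    intro c hc
    refine ⟨measurable_cubeShift _, ?_⟩
    have h : cubeShift (X := X) (-c) ∘ cubeShift c = id := by
      funext y ε; simp [cubeShift]
    conv_lhs => rw [← MeasurePreserving.map_eq hc]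
    rw [Measure.map_map (measurable_cubeShift _) (measurable_cubeShift _), h, Measure.map_id]

instance : MeasurableConstVAdd (cubeStabilizer μ e) (Cube X k) :=
  ⟨fun c => measurable_cubeShift (c : Cube G k)⟩

instance : VAddInvariantMeasure (cubeStabilizer μ e) (Cube X k)
    (cubeMeasure μ e : Measure (Cube X k)) :=
  ⟨fun c _ hs => MeasurePreserving.measure_preimage c.2 hs.nullMeasurableSet⟩

variable [VAddInvariantMeasure G X (μ : Measure X)] {e}

/-- Translation of the side `ε i = 0`, as the difference of the diagonal translation and that of
the side `ε i = 1`. -/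
theorem complSide_mem_cubeStabilizer (he : ∀ i, IsMeasurableFlow X (e i)) (i : Fin k) (t : ℝ) :
    (fun ε => if ε i then 0 else e i t : Cube G k) ∈ cubeStabilizer μ e := by
  have h1 : (fun _ => e i t : Cube G k) ∈ cubeStabilizer μ e :=
    measurePreserving_cube_vadd μ he (e i t)
  have h2 : sideElement i (e i t) ∈ cubeStabilizer μ e :=
    measurePreserving_cubeShift_side μ he i t
  convert sub_mem h1 h2 using 1
  funext ε
  by_cases h : ε i <;> simp [sideElement, h]

/-- The flow on the cube that moves along `e i` the coordinates `ε` with `ε i = 0` and fixes the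
others. -/
def sideFlow (he : ∀ i, IsMeasurableFlow X (e i)) (i : Fin k) : ℝ →+ cubeStabilizer μ e where
  toFun t := ⟨fun ε => if ε i then 0 else e i t, complSide_mem_cubeStabilizer μ he i t⟩
  map_zero' := by ext ε; simp
  map_add' s t := by
    ext ε
    by_cases h : ε i <;> simp [h]

theorem sideFlow_vadd_apply (he : ∀ i, IsMeasurableFlow X (e i)) (i : Fin k) (t : ℝ)
    (y : Cube X k) (ε : Fin k → Bool) :
    (sideFlow μ he i t +ᵥ y) ε = (if ε i then 0 else e i t) +ᵥ y ε := rfl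

theorem isMeasurableFlow_sideFlow (he : ∀ i, IsMeasurableFlow X (e i)) (i : Fin k) :
    IsMeasurableFlow (Cube X k) (sideFlow μ he i) := by
  refine measurable_pi_lambda _ fun ε => ?_
  simp only [sideFlow_vadd_apply]
  by_cases h : ε i
  · simp only [h, if_true, zero_vadd]; fun_prop
  · simp only [h, if_false, Bool.false_eq_true]
    exact (he i).vadd measurable_fst ((measurable_pi_apply ε).comp measurable_snd)

end Lift

section Convergence

variable {G : Type*} [AddCommGroup G] {X : Type*} [AddAction G X] [MeasurableSpace X]
  [MeasurableConstVAdd G X] [StandardBorelSpace X] (μ : ProbabilityMeasure X)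
  [VAddInvariantMeasure G X (μ : Measure X)] {n : ℕ} {e : Fin (n + 1) → ℝ →+ G}

/-- On the cube, with the flow `a*` of side `0` and the flows `bⱼ* = a* + e_{j+1}*`, averages whose
first function does not depend on the coordinate `0` reduce to averages of one function fewer.
Indeed a function of a coordinate `ε ≠ 0` is invariant either under `a*`, and then comes out of the
average, or under some `e_{j+1}*`, and then moves along `bⱼ*` just as along `a*`. -/
theorem isL2Cauchy_pointedAverage_offBase (he : ∀ i, IsMeasurableFlow X (e i))
    {g : Fin n → Cube X (n + 1) → ℝ} (hg : ∀ j, UnitBounded (g j))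
    (ih : ∀ h : Fin n → Cube X (n + 1) → ℝ, (∀ j, UnitBounded (h j)) →
      IsL2Cauchy (cubeMeasure μ e : Measure (Cube X (n + 1)))
        (multiFlowAverage (fun j => sideFlow μ he 0 + sideFlow μ he j.succ) h))
    {p : (OffBase (n + 1) → X) → ℝ} (hp : UnitBounded p) :
    IsL2Cauchy (cubeMeasure μ e : Measure (Cube X (n + 1)))
      (pointedAverage (sideFlow μ he 0) (fun j => sideFlow μ he 0 + sideFlow μ he j.succ)
        (fun y => p (offBase y)) g) := by
  have hm := isMeasurableFlow_sideFlow μ he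
  have hb : ∀ j : Fin n, IsMeasurableFlow (Cube X (n + 1))
      (sideFlow μ he 0 + sideFlow μ he j.succ) := fun j => (hm 0).add (hm _)
  refine isL2Cauchy_pointedAverage_of_generateFrom _ measurable_offBase generateFrom_pi.symm
    isPiSystem_pi ⟨fun _ => Set.univ, fun _ _ => MeasurableSet.univ, Set.pi_univ _⟩ (hm 0) hb hg
    ?_ hp
  rintro _ ⟨B, hB, rfl⟩
  have hB' : ∀ ε : OffBase (n + 1), MeasurableSet (B ε) := fun ε => hB ε (Set.mem_univ _)
  have hex : ∀ ε : OffBase (n + 1), ∃ i, ε.1 i = true := by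
    intro ε
    by_contra hc
    push Not at hc
    exact ε.2 (funext fun i => by simpa using hc i)
  -- each coordinate `ε ≠ 0` is assigned to a side flow that fixes it
  choose ι hι using hex
  let P : Fin (n + 1) → Cube X (n + 1) → ℝ := fun i y =>
    ∏ ε with ι ε = i, (B ε).indicator (fun _ => (1 : ℝ)) (y ε)
  have hP : ∀ i, UnitBounded (P i) := fun i =>
    UnitBounded.prod fun ε => (UnitBounded.indicator (hB' ε)).comp (measurable_pi_apply _)
  have hPinv : ∀ i t y, P i (sideFlow μ he i t +ᵥ y) = P i y := by
    intro i t y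
    refine Finset.prod_congr rfl fun ε hε => ?_
    rw [Finset.mem_filter] at hε
    rw [sideFlow_vadd_apply, ← hε.2, hι, if_pos rfl, zero_vadd]
  have hprod : ∀ y, (offBase ⁻¹' Set.univ.pi B).indicator (fun _ => (1 : ℝ)) y =
      P 0 y * ∏ j : Fin n, P j.succ y := by
    intro y
    rw [← Fin.prod_univ_succ (fun i => P i y)]
    simp only [P]
    rw [Finset.prod_fiberwise]
    by_cases hy : y ∈ offBase ⁻¹' Set.univ.pi B
    · rw [Set.indicator_of_mem hy, Finset.prod_eq_one]
      intro ε _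
      exact Set.indicator_of_mem (hy ε (Set.mem_univ _)) _
    · rw [Set.indicator_of_notMem hy]
      have : ∃ ε, y ε.1 ∉ B ε := by
        by_contra hc
        push Not at hc
        exact hy fun ε _ => hc ε
      obtain ⟨ε, hε⟩ := this
      rw [Finset.prod_eq_zero (Finset.mem_univ ε) (Set.indicator_of_notMem hε _)]
  have hS : MeasurableSet (offBase (X := X) (k := n + 1) ⁻¹' Set.univ.pi B) :=
    measurable_offBase (MeasurableSet.univ_pi hB')
  have hkey : ∀ T, pointedAverage (sideFlow μ he 0)
      (fun j => sideFlow μ he 0 + sideFlow μ he j.succ)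
      ((offBase ⁻¹' Set.univ.pi B).indicator fun _ => (1 : ℝ)) g T = fun y => P 0 y *
        multiFlowAverage (fun j => sideFlow μ he 0 + sideFlow μ he j.succ)
          (fun j y => P j.succ y * g j y) T y := by
    intro T
    funext y
    rw [pointedAverage, multiFlowAverage, ← integral_const_mul]
    congr 1
    funext t
    have h1 : ∀ j : Fin n, P j.succ ((sideFlow μ he 0 + sideFlow μ he j.succ) t +ᵥ y) =
        P j.succ (sideFlow μ he 0 t +ᵥ y) := fun j => by
      rw [AddMonoidHom.add_apply, add_comm (sideFlow μ he 0 t), add_vadd, hPinv]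
    rw [hprod, hPinv]
    simp only [Finset.prod_mul_distrib, h1]
    ring
  refine (ih (fun j y => P j.succ y * g j y) fun j => (hP _).mul (hg j)).of_le (fun T =>
    (unitBounded_pointedAverage (hm 0) hb (UnitBounded.indicator hS) hg
      T).measurable.aestronglyMeasurable) fun S T => ?_
  rw [hkey, hkey]
  refine eLpNorm_mono fun y => ?_
  simp only [Pi.sub_apply, ← mul_sub, norm_mul]
  exact mul_le_of_le_one_left (norm_nonneg _) ((hP 0).bound y)

/-- For every bounded `f` there is a bounded `φ` such that `f - φ` has vanishing seminorm and `φ`,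
placed at the coordinate `0` of the cube, is a function of the other coordinates. -/
theorem exists_cubeForm_sub_eq_zero (he : ∀ i, IsMeasurableFlow X (e i)) {f : X → ℝ}
    (hf : UnitBounded f) :
    ∃ φ : X → ℝ, UnitBounded φ ∧ cubeForm μ e (fun x => (f x - φ x) / 2) = 0 ∧
      ∃ p : (OffBase (n + 1) → X) → ℝ, UnitBounded p ∧
        (fun y => φ (y fun _ => false)) =ᵐ[(cubeMeasure μ e : Measure (Cube X (n + 1)))]
          fun y => p (offBase y) := by
  set ν : Measure (Cube X (n + 1)) := (cubeMeasure μ e : Measure (Cube X (n + 1)))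
  have hm : offBaseSigma X (n + 1) ≤ (inferInstance : MeasurableSpace (Cube X (n + 1))) :=
    measurable_offBase.comap_le
  obtain ⟨φ, hφ, hφf⟩ := exists_condExp_offBase_ae_eq μ he hf
  have hf0 : UnitBounded fun y : Cube X (n + 1) => f (y fun _ => false) :=
    hf.comp (measurable_pi_apply _)
  have hφ0 : UnitBounded fun y : Cube X (n + 1) => φ (y fun _ => false) :=
    hφ.comp (measurable_pi_apply _)
  refine ⟨φ, hφ, ?_, ?_⟩
  · rw [cubeForm_eq_zero_iff μ he (hf.half_sub hφ)]
    have e1 : (fun y : Cube X (n + 1) => (f (y fun _ => false) - φ (y fun _ => false)) / 2) =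
        (1 / 2 : ℝ) • ((fun y : Cube X (n + 1) => f (y fun _ => false)) -
          fun y : Cube X (n + 1) => φ (y fun _ => false)) := by
      funext y
      simp only [Pi.smul_apply, Pi.sub_apply, smul_eq_mul]
      ring
    rw [e1]
    have e2 : ν[fun y => φ (y fun _ => false) | offBaseSigma X (n + 1)] =ᵐ[ν]
        ν[fun y => f (y fun _ => false) | offBaseSigma X (n + 1)] := by
      refine (condExp_congr_ae hφf.symm).trans ?_
      rw [condExp_of_stronglyMeasurable hm stronglyMeasurable_condExp integrable_condExp]
    refine (condExp_smul _ _ _).trans ?_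
    filter_upwards [condExp_sub (hf0.integrable ν) (hφ0.integrable ν) (offBaseSigma X (n + 1)),
      e2] with y h1 h2
    rw [Pi.smul_apply, h1, Pi.sub_apply, h2, sub_self, smul_zero, Pi.zero_apply]
  · obtain ⟨P, hPm, hPb, hP⟩ := UnitBounded.exists_condExp (offBaseSigma X (n + 1)) hf0 ν
    obtain ⟨p, hpm, hp⟩ := hPm.exists_eq_measurable_comp
    refine ⟨fun z => max (-1) (min 1 (p z)), ⟨measurable_const.max (measurable_const.min hpm),
      fun z => by rw [abs_le]; exact ⟨le_max_left _ _, max_le (by norm_num) (min_le_left _ _)⟩⟩, ?_⟩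
    filter_upwards [hP, hφf] with y h1 h2
    have h3 := abs_le.1 (hPb y)
    have h4 : P y = p (offBase y) := congrFun hp y
    rw [h4] at h1 h3
    rw [min_eq_right h3.2, max_eq_right h3.1, h1, h2]

end Convergence

/-- Mean convergence of multiple averages along commuting flows, in Cauchy form. -/
theorem isL2Cauchy_multiFlowAverage (n : ℕ) {G : Type*} [AddCommGroup G] {X : Type*}
    [AddAction G X] [MeasurableSpace X] [MeasurableConstVAdd G X] [StandardBorelSpace X]
    (μ : ProbabilityMeasure X) [VAddInvariantMeasure G X (μ : Measure X)] {c : Fin n → ℝ →+ G}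
    (hc : ∀ i, IsMeasurableFlow X (c i)) {f : Fin n → X → ℝ} (hf : ∀ i, UnitBounded (f i)) :
    IsL2Cauchy (μ : Measure X) (multiFlowAverage c f) := by
  induction n generalizing G X with
  | zero =>
    have h : ∀ T, multiFlowAverage c f T = fun _ => 1 := fun T => by
      funext x; simp [multiFlowAverage]
    refine ⟨fun T => ?_, ?_⟩
    · rw [h]; exact aestronglyMeasurable_const
    · simp [h]
  | succ n ih =>
    set a := c 0 with hadef
    set b : Fin n → ℝ →+ G := fun j => c j.succ with hbdef
    set g : Fin n → X → ℝ := fun j => f j.succ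
    have ha : IsMeasurableFlow X a := hc 0
    have hb : ∀ j, IsMeasurableFlow X (b j) := fun j => hc _
    have hg : ∀ j, UnitBounded (g j) := fun j => hf _
    set e := pointedFlows a b with hedef
    have he := isMeasurableFlow_pointedFlows ha hb
    have e0 : multiFlowAverage c f = pointedAverage a b (f 0) g := by
      funext T x
      simp only [multiFlowAverage, pointedAverage, Fin.prod_univ_succ]
      rfl
    rw [e0]
    obtain ⟨φ, hφ, h0, p, hp, hφp⟩ := exists_cubeForm_sub_eq_zero μ he (hf 0)
    have hd := (hf 0).half_sub hφ
    have hmeas : ∀ {u : X → ℝ}, UnitBounded u → ∀ T,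
        AEStronglyMeasurable (pointedAverage a b u g T) (μ : Measure X) := fun hu T =>
      (unitBounded_pointedAverage ha hb hu hg T).measurable.aestronglyMeasurable
    have h1 : IsL2Cauchy (μ : Measure X)
        (pointedAverage a b (fun x => (f 0 x - φ x) / 2) g) := by
      refine IsL2Cauchy.of_tendsto (L := 0) (hmeas hd) aestronglyMeasurable_zero ?_
      refine (tendsto_eLpNorm_two_iff (Eventually.of_forall fun T => ?_)).2 ?_
      · rw [sub_zero]; exact (unitBounded_pointedAverage ha hb hd hg T).memLp _ 2
      · simp only [sub_zero, Real.norm_eq_abs, sq_abs]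
        exact tendsto_integral_sq_pointedAverage_zero μ ha hb hd hg h0
    have h2 : IsL2Cauchy (μ : Measure X) (pointedAverage a b φ g) := by
      have hev := measurePreserving_cube_eval μ e fun _ => false
      -- the average of `φ` is lifted to the cube, on which the flow `a*` moves the coordinate `0`
      -- along `a` and the flow `a* + e_{j+1}*` moves it along `bⱼ`
      rw [← IsL2Cauchy.comp_iff hev (hmeas hφ)]
      have hm := isMeasurableFlow_sideFlow μ he
      have hφ0 : UnitBounded fun y : Cube X (n + 1) => φ (y fun _ => false) :=
        hφ.comp (measurable_pi_apply _)
      have hg0 : ∀ j, UnitBounded fun y : Cube X (n + 1) => g j (y fun _ => false) := fun j =>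
        (hg j).comp (measurable_pi_apply _)
      have e1 : (fun T => pointedAverage a b φ g T ∘ fun y : Cube X (n + 1) => y fun _ => false) =
          pointedAverage (sideFlow μ he 0) (fun j => sideFlow μ he 0 + sideFlow μ he j.succ)
            (fun y => φ (y fun _ => false)) fun j y => g j (y fun _ => false) := by
        funext T y
        simp only [pointedAverage, Function.comp_apply]
        congr 1
        funext t
        congr 1
        refine Finset.prod_congr rfl fun j _ => ?_
        rw [AddMonoidHom.add_apply, add_vadd]
        change g j (b j t +ᵥ _) = g j (a t +ᵥ ((b j - a) t +ᵥ _))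
        rw [vadd_vadd, ← AddMonoidHom.add_apply, add_sub_cancel]
      rw [e1]
      refine isL2Cauchy_pointedAverage_of_approx _ (hm 0) (fun j => (hm 0).add (hm _)) hφ0 hg0
        fun ε hε => ⟨fun y => p (offBase y), hp.comp measurable_offBase,
          isL2Cauchy_pointedAverage_offBase μ he hg0
            (fun h hh => ih (cubeMeasure μ e) (fun j => (hm 0).add (hm _)) hh) hp, ?_⟩
      have : eLpNorm ((fun y : Cube X (n + 1) => φ (y fun _ => false)) -
          fun y => p (offBase y)) 2 (cubeMeasure μ e : Measure (Cube X (n + 1))) = 0 := by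
        rw [eLpNorm_congr_ae (g := 0), eLpNorm_zero]
        filter_upwards [hφp] with y hy
        rw [Pi.sub_apply, hy, sub_self, Pi.zero_apply]
      rw [this]
      exact zero_le
    have e2 : pointedAverage a b (f 0) g = fun T =>
        (2 : ℝ) • pointedAverage a b (fun x => (f 0 x - φ x) / 2) g T +
          pointedAverage a b φ g T := by
      funext T
      rw [← pointedAverage_sub ha hb (hf 0) hφ hg, sub_add_cancel]
    rw [e2]
    exact (h1.const_smul (2 : ℝ)).add h2

/-! ### Completeness, and limits in mean versus pointwise limits -/

section Limits

variable {𝕜 : Type*} [RCLike 𝕜] {X : Type*} [MeasurableSpace X] {μ : Measure X}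

theorem IsL2Cauchy.congr_ae {E : Type*} [NormedAddCommGroup E] {u v : ℝ → X → E}
    (hv : IsL2Cauchy μ v) (h : ∀ T, u T =ᵐ[μ] v T) : IsL2Cauchy μ u :=
  ⟨fun T => (hv.1 T).congr (h T).symm, hv.tendsto.congr fun p =>
    (eLpNorm_congr_ae ((h p.1).sub (h p.2))).symm⟩

/-- Completeness of `L²`, for families indexed by a real parameter. -/
theorem IsL2Cauchy.exists_tendsto {u : ℝ → X → 𝕜} (hu : IsL2Cauchy μ u)
    (hm : ∀ T, MemLp (u T) 2 μ) :
    ∃ L : X → 𝕜, MemLp L 2 μ ∧ Tendsto (fun T => eLpNorm (u T - L) 2 μ) atTop (𝓝 0) := by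
  have hc : Cauchy (Filter.map (fun T => (hm T).toLp (u T)) atTop) := by
    refine cauchy_map_iff'.2 (uniformity_basis_edist.tendsto_right_iff.2 fun ε hε => ?_)
    filter_upwards [hu.tendsto.eventually (gt_mem_nhds hε)] with p hp
    change edist ((hm p.1).toLp _) ((hm p.2).toLp _) < ε
    rwa [Lp.edist_toLp_toLp]
  obtain ⟨L, hL⟩ := cauchy_map_iff_exists_tendsto.1 hc
  refine ⟨L, Lp.memLp L, ((Lp.tendsto_Lp_iff_tendsto_eLpNorm' _ _).1 hL).congr fun T =>
    eLpNorm_congr_ae ?_⟩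
  filter_upwards [(hm T).coeFn_toLp] with x hx
  simp [hx]

/-- A pointwise limit agrees with the limit in mean, which is an almost everywhere limit along a
subsequence. -/
theorem TendstoInL2.ae_eq_of_ae_tendsto {F : ℝ → X → 𝕜} {L g : X → 𝕜} (h : TendstoInL2 μ F L)
    (hg : ∀ᵐ x ∂μ, Tendsto (fun T => F T x) atTop (𝓝 (g x))) : g =ᵐ[μ] L := by
  obtain ⟨hF, hL, hlim⟩ := h
  have hs : Tendsto (fun N : ℕ => (N : ℝ) + 1) atTop atTop :=
    tendsto_atTop_add_const_right _ _ tendsto_natCast_atTop_atTop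
  obtain ⟨ns, hns, hae⟩ := (tendstoInMeasure_of_tendsto_eLpNorm (p := 2) (by norm_num)
    (fun N : ℕ => (hF ((N : ℝ) + 1) (by positivity)).aestronglyMeasurable)
    hL.aestronglyMeasurable (hlim.comp hs)).exists_seq_tendsto_ae
  filter_upwards [hg, hae] with x h1 h2
  exact tendsto_nhds_unique (h1.comp (hs.comp hns.tendsto_atTop)) h2

theorem TendstoInL2.congr_of_sub {F F' : ℝ → X → 𝕜} {L : X → 𝕜} (h : TendstoInL2 μ F L)
    (hF' : ∀ T > 0, MemLp (F' T) 2 μ)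
    (hd : Tendsto (fun T => eLpNorm (F' T - F T) 2 μ) atTop (𝓝 0)) : TendstoInL2 μ F' L := by
  refine ⟨hF', h.2.1, ?_⟩
  have h0 := hd.add h.2.2
  rw [add_zero] at h0
  refine tendsto_of_tendsto_of_tendsto_of_le_of_le' tendsto_const_nhds h0
    (Eventually.of_forall fun _ => zero_le) ?_
  filter_upwards [eventually_gt_atTop 0] with T hT
  have e : F' T - L = (F' T - F T) + (F T - L) := by abel
  rw [e]
  exact eLpNorm_add_le ((hF' T hT).sub (h.1 T hT)).aestronglyMeasurable
    ((h.1 T hT).sub h.2.1).aestronglyMeasurable (by norm_num)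

end Limits

/-! ### Real and complex bounded functions -/

section Scalars

variable {𝕜 : Type*} [RCLike 𝕜] {G : Type*} [AddCommGroup G] {X : Type*} [AddAction G X]
  [MeasurableSpace X] [MeasurableConstVAdd G X] {n : ℕ} {c : Fin n → ℝ →+ G}

omit [RCLike 𝕜] in
theorem ae_ae_forall_eq_of_ae_eq (μ : Measure X) [IsProbabilityMeasure μ]
    [VAddInvariantMeasure G X μ] (hc : ∀ i, IsMeasurableFlow X (c i)) {f f' : Fin n → X → 𝕜}
    (h : ∀ i, f i =ᵐ[μ] f' i) (T : ℝ) :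
    ∀ᵐ x ∂μ, ∀ᵐ t ∂uniformTime T, ∀ i, f i (c i t +ᵥ x) = f' i (c i t +ᵥ x) := by
  refine Measure.ae_ae_of_ae_prod (p := fun z : X × ℝ => ∀ i, f i (c i z.2 +ᵥ z.1) =
    f' i (c i z.2 +ᵥ z.1)) (ae_all_iff.2 fun i => ?_)
  exact (QuasiMeasurePreserving.prod_of_left
    (f := fun z : X × ℝ => c i z.2 +ᵥ z.1) ((hc i).vadd measurable_snd measurable_fst)
    (ae_of_all _ fun t => (measurePreserving_vadd (c i t) μ).quasiMeasurePreserving)).ae (h i)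

theorem multiFlowAverage_congr_ae (μ : Measure X) [IsProbabilityMeasure μ]
    [VAddInvariantMeasure G X μ] (hc : ∀ i, IsMeasurableFlow X (c i)) {f f' : Fin n → X → 𝕜}
    (h : ∀ i, f i =ᵐ[μ] f' i) (T : ℝ) :
    multiFlowAverage c f T =ᵐ[μ] multiFlowAverage c f' T := by
  filter_upwards [ae_ae_forall_eq_of_ae_eq μ hc h T] with x hx
  refine integral_congr_ae ?_
  filter_upwards [hx] with t ht
  exact Finset.prod_congr rfl fun i _ => ht i

omit [MeasurableConstVAdd G X] in
theorem unitBounded_multiFlowProduct (hc : ∀ i, IsMeasurableFlow X (c i)) {h : Fin n → X → ℝ}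
    (hh : ∀ i, UnitBounded (h i)) :
    UnitBounded fun p : ℝ × X => ∏ i, h i (c i p.1 +ᵥ p.2) :=
  UnitBounded.prod fun i => (hh i).comp (φ := fun p : ℝ × X => c i p.1 +ᵥ p.2) (hc i)

theorem prod_sum_mul_ofReal (z : Fin n → Bool → 𝕜) (r : Fin n → Bool → ℝ) :
    ∏ i, ∑ k, z i k * (r i k : 𝕜) =
      ∑ κ : Fin n → Bool, (∏ i, z i (κ i)) * ((∏ i, r i (κ i) : ℝ) : 𝕜) := by
  rw [Finset.prod_univ_sum, Fintype.piFinset_univ]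
  refine Finset.sum_congr rfl fun κ _ => ?_
  rw [Finset.prod_mul_distrib, RCLike.ofReal_prod]

omit [MeasurableConstVAdd G X] in
/-- Expansion of the averages of combinations of two real functions into averages of real
functions. -/
theorem multiFlowAverage_expand (hc : ∀ i, IsMeasurableFlow X (c i)) (z : Fin n → Bool → 𝕜)
    {h : Fin n → Bool → X → ℝ} (hh : ∀ i k, UnitBounded (h i k)) (T : ℝ) :
    multiFlowAverage c (fun i x => ∑ k, z i k * (h i k x : 𝕜)) T =
      ∑ κ : Fin n → Bool, (∏ i, z i (κ i)) •
        fun x => ((multiFlowAverage c (fun i => h i (κ i)) T x : ℝ) : 𝕜) := by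
  funext x
  simp only [multiFlowAverage, Finset.sum_apply, Pi.smul_apply, smul_eq_mul]
  simp only [prod_sum_mul_ofReal z fun i k => h i k _]
  rw [integral_finsetSum]
  · refine Finset.sum_congr rfl fun κ _ => ?_
    rw [integral_const_mul]
    congr 1
    exact integral_ofReal
  · intro κ _
    exact ((((unitBounded_multiFlowProduct hc fun i => hh i (κ i)).comp (φ := fun t => (t, x))
      (by fun_prop)).integrable (uniformTime T)).ofReal (𝕜 := 𝕜)).const_mul _

/-- A bounded real or complex function is a combination of two real functions bounded by one,
which are positive multiples of its real and imaginary parts. -/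
theorem exists_decomposition {μ : Measure X} {f : X → 𝕜} (hf : MemLp f ∞ μ) :
    ∃ (C : Bool → ℝ) (h : Bool → X → ℝ), (∀ k, 0 < C k) ∧ (∀ k, UnitBounded (h k)) ∧
      ((fun x => RCLike.re (f x)) =ᵐ[μ] fun x => C true * h true x) ∧
      ((fun x => RCLike.im (f x)) =ᵐ[μ] fun x => C false * h false x) ∧
      f =ᵐ[μ] fun x => ∑ k, (if k then (C k : 𝕜) else C k * RCLike.I) * (h k x : 𝕜) := by
  obtain ⟨C₁, hC₁, h₁, hh₁, e₁⟩ := exists_unitBounded_of_memLp_top hf.re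
  obtain ⟨C₂, hC₂, h₂, hh₂, e₂⟩ := exists_unitBounded_of_memLp_top hf.im
  refine ⟨fun k => if k then C₁ else C₂, fun k => if k then h₁ else h₂, ?_, ?_, ?_, ?_, ?_⟩
  · intro k; cases k <;> simpa
  · intro k; cases k <;> simpa
  · simpa using e₁
  · simpa using e₂
  · filter_upwards [e₁, e₂] with x h1 h2
    rw [← RCLike.re_add_im (f x), h1, h2]
    simp
    ring

variable [StandardBorelSpace X] (μ : ProbabilityMeasure X)
  [VAddInvariantMeasure G X (μ : Measure X)]

omit [StandardBorelSpace X] in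
theorem ae_integrable_multiFlowProduct (hc : ∀ i, IsMeasurableFlow X (c i)) {f : Fin n → X → 𝕜}
    (hf : ∀ i, MemLp (f i) ∞ (μ : Measure X)) (T : ℝ) :
    ∀ᵐ x ∂(μ : Measure X), Integrable (fun t => ∏ i, f i (c i t +ᵥ x)) (uniformTime T) := by
  choose C h _ hh _ _ hfh using fun i => exists_decomposition (hf i)
  filter_upwards [ae_ae_forall_eq_of_ae_eq (μ : Measure X) hc hfh T] with x hx
  have hi : Integrable (fun t => ∏ i, ∑ k, (if k then (C i k : 𝕜) else C i k * RCLike.I) *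
      (h i k (c i t +ᵥ x) : 𝕜)) (uniformTime T) := by
    simp only [prod_sum_mul_ofReal (fun i k => if k then (C i k : 𝕜) else C i k * RCLike.I)
      fun i k => h i k _]
    refine integrable_finsetSum _ fun κ _ => ?_
    exact ((((unitBounded_multiFlowProduct hc fun i => hh i (κ i)).comp (φ := fun t => (t, x))
      (by fun_prop)).integrable (uniformTime T)).ofReal (𝕜 := 𝕜)).const_mul _
  refine hi.congr ?_
  filter_upwards [hx] with t ht
  exact Finset.prod_congr rfl fun i _ => (ht i).symm

omit [MeasurableConstVAdd G X] [StandardBorelSpace X]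
  [VAddInvariantMeasure G X (μ : Measure X)] in
theorem memLp_multiFlowAverage_ofReal (hc : ∀ i, IsMeasurableFlow X (c i)) {h : Fin n → X → ℝ}
    (hh : ∀ i, UnitBounded (h i)) (T : ℝ) :
    MemLp (fun x => ((multiFlowAverage c h T x : ℝ) : 𝕜)) 2 (μ : Measure X) := by
  have hu : UnitBounded (multiFlowAverage c h T) :=
    (unitBounded_multiFlowProduct hc hh).integral_left _
  exact (hu.memLp (μ : Measure X) 2).ofReal

/-- Mean convergence of the averages of bounded real or complex functions, in Cauchy form. -/
theorem isL2Cauchy_multiFlowAverage_of_memLp_top (hc : ∀ i, IsMeasurableFlow X (c i))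
    {f : Fin n → X → 𝕜} (hf : ∀ i, MemLp (f i) ∞ (μ : Measure X)) :
    IsL2Cauchy (μ : Measure X) (multiFlowAverage c f) ∧
      ∀ T, MemLp (multiFlowAverage c f T) 2 (μ : Measure X) := by
  choose C h _ hh _ _ hfh using fun i => exists_decomposition (hf i)
  have hexp := fun T => multiFlowAverage_congr_ae (μ : Measure X) hc hfh T
  simp only [multiFlowAverage_expand hc (fun i k => if k then (C i k : 𝕜) else C i k * RCLike.I)
    hh] at hexp
  refine ⟨IsL2Cauchy.congr_ae (IsL2Cauchy.sum fun κ => IsL2Cauchy.const_smul ?_ _) hexp,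
    fun T => (memLp_congr_ae (hexp T)).2 (memLp_finsetSum' _ fun κ _ =>
      (memLp_multiFlowAverage_ofReal μ hc (fun i => hh i (κ i)) T).const_smul _)⟩
  refine (isL2Cauchy_multiFlowAverage n μ hc fun i => hh i (κ i)).of_le
    (fun T => (memLp_multiFlowAverage_ofReal μ hc (fun i => hh i (κ i))
      T).aestronglyMeasurable) fun S T => eLpNorm_mono fun x => ?_
  simp only [Pi.sub_apply]
  rw [← RCLike.ofReal_sub, RCLike.norm_ofReal, Real.norm_eq_abs]

end Scalars

section CharacteristicFactor

variable {𝕜 : Type*} [RCLike 𝕜] {G : Type*} [AddCommGroup G] {X : Type*} [AddAction G X]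
  [MeasurableSpace X] [MeasurableConstVAdd G X] {d : ℕ} {c : Fin (d + 1) → ℝ →+ G}
  [StandardBorelSpace X] (μ : ProbabilityMeasure X) [VAddInvariantMeasure G X (μ : Measure X)]

/-- The one-parameter subgroups `cᵢ, cⱼ - cᵢ` (`j ≠ i`). -/
def factorFlows (c : Fin (d + 1) → ℝ →+ G) (i : Fin (d + 1)) : Fin (d + 1) → ℝ →+ G :=
  pointedFlows (c i) fun j => c (i.succAbove j)

/-- If one of the functions has vanishing conditional expectation on its characteristic factor, the
averages tend to zero. The real and imaginary parts of that function inherit the vanishing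
conditional expectation, hence have vanishing seminorm. -/
theorem tendsto_eLpNorm_multiFlowAverage_zero (hc : ∀ i, IsMeasurableFlow X (c i))
    {f : Fin (d + 1) → X → 𝕜} (hf : ∀ i, MemLp (f i) ∞ (μ : Measure X)) (i : Fin (d + 1))
    {Z : Fin (d + 1) → MeasurableSpace X}
    (hZ : IsHostKraFactor (Z i) μ fun k => (factorFlows c i k).range)
    (h0 : (μ : Measure X)[f i | Z i] =ᵐ[(μ : Measure X)] 0) :
    Tendsto (fun T => eLpNorm (multiFlowAverage c f T) 2 (μ : Measure X)) atTop (𝓝 0) := by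
  choose C h hC hh hre him hfh using fun i => exists_decomposition (hf i)
  have hflow : ∀ k, IsMeasurableFlow X (factorFlows c i k) :=
    isMeasurableFlow_pointedFlows (hc i) fun j => hc _
  have hfi : Integrable (f i) (μ : Measure X) := (hf i).integrable (by simp)
  have hform : ∀ k, cubeForm μ (factorFlows c i) (h i k) = 0 := by
    intro k
    cases k
    · rw [← hostKraSeminorm_eq_zero_iff μ hflow (hC i false).ne' (hh i false) (him i)]
      refine (hZ.2 _ (hf i).im).1 ?_
      have := ContinuousLinearMap.comp_condExp_comm (m := Z i) hfi (RCLike.imCLM (K := 𝕜))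
      refine this.symm.trans ?_
      filter_upwards [h0] with x hx
      simp [hx]
    · rw [← hostKraSeminorm_eq_zero_iff μ hflow (hC i true).ne' (hh i true) (hre i)]
      refine (hZ.2 _ (hf i).re).1 ?_
      have := ContinuousLinearMap.comp_condExp_comm (m := Z i) hfi (RCLike.reCLM (K := 𝕜))
      refine this.symm.trans ?_
      filter_upwards [h0] with x hx
      simp [hx]
  have hreal : ∀ κ : Fin (d + 1) → Bool, Tendsto (fun T => eLpNorm
      (fun x => ((multiFlowAverage c (fun j => h j (κ j)) T x : ℝ) : 𝕜)) 2 (μ : Measure X))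
      atTop (𝓝 0) := by
    intro κ
    refine (tendsto_eLpNorm_two_iff (Eventually.of_forall fun T =>
      memLp_multiFlowAverage_ofReal μ hc (fun j => hh j (κ j)) T)).2 ?_
    have := tendsto_integral_sq_pointedAverage_zero μ (hc i)
      (b := fun j => c (i.succAbove j)) (fun j => hc _) (hh i (κ i))
      (g := fun j => h (i.succAbove j) (κ (i.succAbove j))) (fun j => hh _ _) (hform (κ i))
    refine this.congr fun T => integral_congr_ae (ae_of_all _ fun x => ?_)
    simp only [RCLike.norm_ofReal, sq_abs, multiFlowAverage, Fin.prod_univ_succAbove _ i]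
    rfl
  have hexp := fun T => multiFlowAverage_congr_ae (μ : Measure X) hc hfh T
  simp only [multiFlowAverage_expand hc (fun i k => if k then (C i k : 𝕜) else C i k * RCLike.I)
    hh] at hexp
  have hsum := tendsto_finsetSum (Finset.univ : Finset (Fin (d + 1) → Bool)) fun κ _ =>
    ENNReal.Tendsto.const_mul
      (a := ‖∏ i, if κ i then (C i (κ i) : 𝕜) else C i (κ i) * RCLike.I‖ₑ) (hreal κ)
      (Or.inr (by simp))
  simp only [mul_zero, Finset.sum_const_zero] at hsum
  refine tendsto_of_tendsto_of_tendsto_of_le_of_le tendsto_const_nhds hsum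
    (fun _ => zero_le) fun T => ?_
  rw [eLpNorm_congr_ae (hexp T)]
  refine (eLpNorm_sum_le (fun κ _ => ((memLp_multiFlowAverage_ofReal μ hc (fun i => hh i (κ i))
    T).const_smul _).aestronglyMeasurable) (by norm_num)).trans ?_
  refine Finset.sum_le_sum fun κ _ => ?_
  rw [eLpNorm_const_smul]

/-- Replacing every function by its conditional expectation on the corresponding characteristic
factor does not change the averages asymptotically; the replacements are made one at a time. -/
theorem tendsto_eLpNorm_multiFlowAverage_condExp_sub (hc : ∀ i, IsMeasurableFlow X (c i))
    {f : Fin (d + 1) → X → 𝕜} (hf : ∀ i, MemLp (f i) ∞ (μ : Measure X))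
    {Z : Fin (d + 1) → MeasurableSpace X}
    (hZ : ∀ i, IsHostKraFactor (Z i) μ fun k => (factorFlows c i k).range) :
    Tendsto (fun T => eLpNorm (multiFlowAverage c (fun i => (μ : Measure X)[f i | Z i]) T -
      multiFlowAverage c f T) 2 (μ : Measure X)) atTop (𝓝 0) := by
  classical
  have hE : ∀ i, MemLp ((μ : Measure X)[f i | Z i]) ∞ (μ : Measure X) := fun i =>
    (hf i).condExp (by simp)
  let F : Finset (Fin (d + 1)) → Fin (d + 1) → X → 𝕜 := fun s i =>
    if i ∈ s then (μ : Measure X)[f i | Z i] else f i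
  have hF : ∀ s i, MemLp (F s i) ∞ (μ : Measure X) := by
    intro s i
    by_cases h : i ∈ s
    · simp only [F, h, if_true]; exact hE i
    · simp only [F, h, if_false]; exact hf i
  suffices h : ∀ s, Tendsto (fun T => eLpNorm (multiFlowAverage c (F s) T -
      multiFlowAverage c f T) 2 (μ : Measure X)) atTop (𝓝 0) by
    simpa [F] using h Finset.univ
  intro s
  induction s using Finset.induction_on with
  | empty => simp [F]
  | insert i s hi ih =>
    let D : Fin (d + 1) → X → 𝕜 := fun j =>
      if j = i then (μ : Measure X)[f i | Z i] - f i else F s j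
    have hD : ∀ j, MemLp (D j) ∞ (μ : Measure X) := by
      intro j
      by_cases h : j = i
      · simp only [D, h, if_true]; exact (hE i).sub (hf i)
      · simp only [D, h, if_false]; exact hF s j
    have hDi : D i = (μ : Measure X)[f i | Z i] - f i := by simp [D]
    have hfi : Integrable (f i) (μ : Measure X) := (hf i).integrable (by simp)
    have hDZ : (μ : Measure X)[D i | Z i] =ᵐ[(μ : Measure X)] 0 := by
      rw [hDi]
      refine (condExp_sub integrable_condExp hfi _).trans ?_
      rw [condExp_of_stronglyMeasurable (hZ i).1 stronglyMeasurable_condExp integrable_condExp,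
        sub_self]
    have hlim := (tendsto_eLpNorm_multiFlowAverage_zero μ hc hD i (hZ i) hDZ).add ih
    rw [add_zero] at hlim
    have hmem := fun u : Finset (Fin (d + 1)) =>
      (isL2Cauchy_multiFlowAverage_of_memLp_top μ hc (hF u)).2
    refine tendsto_of_tendsto_of_tendsto_of_le_of_le tendsto_const_nhds hlim
      (fun _ => zero_le) fun T => ?_
    have hstep : multiFlowAverage c (F (insert i s)) T - multiFlowAverage c (F s) T
        =ᵐ[(μ : Measure X)] multiFlowAverage c D T := by
      filter_upwards [ae_integrable_multiFlowProduct μ hc (hF (insert i s)) T,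
        ae_integrable_multiFlowProduct μ hc (hF s) T] with x h1 h2
      rw [Pi.sub_apply, multiFlowAverage, multiFlowAverage, multiFlowAverage, ← integral_sub h1 h2]
      congr 1
      funext t
      have hne : ∀ j, i.succAbove j ≠ i := fun j => Fin.succAbove_ne i j
      simp only [Fin.prod_univ_succAbove _ i]
      simp [F, D, hi, hne, sub_mul]
    have e : multiFlowAverage c (F (insert i s)) T - multiFlowAverage c f T =
        (multiFlowAverage c (F (insert i s)) T - multiFlowAverage c (F s) T) +
          (multiFlowAverage c (F s) T - multiFlowAverage c f T) := by abel
    have hmf := (isL2Cauchy_multiFlowAverage_of_memLp_top μ hc hf).2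
    rw [e, ← eLpNorm_congr_ae hstep]
    exact eLpNorm_add_le ((hmem _ T).sub (hmem _ T)).aestronglyMeasurable
      ((hmem _ T).sub (hmf T)).aestronglyMeasurable (by norm_num)

end CharacteristicFactor

/-! ### The multiple averages of a vector space action -/

section Vector

variable {E : Type*} [AddCommGroup E] [Module ℝ E]

/-- The one-parameter subgroup `t ↦ t • v`. -/
def lineFlow (v : E) : ℝ →+ E := (LinearMap.toSpanSingleton ℝ E v).toAddMonoidHom

theorem lineFlow_apply (v : E) (t : ℝ) : lineFlow v t = t • v := rfl

theorem range_lineFlow (v : E) : (lineFlow v).range = (Submodule.span ℝ {v}).toAddSubgroup := by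
  ext w
  simp only [AddMonoidHom.mem_range, lineFlow_apply, Submodule.mem_toAddSubgroup,
    Submodule.mem_span_singleton]

theorem lineFlow_sub (v w : E) : lineFlow v - lineFlow w = lineFlow (v - w) := by
  ext t
  simp [lineFlow_apply, smul_sub]

theorem factorSubgroups_eq_range {d : ℕ} (α : Fin (d + 1) → E) (i : Fin (d + 1)) :
    factorSubgroups α i = fun k => (factorFlows (fun j => lineFlow (α j)) i k).range := by
  funext k
  refine Fin.cases ?_ (fun j => ?_) k
  · exact (range_lineFlow _).symm
  · change _ = (lineFlow (α (i.succAbove j)) - lineFlow (α i)).range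
    rw [lineFlow_sub, range_lineFlow]
    rfl

theorem multipleAverage_eq_multiFlowAverage {𝕜 : Type*} [RCLike 𝕜] {X : Type*} [AddAction E X]
    {n : ℕ} (α : Fin n → E) (f : Fin n → X → 𝕜) {T : ℝ} (hT : 0 < T) :
    multipleAverage α f T = multiFlowAverage (fun i => lineFlow (α i)) f T := by
  funext x
  rw [multiFlowAverage, integral_uniformTime hT]
  rfl

end Vector

theorem mainTheorem7 {𝕜 : Type*} [RCLike 𝕜] (m d : ℕ)
    {X : Type*} [MeasurableSpace X] [StandardBorelSpace X]
    [AddAction (EuclideanSpace ℝ (Fin m)) X] [MeasurableVAdd₂ (EuclideanSpace ℝ (Fin m)) X]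
    (μ : ProbabilityMeasure X)
    [VAddInvariantMeasure (EuclideanSpace ℝ (Fin m)) X (μ : Measure X)]
    (α : Fin (d + 1) → EuclideanSpace ℝ (Fin m)) :
    (∃ Z : Fin (d + 1) → MeasurableSpace X, ∀ i, IsHostKraFactor (Z i) μ (factorSubgroups α i)) ∧
    ∀ Z : Fin (d + 1) → MeasurableSpace X,
      (∀ i, IsHostKraFactor (Z i) μ (factorSubgroups α i)) →
      ∀ f : Fin (d + 1) → X → 𝕜, (∀ i, MemLp (f i) ∞ (μ : Measure X)) →
        (∃ L : X → 𝕜,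
          TendstoInL2 (μ : Measure X) (multipleAverage α f) L ∧
          TendstoInL2 (μ : Measure X)
            (multipleAverage α fun i => (μ : Measure X)[f i | Z i]) L) ∧
        ∀ g g' : X → 𝕜,
          (∀ᵐ x ∂(μ : Measure X),
            Tendsto (fun T => multipleAverage α f T x) atTop (𝓝 (g x))) →
          (∀ᵐ x ∂(μ : Measure X),
            Tendsto (fun T => multipleAverage α (fun i => (μ : Measure X)[f i | Z i]) T x)
              atTop (𝓝 (g' x))) →
          g =ᵐ[(μ : Measure X)] g' := by
  set c : Fin (d + 1) → ℝ →+ EuclideanSpace ℝ (Fin m) := fun i => lineFlow (α i) with hcdef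
  have hc : ∀ i, IsMeasurableFlow X (c i) := fun i => by
    have h : Measurable fun p : ℝ × X => (p.1 • α i, p.2) := by fun_prop
    exact (measurable_vadd (M := EuclideanSpace ℝ (Fin m)) (α := X)).comp h
  simp only [factorSubgroups_eq_range]
  refine ⟨⟨fun i => hostKraFactor μ (factorFlows c i), fun i => isHostKraFactor_hostKraFactor μ
    (isMeasurableFlow_pointedFlows (hc i) fun j => hc _)⟩, fun Z hZ f hf => ?_⟩
  have hE : ∀ i, MemLp ((μ : Measure X)[f i | Z i]) ∞ (μ : Measure X) := fun i =>
    (hf i).condExp (by simp)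
  obtain ⟨hCauchy, hmem⟩ := isL2Cauchy_multiFlowAverage_of_memLp_top μ hc hf
  have hmem' := (isL2Cauchy_multiFlowAverage_of_memLp_top μ hc hE).2
  obtain ⟨L, hL, hlim⟩ := hCauchy.exists_tendsto hmem
  have h1 : TendstoInL2 (μ : Measure X) (multipleAverage α f) L := by
    refine ⟨fun T hT => by rw [multipleAverage_eq_multiFlowAverage α f hT]; exact hmem T, hL,
      hlim.congr' ?_⟩
    filter_upwards [eventually_gt_atTop 0] with T hT
    rw [multipleAverage_eq_multiFlowAverage α f hT]
  have h2 : TendstoInL2 (μ : Measure X)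
      (multipleAverage α fun i => (μ : Measure X)[f i | Z i]) L := by
    refine h1.congr_of_sub (fun T hT => by
      rw [multipleAverage_eq_multiFlowAverage α _ hT]; exact hmem' T)
      ((tendsto_eLpNorm_multiFlowAverage_condExp_sub μ hc hf hZ).congr' ?_)
    filter_upwards [eventually_gt_atTop 0] with T hT
    rw [multipleAverage_eq_multiFlowAverage α f hT, multipleAverage_eq_multiFlowAverage α _ hT]
  exact ⟨⟨L, h1, h2⟩, fun g g' hg hg' =>
    (h1.ae_eq_of_ae_tendsto hg).trans (h2.ae_eq_of_ae_tendsto hg').symm⟩
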